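/- Let $d\ge 2$ and $m\ge 1$ be integers and let $\mu>0$, $\lambda\in(0,1)$, $\tau>0$, $\kappa>0$. **Coefficients.** Let $A=(a_{ij}^{\alpha\beta}):\mathbb R^d\to\mathbb R^{(dm)^2}$ ($1\le i,j\le d$, $1\le\alpha,\beta\le m$) satisfy $a_{ij}^{\alpha\beta}=a_{ji}^{\beta\alpha}$; $\mu|\xi|^2\le a_{ij}^{\alpha\beta}(y)\xi_i^\alpha\xi_j^\beta\le\mu^{-1}|\xi|^2$ for all $y\in\mathbb R^d$, $\xi\in\mathbb R^{dm}$; $A(y+\mathbf n)=A(y)$ for $\mathbf n\in\mathbb Z^d$; and $|A(y)-A(w)|\le\tau|y-w|^\lambda$. **Geometry.** Let $Y=(-\tfrac12,\tfrac12)^d$, let $\omega\subset Y$ be a simply connected domain with Lipschitz boundary and $\mathrm{dist}(\omega,\partial Y)>0$, and let $\Omega\subset\mathbb R^d$ be a bounded Lipschitz domain. For $\varepsilon\in(0,1)$ put $\omega_\varepsilon^{\mathbf n}=\varepsilon(\mathbf n+\omega)$, let $D_\varepsilon$ be the union of all $\omega_\varepsilon^{\mathbf n}$, $\mathbf n\in\mathbb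 Z^d$, with $\omega_\varepsilon^{\mathbf n}\subset\Omega$ and $\mathrm{dist}(\omega_\varepsilon^{\mathbf n},\partial\Omega)>\kappa\varepsilon$, and put $\Omega_\varepsilon=\Omega\setminus\overline{D_\varepsilon}$. For $\delta>1$ let $\Lambda_{\varepsilon,\delta}=\delta\mathbf 1_{D_\varepsilon}+\mathbf 1_{\Omega_\varepsilon}$ and $\mathcal L_{\varepsilon,\delta}(u)=-\mathrm{div}\,[\Lambda_{\varepsilon,\delta}(x)A(x/\varepsilon)\nabla u]$. **Boundary cylinders.** Fix $M\ge0$ and $M_0>0$. A boundary chart of radius $r_0>0$ at $x_0\in\partial\Omega$ consists of a rigid motion $\Phi:\mathbb R^{d-1}\times\mathbb R\to\mathbb R^d$ with $\Phi(0,0)=x_0$ and a function $\psi:\mathbb R^{d-1}\to\mathbb R$ that is Lipschitz with constant $M$, with $\psi(0)=0$, such that for $|x'|<r_0$ and $|z-\psi(x')|<M_0r_0$ one has $\Phi(x',z)\in\Omega$ if and only if $z>\psi(x')$. For $0<r<r_0$ let $$\mathbf D_r=\Phi\{(x',z): |x'|<r,\ 0<z-\psi(x')<M_0r\},\qquad \Delta_r=\partial\mathbf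 D_r\cap\partial\Omega .$$ **Theorem.** For every integer $\ell\ge1$ there is a constant $C_\ell>0$, depending only on $d,m,\mu,\lambda,\tau,\kappa,\omega,\Omega,M,M_0$ and $\ell$, such that the following holds for all $A$ as above, all $\varepsilon\in(0,1)$, all $\delta\in(1,\infty)$, all $R\ge32\varepsilon$, and all boundary charts of radius $r_0>2R$ at points of $\partial\Omega$. Let $f\in L^2(\mathbf D_{2R};\mathbb R^m)$, let $g:\Delta_{2R}\to\mathbb R^m$ be Lipschitz, and let $u\in H^1(\mathbf D_{2R};\mathbb R^m)$ be a weak solution of $\mathcal L_{\varepsilon,\delta}(u)=f$ in $\mathbf D_{2R}$ with $u=g$ on $\Delta_{2R}$ in the sense of traces. Then $$\int_{\mathbf D_{3R/2}}|\nabla u|^2\le \frac{C_\ell}{R^2}\int_{\mathbf D_{2R}}|u|^2+C_\ell\Big(\frac{\varepsilon}{R}\Big)^{2\ell}\int_{\mathbf D_{2R}}|\nabla u|^2+C_\ell\Big(R^2\int_{\mathbf D_{2R}}|f|^2+\frac1{R^2}\|g\|_{L^\infty(\Delta_{2R})}^2+\|\nabla_{\tan}g\|_{L^\infty(\Delta_{2R})}^2\Big),$$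 where $\nabla_{\tan}g$ is the tangential gradient of $g$ on $\Delta_{2R}$, defined almost everywhere for surface measure. -/

import Mathlib

open MeasureTheory Filter Topology Set
open scoped ENNReal NNReal

noncomputable section

namespace HighContrast

/-- The Euclidean space `ℝⁿ`. -/
abbrev Rn (n : ℕ) : Type := EuclideanSpace ℝ (Fin n)

/-- The space `ℝ^{dm}` of gradients of maps `ℝᵈ → ℝᵐ`, with the Euclidean norm; the entry with index
`(α, i)` of the gradient of `u` is `∂ᵢ u^α`. -/
abbrev Grad (d m : ℕ) : Type := EuclideanSpace ℝ (Fin m × Fin d)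

/-- The entries `(α, i) ↦ (L eᵢ)^α` of a linear map `L : ℝᵈ → ℝᵐ`. -/
def gradOf {d m : ℕ} (L : Rn d →L[ℝ] Rn m) : Grad d m :=
  WithLp.toLp 2 fun p => L (EuclideanSpace.single p.2 1) p.1

/-! ### Coefficients -/

/-- A coefficient tensor `A = (a_{ij}^{αβ})` on `ℝᵈ`: the entry `A y (α, i) (β, j)` is
`a_{ij}^{αβ}(y)`. -/
abbrev Coeff (d m : ℕ) : Type := Rn d → Matrix (Fin m × Fin d) (Fin m × Fin d) ℝ

/-- The point of `ℝᵈ` with the integer coordinates `k`. -/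
def latticePoint {d : ℕ} (k : Fin d → ℤ) : Rn d := WithLp.toLp 2 fun i => (k i : ℝ)

/-- The bilinear form `(ξ, η) ↦ a_{ij}^{αβ} ξ_j^β η_i^α`. -/
def bilin {d m : ℕ} (B : Matrix (Fin m × Fin d) (Fin m × Fin d) ℝ) (ξ η : Grad d m) : ℝ :=
  ∑ p, ∑ q, B p q * ξ q * η p

/-- Symmetry, strong ellipticity with constant `μ`, `ℤᵈ`-periodicity, and Hölder continuity with
exponent `lam` and constant `τ`. -/
structure IsAdmissibleCoeff {d m : ℕ} (μ lam τ : ℝ) (A : Coeff d m) : Prop where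
  symm : ∀ y, (A y).IsSymm
  lower : ∀ y ξ, μ * ‖ξ‖ ^ 2 ≤ bilin (A y) ξ ξ
  upper : ∀ y ξ, bilin (A y) ξ ξ ≤ μ⁻¹ * ‖ξ‖ ^ 2
  periodic : ∀ y (k : Fin d → ℤ), A (y + latticePoint k) = A y
  holder : ∀ y w, √(∑ p, ∑ q, (A y p q - A w p q) ^ 2) ≤ τ * ‖y - w‖ ^ lam

/-! ### Lipschitz domains and boundary cylinders -/

/-- Local coordinates `(x', z) ∈ ℝ^{d-1} × ℝ`, with the Euclidean norm. -/
abbrev Local (d : ℕ) : Type := WithLp 2 (Rn (d - 1) × ℝ)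

/-- A rigid change of coordinates from local coordinates to `ℝᵈ`. -/
abbrev Rigid (d : ℕ) : Type := Local d ≃ᵃⁱ[ℝ] Rn d

/-- `(Φ, ψ)` describes `Ω` near the boundary point `x₀`: `ψ` is Lipschitz with constant `M`, `Φ` maps
the origin to `x₀`, and inside the cylinder `|x'| < r₀`, `|z - ψ(x')| < M₀ r₀` the set `Ω` is exactly
the part above the graph of `ψ`. -/
structure IsBoundaryChart {d : ℕ} (Ω : Set (Rn d)) (x₀ : Rn d) (M : ℝ≥0) (M₀ r₀ : ℝ)
    (Φ : Rigid d) (ψ : Rn (d - 1) → ℝ) : Prop where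
  pos_height : 0 < M₀
  pos_radius : 0 < r₀
  lipschitz : LipschitzWith M ψ
  graph_origin : ψ 0 = 0
  map_origin : Φ 0 = x₀
  mem_iff : ∀ (x' : Rn (d - 1)) (z : ℝ), ‖x'‖ < r₀ → |z - ψ x'| < M₀ * r₀ →
    (Φ (WithLp.toLp 2 (x', z)) ∈ Ω ↔ ψ x' < z)

/-- Near each of its boundary points the set is, after a rigid motion, the region above the graph of
a Lipschitz function. -/
def HasLipschitzBoundary {d : ℕ} (Ω : Set (Rn d)) : Prop :=
  ∀ x₀ ∈ frontier Ω, ∃ (M : ℝ≥0) (M₀ r₀ : ℝ) (Φ : Rigid d) (ψ : Rn (d - 1) → ℝ),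
    IsBoundaryChart Ω x₀ M M₀ r₀ Φ ψ

/-- A bounded Lipschitz domain (open, connected, non-empty). -/
structure IsBoundedLipschitzDomain {d : ℕ} (Ω : Set (Rn d)) : Prop where
  isOpen : IsOpen Ω
  connected : IsConnected Ω
  bounded : Bornology.IsBounded Ω
  lipschitz : HasLipschitzBoundary Ω

/-- The boundary cylinder `D_r = Φ {(x', z) : |x'| < r, 0 < z - ψ(x') < M₀ r}`. -/
def boundaryCylinder {d : ℕ} (M₀ : ℝ) (Φ : Rigid d) (ψ : Rn (d - 1) → ℝ) (r : ℝ) : Set (Rn d) :=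
  Φ '' {p | ‖p.fst‖ < r ∧ 0 < p.snd - ψ p.fst ∧ p.snd - ψ p.fst < M₀ * r}

/-- The boundary portion `Δ_r = ∂D_r ∩ ∂Ω`. -/
def boundaryPortion {d : ℕ} (Ω : Set (Rn d)) (M₀ : ℝ) (Φ : Rigid d) (ψ : Rn (d - 1) → ℝ)
    (r : ℝ) : Set (Rn d) :=
  frontier (boundaryCylinder M₀ Φ ψ r) ∩ frontier Ω

/-- Surface measure on `Γ ⊆ ℝᵈ`: the `(d-1)`-dimensional Hausdorff measure restricted to `Γ`. -/
def surfaceMeasure {d : ℕ} (Γ : Set (Rn d)) : Measure (Rn d) :=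
  (μH[(d : ℝ) - 1] : Measure (Rn d)).restrict Γ

/-! ### Inclusions and the contrast function -/

/-- The open unit cell `Y = (-1/2, 1/2)ᵈ`. -/
def unitCell (d : ℕ) : Set (Rn d) := {y | ∀ i, -(1 / 2) < y i ∧ y i < 1 / 2}

/-- The distance between two sets. -/
def setEDist {d : ℕ} (S T : Set (Rn d)) : ℝ≥0∞ := ⨅ x ∈ S, ⨅ y ∈ T, edist x y

/-- A model inclusion: a simply connected Lipschitz domain in the unit cell, at positive distance
from the boundary of the cell. -/
structure IsModelInclusion {d : ℕ} (ω : Set (Rn d)) : Prop where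
  isOpen : IsOpen ω
  simplyConnected : IsSimplyConnected ω
  lipschitz : HasLipschitzBoundary ω
  subset_cell : ω ⊆ unitCell d
  dist_pos : 0 < setEDist ω (frontier (unitCell d))

/-- The scaled inclusion `ε (k + ω)`. -/
def inclusion {d : ℕ} (ω : Set (Rn d)) (ε : ℝ) (k : Fin d → ℤ) : Set (Rn d) :=
  (fun y => ε • (latticePoint k + y)) '' ω

/-- The union `D_ε` of those inclusions `ε (k + ω)` that lie in `Ω` at distance greater than `κ ε`
from the boundary of `Ω`. -/
def inclusions {d : ℕ} (ω Ω : Set (Rn d)) (κ ε : ℝ) : Set (Rn d) :=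
  ⋃ k ∈ {k : Fin d → ℤ | inclusion ω ε k ⊆ Ω ∧
    ENNReal.ofReal (κ * ε) < setEDist (inclusion ω ε k) (frontier Ω)}, inclusion ω ε k

/-- The contrast function `δ 1_{D_ε} + 1_{Ω_ε}`, where `Ω_ε = Ω \ closure D_ε`. -/
def contrast {d : ℕ} (ω Ω : Set (Rn d)) (κ ε δ : ℝ) (x : Rn d) : ℝ :=
  δ * (inclusions ω Ω κ ε).indicator 1 x + (Ω \ closure (inclusions ω Ω κ ε)).indicator 1 x

/-! ### Sobolev functions, weak solutions, boundary values -/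

/-- `u ∈ H¹(U; ℝᵐ)` with weak gradient `Du`. -/
structure IsH1 {d m : ℕ} (U : Set (Rn d)) (u : Rn d → Rn m) (Du : Rn d → Grad d m) : Prop where
  memLp : MemLp u 2 (volume.restrict U)
  memLp_grad : MemLp Du 2 (volume.restrict U)
  weak_grad : ∀ φ : Rn d → ℝ, ContDiff ℝ (⊤ : ℕ∞) φ → HasCompactSupport φ → tsupport φ ⊆ U →
    ∀ (α : Fin m) (i : Fin d),
      ∫ x in U, u x α * fderiv ℝ φ x (EuclideanSpace.single i 1) = - ∫ x in U, Du x (α, i) * φ x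

/-- A function with weak gradient `Du` is a weak solution in `U` of
`-div (Λ(x) A(x/ε) ∇u) = f`. -/
def IsWeakSolution {d m : ℕ} (U : Set (Rn d)) (Λ : Rn d → ℝ) (A : Coeff d m) (ε : ℝ)
    (Du : Rn d → Grad d m) (f : Rn d → Rn m) : Prop :=
  ∀ φ : Rn d → Rn m, ContDiff ℝ (⊤ : ℕ∞) φ → HasCompactSupport φ → tsupport φ ⊆ U →
    ∫ x in U, Λ x * bilin (A (ε⁻¹ • x)) (Du x) (gradOf (fderiv ℝ φ x)) = ∫ x in U, inner ℝ (f x) (φ x)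

/-- `u = g` on `Γ ⊆ ∂U` in the sense of traces, for `u ∈ H¹(U; ℝᵐ)` with weak gradient `Du`: some
sequence of smooth functions on `ℝᵈ` converges to `u` in `H¹(U)` and to `g` in `L²(Γ)`. -/
def HasTrace {d m : ℕ} (U Γ : Set (Rn d)) (u : Rn d → Rn m) (Du : Rn d → Grad d m)
    (g : Rn d → Rn m) : Prop :=
  ∃ v : ℕ → Rn d → Rn m, (∀ n, ContDiff ℝ (⊤ : ℕ∞) (v n)) ∧
    Tendsto (fun n => eLpNorm (fun x => v n x - u x) 2 (volume.restrict U)) atTop (𝓝 0) ∧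
    Tendsto (fun n => eLpNorm (fun x => gradOf (fderiv ℝ (v n) x) - Du x) 2 (volume.restrict U))
      atTop (𝓝 0) ∧
    Tendsto (fun n => eLpNorm (fun x => v n x - g x) 2 (surfaceMeasure Γ)) atTop (𝓝 0)

/-- The parametrization `x' ↦ Φ(x', ψ(x'))` of the graph. -/
def graphMap {d : ℕ} (Φ : Rigid d) (ψ : Rn (d - 1) → ℝ) (x' : Rn (d - 1)) : Rn d :=
  Φ (WithLp.toLp 2 (x', ψ x'))

/-- The tangential gradient at `p = γ(x')` of a function `g` on the graph parametrized by
`γ = graphMap Φ ψ`. It is the linear map that vanishes on the normal direction and is determined on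
the tangent space `T = range Dγ(x')` by the chain rule `L ∘ Dγ(x') = D(g ∘ γ)(x')`; note that
`π ∘ Dγ(x') = id`, where `π` takes the `x'`-component in local coordinates. For Lipschitz `ψ` and `g`
this makes sense at almost every point of the graph. -/
def tangentialGradient {d m : ℕ} (Φ : Rigid d) (ψ : Rn (d - 1) → ℝ) (g : Rn d → Rn m)
    (p : Rn d) : Grad d m :=
  let x' : Rn (d - 1) := (Φ.symm p).fst
  let T : Submodule ℝ (Rn d) := (fderiv ℝ (graphMap Φ ψ) x').range
  let π : Rn d →L[ℝ] Rn (d - 1) := (WithLp.fstL 2 ℝ (Rn (d - 1)) ℝ).comp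
    (Φ.symm.linearIsometryEquiv.toContinuousLinearEquiv : Rn d →L[ℝ] Local d)
  gradOf (((fderiv ℝ (fun y => g (graphMap Φ ψ y)) x').comp π).comp T.starProjection)

/-- The `L^∞` norm on `Γ` with respect to surface measure. -/
def supNorm {d : ℕ} {V : Type*} [NormedAddCommGroup V] (Γ : Set (Rn d)) (h : Rn d → V) : ℝ :=
  (eLpNorm h ∞ (surfaceMeasure Γ)).toReal

end HighContrast

end

/-! A Caccioppoli inequality has constants that blow up with the contrast `δ` when the gradient of
the cutoff, or of the extension of the boundary data, is felt inside the inclusions, since the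
quadratic error there carries the weight `δ`. The remedy is to use a cutoff and an extension that
are constant on every inclusion.

Both come from one map. `exists_collapse` builds `P : ℝᵈ → ℝᵈ`, Lipschitz with a constant
independent of `ε` and `Ω`, which moves points by at most `√d ε`, fixes `∂Ω`, and sends each
inclusion to a single point. Let `φ` be a standard cutoff composed with `P`, and let `G` be an
extension of `g`, constant along vertical lines, composed with `P`. Then `φ` and `G` are locally
constant on `D_ε`, keep Lipschitz constants of the usual size, and `G = g` on the boundary portion
because `P` fixes it. Testing the equation with `φ² (u - G)`, all error terms live where the
contrast is one, while on `D_ε` the weight only helps the left-hand side (`energy_pointwise`,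
`energy_estimate`).

If `R` exceeds a fixed multiple `N ε`, the shift by `P` is negligible relative to `R` and the
inequality holds even without the term in `(ε/R)^{2ℓ}` (`caccioppoli_of_small_inclusions`). If `R <
N ε`, then `(N ε/R)^{2ℓ} ≥ 1` and the gradient term alone dominates the left-hand side.

Two technical points carry most of the length. First, `φ² (u - G)` does not have compact support in
the cylinder; it is admissible because `u - G` has zero trace, so its square integral over a strip
of height `a` along the graph is at most `a²` times a quantity that tends to zero
(`lintegral_strip_le`). This beats the `1/a` gradient of a cutoff in the height
(`isTestPair_cut_of_cylinderGauge`). Second, the Lipschitz constant of the extension must be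
governed by the essential supremum of the tangential gradient; this follows from Rademacher's
theorem and mollification on a ball of the base (`exists_boundary_extension`). -/

noncomputable section

namespace HighContrast

/-! ### Local coordinates -/

section LocalCoordinates

variable {d : ℕ}

/-- The `x'`-component in local coordinates. -/
def localBase (Φ : Rigid d) (x : Rn d) : Rn (d - 1) := (Φ.symm x).fst

/-- The height above the graph of `ψ`. -/
def height (Φ : Rigid d) (ψ : Rn (d - 1) → ℝ) (x : Rn d) : ℝ :=
  (Φ.symm x).snd - ψ (Φ.symm x).fst

/-- The gauge whose sublevel sets above the graph are the boundary cylinders. -/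
def cylinderGauge (M₀ : ℝ) (Φ : Rigid d) (ψ : Rn (d - 1) → ℝ) (x : Rn d) : ℝ :=
  max ‖localBase Φ x‖ (height Φ ψ x / M₀)

theorem lipschitzWith_localBase (Φ : Rigid d) : LipschitzWith 1 (localBase Φ) := by
  refine LipschitzWith.of_dist_le_mul fun x y => ?_
  rw [NNReal.coe_one, one_mul, ← Φ.symm.dist_map x y, dist_eq_norm, dist_eq_norm]
  have h := WithLp.prod_norm_sq_eq_of_L2 (Φ.symm x - Φ.symm y)
  have h2 : ‖localBase Φ x - localBase Φ y‖ ^ 2 ≤ ‖Φ.symm x - Φ.symm y‖ ^ 2 := by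
    rw [h]
    simp only [localBase, WithLp.sub_fst, le_add_iff_nonneg_right]
    positivity
  exact le_of_sq_le_sq h2 (norm_nonneg _)

theorem lipschitzWith_height (Φ : Rigid d) {ψ : Rn (d - 1) → ℝ} {M : ℝ≥0}
    (hψ : LipschitzWith M ψ) : LipschitzWith (1 + M) (height Φ ψ) := by
  have h1 : LipschitzWith 1 fun x => (Φ.symm x).snd := by
    refine LipschitzWith.of_dist_le_mul fun x y => ?_
    rw [NNReal.coe_one, one_mul, ← Φ.symm.dist_map x y, dist_eq_norm, dist_eq_norm]
    have h := WithLp.prod_norm_sq_eq_of_L2 (Φ.symm x - Φ.symm y)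
    have h2 : ‖(Φ.symm x).snd - (Φ.symm y).snd‖ ^ 2 ≤ ‖Φ.symm x - Φ.symm y‖ ^ 2 := by
      rw [h]
      simp
    exact le_of_sq_le_sq h2 (norm_nonneg _)
  have h2 := hψ.comp (lipschitzWith_localBase Φ)
  rw [mul_one] at h2
  exact h1.sub h2

/-- The constant involves `M` and `M₀` only, so one value serves all charts. -/
theorem lipschitzWith_cylinderGauge (M₀ : ℝ) (Φ : Rigid d) {ψ : Rn (d - 1) → ℝ}
    {M : ℝ≥0} (hψ : LipschitzWith M ψ) :
    LipschitzWith (max 1 ((1 + M) * ‖M₀⁻¹‖₊)) (cylinderGauge M₀ Φ ψ) := by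
  have h : LipschitzWith ((1 + M) * ‖M₀⁻¹‖₊) fun x => height Φ ψ x / M₀ := by
    refine LipschitzWith.of_dist_le_mul fun x y => ?_
    have := (lipschitzWith_height Φ hψ).dist_le_mul x y
    rw [Real.dist_eq] at this ⊢
    rw [div_eq_mul_inv, div_eq_mul_inv, ← sub_mul, abs_mul]
    push_cast at this ⊢
    rw [Real.norm_eq_abs]
    nlinarith [abs_nonneg M₀⁻¹]
  exact ((lipschitzWith_one_norm.comp (lipschitzWith_localBase Φ)).max h).weaken (by simp)

theorem mem_boundaryCylinder_iff {M₀ : ℝ} (hM₀ : 0 < M₀) (Φ : Rigid d) (ψ : Rn (d - 1) → ℝ)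
    {r : ℝ} {x : Rn d} :
    x ∈ boundaryCylinder M₀ Φ ψ r ↔ cylinderGauge M₀ Φ ψ x < r ∧ 0 < height Φ ψ x := by
  have key : x ∈ boundaryCylinder M₀ Φ ψ r ↔
      ‖localBase Φ x‖ < r ∧ 0 < height Φ ψ x ∧ height Φ ψ x < M₀ * r := by
    constructor
    · rintro ⟨p, hp, rfl⟩
      simpa [localBase, height] using hp
    · intro h
      exact ⟨Φ.symm x, h, by simp⟩
  rw [key, cylinderGauge, max_lt_iff, div_lt_iff₀' hM₀]
  tauto

/-- The point with base `x'` and height `s`. -/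
def liftPoint (Φ : Rigid d) (ψ : Rn (d - 1) → ℝ) (x' : Rn (d - 1)) (s : ℝ) : Rn d :=
  Φ (WithLp.toLp 2 (x', ψ x' + s))

@[simp] theorem localBase_liftPoint (Φ : Rigid d) (ψ : Rn (d - 1) → ℝ) (x' : Rn (d - 1)) (s : ℝ) :
    localBase Φ (liftPoint Φ ψ x' s) = x' := by
  simp [localBase, liftPoint]

@[simp] theorem height_liftPoint (Φ : Rigid d) (ψ : Rn (d - 1) → ℝ) (x' : Rn (d - 1)) (s : ℝ) :
    height Φ ψ (liftPoint Φ ψ x' s) = s := by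
  simp [height, liftPoint]

theorem liftPoint_localBase_height (Φ : Rigid d) (ψ : Rn (d - 1) → ℝ) (x : Rn d) :
    liftPoint Φ ψ (localBase Φ x) (height Φ ψ x) = x := by
  simp only [localBase, height, liftPoint, add_sub_cancel]
  exact Φ.apply_symm_apply x

theorem liftPoint_zero (Φ : Rigid d) (ψ : Rn (d - 1) → ℝ) (x' : Rn (d - 1)) :
    liftPoint Φ ψ x' 0 = graphMap Φ ψ x' := by
  simp [liftPoint, graphMap]

theorem Rigid.measurePreserving (Φ : Rigid d) : MeasurePreserving Φ volume volume := by
  have h1 : (Φ : Local d → Rn d) = fun x => Φ.linearIsometryEquiv x + Φ 0 := by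
    funext x
    have := Φ.map_vadd 0 x
    simpa using this
  rw [h1]
  exact (measurePreserving_add_right volume (Φ 0)).comp Φ.linearIsometryEquiv.measurePreserving

theorem continuous_liftPoint (Φ : Rigid d) {ψ : Rn (d - 1) → ℝ} (hψ : Continuous ψ) :
    Continuous fun p : Rn (d - 1) × ℝ => liftPoint Φ ψ p.1 p.2 := by
  unfold liftPoint
  refine Φ.continuous.comp ?_
  refine (WithLp.prod_continuous_toLp 2 _ _).comp ?_
  fun_prop

/-- Integration in the coordinates `(x', s)` with `s` the height above the graph. -/
theorem lintegral_slice (Φ : Rigid d) (ψ : Rn (d - 1) → ℝ) {F : Rn d → ℝ≥0∞} (hF : Measurable F) :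
    ∫⁻ x, F x = ∫⁻ x', ∫⁻ s, F (liftPoint Φ ψ x' s) := by
  rw [← (Rigid.measurePreserving Φ).lintegral_comp hF]
  refine ((WithLp.volume_preserving_toLp (Rn (d - 1)) ℝ).lintegral_comp
      (hF.comp Φ.continuous.measurable)).symm.trans ?_
  rw [Measure.volume_eq_prod, lintegral_prod _ (by
    exact ((hF.comp Φ.continuous.measurable).comp
      (WithLp.prod_continuous_toLp 2 _ _).measurable).aemeasurable)]
  refine lintegral_congr fun x' => ?_
  -- On each vertical line the passage from `z` to the height `s` is a translation by `ψ x'`.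
  exact (lintegral_add_left_eq_self (fun z => F (Φ (WithLp.toLp 2 (x', z)))) (ψ x')).symm

theorem volume_graph_eq_zero (Φ : Rigid d) {ψ : Rn (d - 1) → ℝ} {M : ℝ≥0}
    (hψ : LipschitzWith M ψ) : volume {x : Rn d | height Φ ψ x = 0} = 0 := by
  have hm : MeasurableSet {x : Rn d | height Φ ψ x = 0} :=
    (isClosed_eq (lipschitzWith_height Φ hψ).continuous continuous_const).measurableSet
  rw [← lintegral_indicator_one hm, lintegral_slice Φ ψ
    (measurable_one.indicator hm)]
  have : ∀ x' : Rn (d - 1), ∫⁻ s : ℝ, ({x : Rn d | height Φ ψ x = 0}.indicator 1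
      (liftPoint Φ ψ x' s) : ℝ≥0∞) = 0 := by
    intro x'
    have : (fun s : ℝ => ({x : Rn d | height Φ ψ x = 0}.indicator 1
      (liftPoint Φ ψ x' s) : ℝ≥0∞)) = ({0} : Set ℝ).indicator 1 := by
      funext s
      simp [indicator]
    rw [this, lintegral_indicator_one (measurableSet_singleton 0)]
    simp
  simp [this]

theorem isOpen_boundaryCylinder {M₀ : ℝ} (hM₀ : 0 < M₀) (Φ : Rigid d) {ψ : Rn (d - 1) → ℝ}
    {M : ℝ≥0} (hψ : LipschitzWith M ψ) (r : ℝ) : IsOpen (boundaryCylinder M₀ Φ ψ r) := by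
  have : boundaryCylinder M₀ Φ ψ r =
      {x | cylinderGauge M₀ Φ ψ x < r} ∩ {x | 0 < height Φ ψ x} := by
    ext x; exact mem_boundaryCylinder_iff hM₀ Φ ψ
  rw [this]
  exact (isOpen_lt (lipschitzWith_cylinderGauge M₀ Φ hψ).continuous continuous_const).inter
    (isOpen_lt continuous_const (lipschitzWith_height Φ hψ).continuous)

/-! ### Frontier and boundary portion inside a chart. -/

section Chart

variable {Ω : Set (Rn d)} {x₀ : Rn d} {M : ℝ≥0} {M₀ r₀ : ℝ} {Φ : Rigid d} {ψ : Rn (d - 1) → ℝ}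

theorem IsBoundaryChart.mem_iff_height (h : IsBoundaryChart Ω x₀ M M₀ r₀ Φ ψ) {x : Rn d}
    (h1 : ‖localBase Φ x‖ < r₀) (h2 : |height Φ ψ x| < M₀ * r₀) : x ∈ Ω ↔ 0 < height Φ ψ x := by
  have := h.mem_iff (localBase Φ x) (Φ.symm x).snd h1 h2
  have e : Φ (WithLp.toLp 2 (localBase Φ x, (Φ.symm x).snd)) = x := Φ.apply_symm_apply x
  rw [e] at this
  rw [this]
  simp [height, localBase]

/-- Inside the chart, the frontier of `Ω` is the graph. -/
theorem IsBoundaryChart.mem_frontier_iff (h : IsBoundaryChart Ω x₀ M M₀ r₀ Φ ψ) {x : Rn d}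
    (h1 : ‖localBase Φ x‖ < r₀) (h2 : |height Φ ψ x| < M₀ * r₀) :
    x ∈ frontier Ω ↔ height Φ ψ x = 0 := by
  have hc := (lipschitzWith_height Φ h.lipschitz).continuous
  have hO : IsOpen {y | ‖localBase Φ y‖ < r₀ ∧ |height Φ ψ y| < M₀ * r₀} :=
    (isOpen_lt (lipschitzWith_localBase Φ).continuous.norm continuous_const).inter
      (isOpen_lt hc.abs continuous_const)
  have hev : ∀ᶠ y in 𝓝 x, (y ∈ Ω ↔ 0 < height Φ ψ y) :=
    (hO.mem_nhds ⟨h1, h2⟩ : _ ∈ 𝓝 x) |> Filter.mem_of_superset <| fun y hy =>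
      h.mem_iff_height hy.1 hy.2
  rw [frontier_eq_closure_inter_closure]
  constructor
  · rintro ⟨ha, hb⟩
    rw [mem_closure_iff_frequently] at ha hb
    by_contra hne
    rcases lt_or_gt_of_ne hne with hlt | hgt
    · exact ha ((hev.and (hc.continuousAt.eventually (gt_mem_nhds hlt))).mono
        fun y hy hyΩ => absurd (hy.1.1 hyΩ) (not_lt.2 hy.2.le))
    · exact hb ((hev.and (hc.continuousAt.eventually (lt_mem_nhds hgt))).mono
        fun y hy hyΩ => hyΩ (hy.1.2 hy.2))
  -- A point of the graph is approached along its vertical line, from above inside `Ω` and from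
  -- below outside.
  · intro h0
    have hcont : Continuous fun s : ℝ => liftPoint Φ ψ (localBase Φ x) s :=
      (continuous_liftPoint Φ h.lipschitz.continuous).comp
        (continuous_const.prodMk continuous_id)
    have hx0 : liftPoint Φ ψ (localBase Φ x) 0 = x := by
      rw [← h0, liftPoint_localBase_height]
    have ht : Tendsto (fun s : ℝ => liftPoint Φ ψ (localBase Φ x) s) (𝓝 0) (𝓝 x) := by
      exact hcont.tendsto' 0 x hx0
    have hev' := ht.eventually hev
    constructor
    · refine mem_closure_of_tendsto (ht.mono_left (nhdsWithin_le_nhds (s := Ioi 0))) ?_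
      filter_upwards [hev'.filter_mono nhdsWithin_le_nhds, self_mem_nhdsWithin] with s hs hpos
      exact hs.2 (by simpa using hpos)
    · refine mem_closure_of_tendsto (ht.mono_left (nhdsWithin_le_nhds (s := Iio 0))) ?_
      filter_upwards [hev'.filter_mono nhdsWithin_le_nhds, self_mem_nhdsWithin] with s hs hneg
      intro hmem
      have := hs.1 hmem
      simp at this hneg
      linarith

theorem IsBoundaryChart.boundaryCylinder_subset (h : IsBoundaryChart Ω x₀ M M₀ r₀ Φ ψ) {r : ℝ}
    (hr : r ≤ r₀) : boundaryCylinder M₀ Φ ψ r ⊆ Ω := by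
  intro x hx
  obtain ⟨hg, h0⟩ := (mem_boundaryCylinder_iff h.pos_height Φ ψ).1 hx
  rw [cylinderGauge, max_lt_iff, div_lt_iff₀' h.pos_height] at hg
  refine (h.mem_iff_height (hg.1.trans_le hr) ?_).2 h0
  rw [abs_of_pos h0]
  exact hg.2.trans_le (mul_le_mul_of_nonneg_left hr h.pos_height.le)

/-- The boundary portion of a cylinder is the part of the graph over the closed ball. -/
theorem IsBoundaryChart.mem_boundaryPortion_iff (h : IsBoundaryChart Ω x₀ M M₀ r₀ Φ ψ) {r : ℝ}
    (hr0 : 0 < r) (hr : r < r₀) {x : Rn d} :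
    x ∈ boundaryPortion Ω M₀ Φ ψ r ↔ ‖localBase Φ x‖ ≤ r ∧ height Φ ψ x = 0 := by
  have hc := (lipschitzWith_height Φ h.lipschitz).continuous
  have hg := (lipschitzWith_cylinderGauge M₀ Φ h.lipschitz).continuous
  have hM₀ := h.pos_height
  constructor
  · rintro ⟨h1, h2⟩
    have hcl : x ∈ {y | cylinderGauge M₀ Φ ψ y ≤ r} ∩ {y | 0 ≤ height Φ ψ y} := by
      refine closure_minimal ?_ ((isClosed_le hg continuous_const).inter
        (isClosed_le continuous_const hc)) (frontier_subset_closure h1)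
      intro y hy
      have := (mem_boundaryCylinder_iff h.pos_height Φ ψ).1 hy
      exact ⟨this.1.le, this.2.le⟩
    obtain ⟨ha, hb⟩ := hcl
    simp only [mem_ofPred_eq, cylinderGauge, max_le_iff, div_le_iff₀' hM₀] at ha hb
    refine ⟨ha.1, (h.mem_frontier_iff (ha.1.trans_lt hr) ?_).1 h2⟩
    rw [abs_of_nonneg hb]
    exact ha.2.trans_lt (mul_lt_mul_of_pos_left hr hM₀)
  · rintro ⟨h1, h2⟩
    have hfr : x ∈ frontier Ω :=
      (h.mem_frontier_iff (h1.trans_lt hr) (by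
        rw [h2, abs_zero]; exact mul_pos hM₀ h.pos_radius)).2 h2
    refine ⟨?_, hfr⟩
    have hnot : x ∉ boundaryCylinder M₀ Φ ψ r := fun hx => by
      have := ((mem_boundaryCylinder_iff h.pos_height Φ ψ).1 hx).2
      rw [h2] at this; exact lt_irrefl _ this
    rw [(isOpen_boundaryCylinder hM₀ Φ h.lipschitz r).frontier_eq]
    refine ⟨?_, hnot⟩
    -- The base point may lie on the sphere of radius `r`, so the approximating path shrinks the
    -- base while raising the height; it stays in the open cylinder for `0 < s < 1`.
    have hcont : Continuous fun s : ℝ => liftPoint Φ ψ ((1 - s) • localBase Φ x) (M₀ * r * s) :=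
      (continuous_liftPoint Φ h.lipschitz.continuous).comp
        (((continuous_const.sub continuous_id).smul continuous_const).prodMk
          (continuous_const.mul continuous_id))
    have ht : Tendsto (fun s : ℝ => liftPoint Φ ψ ((1 - s) • localBase Φ x) (M₀ * r * s))
        (𝓝[>] 0) (𝓝 x) := by
      refine (hcont.tendsto' 0 _ ?_).mono_left nhdsWithin_le_nhds
      have := liftPoint_localBase_height Φ ψ x
      rw [h2] at this
      simpa using this
    refine mem_closure_of_tendsto ht ?_
    filter_upwards [Ioo_mem_nhdsGT (zero_lt_one (α := ℝ))] with s hs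
    rw [mem_boundaryCylinder_iff hM₀, cylinderGauge, max_lt_iff, div_lt_iff₀' hM₀]
    simp only [localBase_liftPoint, height_liftPoint, norm_smul, Real.norm_eq_abs]
    rw [abs_of_pos (by linarith [hs.2])]
    refine ⟨⟨?_, ?_⟩, by have := hs.1; positivity⟩
    · nlinarith [hs.1, hs.2, norm_nonneg (localBase Φ x)]
    · have : 0 < M₀ * r := mul_pos hM₀ hr0
      nlinarith [hs.2]

end Chart

/-- Locally the frontier is a Lipschitz graph, which is null by Fubini. For `ω` this makes the set
where the contrast is neither `δ` nor one negligible. -/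
theorem HasLipschitzBoundary.volume_frontier_eq_zero {Ω : Set (Rn d)}
    (h : HasLipschitzBoundary Ω) : volume (frontier Ω) = 0 := by
  refine measure_null_of_locally_null _ fun x hx => ?_
  obtain ⟨M, M₀, r₀, Φ, ψ, hc⟩ := h x hx
  have hcont := (lipschitzWith_height Φ hc.lipschitz).continuous
  have hO : IsOpen {y | ‖localBase Φ y‖ < r₀ ∧ |height Φ ψ y| < M₀ * r₀} :=
    (isOpen_lt (lipschitzWith_localBase Φ).continuous.norm continuous_const).inter
      (isOpen_lt hcont.abs continuous_const)
  have hx0 : Φ.symm x = 0 := by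
    rw [← hc.map_origin]; simp
  refine ⟨_, inter_mem_nhdsWithin _ (hO.mem_nhds ?_), ?_⟩
  · simp [localBase, height, hx0, hc.graph_origin, hc.pos_radius, hc.pos_height]
  · refine measure_mono_null (fun y hy => ?_) (volume_graph_eq_zero Φ hc.lipschitz)
    exact (hc.mem_frontier_iff hy.2.1 hy.2.2).1 hy.1

end LocalCoordinates

/-! ### Mollification of Lipschitz functions -/

section Mollification

open scoped Convolution
open ContinuousLinearMap (lsmul)

variable {E F : Type*} [NormedAddCommGroup E] [InnerProductSpace ℝ E]

/-- A sequence of bump functions at the origin with shrinking supports. -/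
def shrinkingBump (E : Type*) [NormedAddCommGroup E] [InnerProductSpace ℝ E] (k : ℕ) :
    ContDiffBump (0 : E) where
  -- A fixed ratio of outer to inner radius is what the Lebesgue differentiation argument for
  -- mollified derivatives needs.
  rIn := 1 / (2 * (k + 1))
  rOut := 1 / (k + 1)
  rIn_pos := by positivity
  rIn_lt_rOut := by
    have : (0 : ℝ) < k + 1 := by positivity
    exact one_div_lt_one_div_of_lt this (by linarith)

theorem shrinkingBump_rOut (k : ℕ) : (shrinkingBump E k).rOut = 1 / (k + 1) := rfl

theorem tendsto_shrinkingBump_rOut :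
    Tendsto (fun k => (shrinkingBump E k).rOut) atTop (𝓝 0) :=
  tendsto_one_div_add_atTop_nhds_zero_nat

variable [FiniteDimensional ℝ E] [MeasurableSpace E] [BorelSpace E] [NormedAddCommGroup F]
  [NormedSpace ℝ F]

/-- The mollification of `w` by the `k`-th bump function. -/
def mollify (k : ℕ) (w : E → F) : E → F :=
  (shrinkingBump E k).normed volume ⋆[lsmul ℝ ℝ, volume] w

theorem mollify_apply (k : ℕ) (w : E → F) (x : E) :
    mollify k w x = ∫ y, (shrinkingBump E k).normed volume y • w (x - y) := rfl

theorem contDiff_mollify (k : ℕ) {w : E → F} [CompleteSpace F] (hw : LocallyIntegrable w) :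
    ContDiff ℝ (⊤ : ℕ∞) (mollify k w) :=
  (shrinkingBump E k).hasCompactSupport_normed.contDiff_convolution_left _
    (shrinkingBump E k).contDiff_normed hw

theorem norm_mollify_sub_le (k : ℕ) {w : E → F} [CompleteSpace F] {K : ℝ≥0}
    (hw : LipschitzWith K w) (x : E) : ‖mollify k w x - w x‖ ≤ K * (1 / (k + 1)) := by
  rw [← dist_eq_norm]
  refine (shrinkingBump E k).dist_normed_convolution_le hw.continuous.aestronglyMeasurable
    fun y hy => ?_
  refine (hw.dist_le_mul y x).trans ?_
  rw [Metric.mem_ball, shrinkingBump_rOut] at hy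
  gcongr

/-- The kernel has mass one and is supported in the ball, so an almost everywhere bound on that ball
suffices; this form applies to derivatives given by Rademacher's theorem. -/
theorem norm_mollify_le (k : ℕ) {h : E → F} {c : ℝ} {x : E}
    (hh : ∀ᵐ y, y ∈ Metric.ball x (1 / (k + 1) : ℝ) → ‖h y‖ ≤ c) : ‖mollify k h x‖ ≤ c := by
  rw [mollify_apply]
  have h1 : ∀ᵐ y, ‖(shrinkingBump E k).normed volume y • h (x - y)‖ ≤
      (shrinkingBump E k).normed volume y * c := by
    have := (quasiMeasurePreserving_sub_left volume x).ae hh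
    filter_upwards [this] with y hy
    rw [norm_smul, Real.norm_of_nonneg ((shrinkingBump E k).nonneg_normed y)]
    by_cases hy' : y ∈ Metric.ball (0 : E) (1 / (k + 1) : ℝ)
    · refine mul_le_mul_of_nonneg_left (hy ?_) ((shrinkingBump E k).nonneg_normed y)
      simpa [dist_eq_norm] using hy'
    · have : (shrinkingBump E k).normed volume y = 0 := by
        rw [← Function.notMem_support, ContDiffBump.support_normed_eq]
        exact hy'
      simp [this]
  refine (norm_integral_le_of_norm_le
    ((shrinkingBump E k).integrable_normed.mul_const c) h1).trans ?_
  rw [integral_mul_const, ContDiffBump.integral_normed, one_mul]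

/-- By Rademacher's theorem `w` is differentiable at `x - y` for almost every `y`, and the Lipschitz
bound dominates the difference quotients, so differentiation passes under the integral. -/
theorem hasFDerivAt_mollify (k : ℕ) {w : E → F} [FiniteDimensional ℝ F] {K : ℝ≥0}
    (hw : LipschitzWith K w) (x : E) :
    HasFDerivAt (mollify k w) (mollify k (fderiv ℝ w) x) x := by
  have : CompleteSpace F := FiniteDimensional.complete ℝ F
  set ρ := (shrinkingBump E k).normed volume
  have hρ : Integrable ρ := (shrinkingBump E k).integrable_normed
  have hρc : Continuous ρ := (shrinkingBump E k).continuous_normed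
  refine (hasFDerivAt_integral_of_dominated_loc_of_lip (μ := volume) (s := univ)
    (F := fun x y => ρ y • w (x - y)) (F' := fun y => ρ y • fderiv ℝ w (x - y))
    (bound := fun y => K * ρ y) univ_mem ?_ ?_ ?_ ?_ ?_ ?_).2
  · refine Eventually.of_forall fun z => Continuous.aestronglyMeasurable ?_
    exact hρc.smul (hw.continuous.comp (by fun_prop))
  · refine (hρc.smul (hw.continuous.comp (by fun_prop))).integrable_of_hasCompactSupport ?_
    exact (shrinkingBump E k).hasCompactSupport_normed.smul_right
  · exact hρc.aestronglyMeasurable.smul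
      ((measurable_fderiv ℝ w).comp (measurable_const.sub measurable_id)).aestronglyMeasurable
  · refine Eventually.of_forall fun y => ?_
    refine LipschitzWith.lipschitzOnWith (LipschitzWith.of_dist_le_mul fun a b => ?_)
    have h0 : 0 ≤ ρ y := (shrinkingBump E k).nonneg_normed y
    have := hw.dist_le_mul (a - y) (b - y)
    rw [dist_sub_right] at this
    rw [dist_eq_norm, ← smul_sub, norm_smul, Real.norm_of_nonneg h0, ← dist_eq_norm]
    have e : ((Real.nnabs (K * ρ y) : ℝ≥0) : ℝ) = K * ρ y := by
      rw [Real.coe_nnabs, abs_of_nonneg (by positivity)]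
    rw [e]
    nlinarith
  · exact hρ.const_mul _
  · have h1 := (quasiMeasurePreserving_sub_left volume x).ae (hw.ae_differentiableAt (μ := volume))
    filter_upwards [h1] with y hy
    have h2 : HasFDerivAt (fun z => w (z - y)) (fderiv ℝ w (x - y)) x := by
      have := hy.hasFDerivAt.comp x ((hasFDerivAt_id x).sub_const y)
      rwa [ContinuousLinearMap.comp_id] at this
    exact h2.const_smul (ρ y)

theorem locallyIntegrable_fderiv {w : E → F} [FiniteDimensional ℝ F] {K : ℝ≥0}
    (hw : LipschitzWith K w) : LocallyIntegrable (fderiv ℝ w) := by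
  have : CompleteSpace F := FiniteDimensional.complete ℝ F
  refine (locallyIntegrable_const (K : ℝ)).mono
    (measurable_fderiv ℝ w).aestronglyMeasurable (Eventually.of_forall fun x => ?_)
  simpa using norm_fderiv_le_of_lipschitz ℝ hw (x₀ := x)

theorem ae_tendsto_mollify_fderiv {w : E → F} [FiniteDimensional ℝ F] {K : ℝ≥0}
    (hw : LipschitzWith K w) :
    ∀ᵐ x, Tendsto (fun k => fderiv ℝ (mollify k w) x) atTop (𝓝 (fderiv ℝ w x)) := by
  have h := ContDiffBump.ae_convolution_tendsto_right_of_locallyIntegrable (K := 2)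
    (φ := shrinkingBump E) (μ := volume) tendsto_shrinkingBump_rOut
    (Eventually.of_forall fun k => by
      simp only [shrinkingBump]
      apply le_of_eq
      field_simp) (locallyIntegrable_fderiv hw)
  filter_upwards [h] with x hx
  simp_rw [(hasFDerivAt_mollify _ hw x).fderiv]
  exact hx

theorem norm_fderiv_mollify_le (k : ℕ) {w : E → F} [FiniteDimensional ℝ F] {K : ℝ≥0}
    (hw : LipschitzWith K w) (x : E) : ‖fderiv ℝ (mollify k w) x‖ ≤ K := by
  rw [(hasFDerivAt_mollify _ hw x).fderiv]
  exact norm_mollify_le k (Eventually.of_forall fun y _ => norm_fderiv_le_of_lipschitz ℝ hw)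

theorem mollify_eq_zero (k : ℕ) {w : E → F} {x : E}
    (h : ∀ y ∈ Metric.ball x (1 / (k + 1) : ℝ), w y = 0) : mollify k w x = 0 := by
  have := norm_mollify_le (c := 0) k (h := w) (x := x)
    (Eventually.of_forall fun y hy => by rw [h y hy, norm_zero])
  simpa using this

theorem tsupport_mollify_subset (k : ℕ) {w : E → F} :
    tsupport (mollify k w) ⊆ Metric.cthickening (1 / (k + 1) : ℝ) (tsupport w) := by
  refine closure_minimal (fun x hx => ?_) Metric.isClosed_cthickening
  by_contra hcon
  refine hx (mollify_eq_zero k fun y hy => ?_)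
  by_contra hy0
  refine hcon (Metric.thickening_subset_cthickening _ _ ?_)
  rw [Metric.mem_thickening_iff]
  exact ⟨y, subset_tsupport _ hy0, by rwa [dist_comm, ← Metric.mem_ball]⟩

/-- A Lipschitz function whose derivative is almost everywhere bounded by `c` on a ball is
`c`-Lipschitz on this ball. -/
theorem lipschitzOnWith_ball_of_ae_fderiv_le {w : E → F} [FiniteDimensional ℝ F] {K c : ℝ≥0}
    (hw : LipschitzWith K w) {z : E} {r : ℝ}
    (hc : ∀ᵐ x, x ∈ Metric.ball z r → ‖fderiv ℝ w x‖ ≤ c) :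
    LipschitzOnWith c w (Metric.ball z r) := by
  have : CompleteSpace F := FiniteDimensional.complete ℝ F
  refine LipschitzOnWith.of_dist_le_mul fun x hx y hy => ?_
  rw [Metric.mem_ball] at hx hy
  have hlim : ∀ p, Tendsto (fun k => mollify k w p) atTop (𝓝 (w p)) := fun p =>
    ContDiffBump.convolution_tendsto_right_of_continuous tendsto_shrinkingBump_rOut hw.continuous p
  refine le_of_tendsto ((hlim x).dist (hlim y)) ?_
  -- Both points lie in a smaller closed ball. Once the mollification radius is below the gap, the
  -- averages at its points see only the original ball, and the mean value inequality applies to the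
  -- smooth mollification.
  have hgap : 0 < r - max (dist x z) (dist y z) := by
    rw [sub_pos, max_lt_iff]; exact ⟨hx, hy⟩
  filter_upwards [(tendsto_one_div_add_atTop_nhds_zero_nat (𝕜 := ℝ)).eventually
    (gt_mem_nhds hgap)] with k hk
  have hconv : Convex ℝ (Metric.closedBall z (max (dist x z) (dist y z))) := convex_closedBall _ _
  rw [dist_comm, dist_comm x y, dist_eq_norm, dist_eq_norm]
  refine hconv.norm_image_sub_le_of_norm_hasFDerivWithin_le (𝕜 := ℝ)
    (f' := fun p => mollify k (fderiv ℝ w) p)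
    (fun p _ => (hasFDerivAt_mollify k hw p).hasFDerivWithinAt) (fun p hp => ?_)
    (Metric.mem_closedBall.2 (le_max_left _ _)) (Metric.mem_closedBall.2 (le_max_right _ _))
  refine norm_mollify_le k ?_
  filter_upwards [hc] with q hq hqb
  refine hq ?_
  rw [Metric.mem_ball] at hqb ⊢
  rw [Metric.mem_closedBall] at hp
  linarith [dist_triangle q p z]

end Mollification

/-! ### Gradients as vectors -/

section Gradients

variable {d m : ℕ}

theorem gradOf_apply (L : Rn d →L[ℝ] Rn m) (p : Fin m × Fin d) :
    gradOf L p = L (EuclideanSpace.single p.2 1) p.1 := rfl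

theorem gradOf_add (L L' : Rn d →L[ℝ] Rn m) : gradOf (L + L') = gradOf L + gradOf L' := by
  ext p; simp [gradOf_apply]

theorem gradOf_sub (L L' : Rn d →L[ℝ] Rn m) : gradOf (L - L') = gradOf L - gradOf L' := by
  ext p; simp [gradOf_apply]

theorem gradOf_smul (c : ℝ) (L : Rn d →L[ℝ] Rn m) : gradOf (c • L) = c • gradOf L := by
  ext p; simp [gradOf_apply]

@[simp] theorem gradOf_zero : gradOf (0 : Rn d →L[ℝ] Rn m) = 0 := by
  ext p; simp [gradOf_apply]

theorem norm_gradOf_le (L : Rn d →L[ℝ] Rn m) : ‖gradOf L‖ ≤ √(m * d) * ‖L‖ := by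
  rw [EuclideanSpace.norm_eq, Fintype.sum_prod_type]
  refine Real.sqrt_le_iff.2 ⟨by positivity, ?_⟩
  rw [mul_pow, Real.sq_sqrt (by positivity)]
  have h : ∀ (α : Fin m) (i : Fin d), ‖gradOf L (α, i)‖ ^ 2 ≤ ‖L‖ ^ 2 := by
    intro α i
    have h1 : ‖L (EuclideanSpace.single i 1) α‖ ≤ ‖L‖ := by
      refine (PiLp.norm_apply_le _ α).trans ?_
      simpa using L.le_opNorm (EuclideanSpace.single i (1 : ℝ))
    exact pow_le_pow_left₀ (norm_nonneg _) h1 2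
  refine (Finset.sum_le_sum fun α _ => Finset.sum_le_sum fun i _ => h α i).trans ?_
  simp [mul_assoc]

theorem norm_apply_le_norm_gradOf (L : Rn d →L[ℝ] Rn m) (v : Rn d) :
    ‖L v‖ ≤ ‖gradOf L‖ * ‖v‖ := by
  refine le_of_sq_le_sq ?_ (by positivity)
  rw [mul_pow, EuclideanSpace.norm_sq_eq, EuclideanSpace.norm_sq_eq (gradOf L),
    EuclideanSpace.norm_sq_eq v, Fintype.sum_prod_type, Finset.sum_mul]
  refine Finset.sum_le_sum fun α _ => ?_
  have hv : L v α = ∑ i, gradOf L (α, i) * v i := by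
    have h1 : v = ∑ i, v i • EuclideanSpace.single i (1 : ℝ) := by
      simpa using ((EuclideanSpace.basisFun (Fin d) ℝ).sum_repr v).symm
    conv_lhs => rw [h1, map_sum]
    simp [gradOf_apply, mul_comm]
  simp only [hv, Real.norm_eq_abs, sq_abs]
  exact Finset.sum_mul_sq_le_sq_mul_sq _ _ _

theorem continuous_gradOf : Continuous (gradOf : (Rn d →L[ℝ] Rn m) → Grad d m) := by
  refine (LipschitzWith.of_dist_le_mul (K := ⟨√(m * d), by positivity⟩)
    fun L L' => ?_).continuous
  rw [dist_eq_norm, dist_eq_norm, ← gradOf_sub]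
  exact norm_gradOf_le _

/-- The gradient of `x ↦ c x • b` at a point, where `a` is the derivative of `c`. -/
def tensor (a : Rn d →L[ℝ] ℝ) (b : Rn m) : Grad d m := gradOf (a.smulRight b)

theorem norm_tensor_le (a : Rn d →L[ℝ] ℝ) (b : Rn m) : ‖tensor a b‖ ≤ √(m * d) * (‖a‖ * ‖b‖) := by
  refine (norm_gradOf_le _).trans ?_
  rw [ContinuousLinearMap.norm_smulRight_apply]

theorem tensor_sub (a : Rn d →L[ℝ] ℝ) (b b' : Rn m) :
    tensor a (b - b') = tensor a b - tensor a b' := by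
  ext p
  simp [tensor, gradOf_apply, mul_sub]

theorem tensor_add_left (a a' : Rn d →L[ℝ] ℝ) (b : Rn m) :
    tensor (a + a') b = tensor a b + tensor a' b := by
  ext p
  simp [tensor, gradOf_apply, add_mul]

theorem tensor_smul_left (c : ℝ) (a : Rn d →L[ℝ] ℝ) (b : Rn m) :
    tensor (c • a) b = c • tensor a b := by
  ext p
  simp [tensor, gradOf_apply, mul_assoc]

@[simp] theorem tensor_zero_left (b : Rn m) : tensor (0 : Rn d →L[ℝ] ℝ) b = 0 := by
  ext p
  simp [tensor]

theorem continuous_tensor :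
    Continuous fun p : (Rn d →L[ℝ] ℝ) × Rn m => tensor p.1 p.2 := by
  refine continuous_gradOf.comp ?_
  exact (ContinuousLinearMap.smulRightL ℝ (Rn d) (Rn m)).continuous₂

/-- The gradient of a vector-valued function, zero where it is not differentiable. -/
def gradient (w : Rn d → Rn m) (x : Rn d) : Grad d m := gradOf (fderiv ℝ w x)

theorem measurable_gradient (w : Rn d → Rn m) : Measurable (gradient w) :=
  continuous_gradOf.measurable.comp (measurable_fderiv ℝ w)

theorem norm_gradient_le {w : Rn d → Rn m} {K : ℝ≥0} (hw : LipschitzWith K w) (x : Rn d) :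
    ‖gradient w x‖ ≤ √(m * d) * K :=
  (norm_gradOf_le _).trans (mul_le_mul_of_nonneg_left (norm_fderiv_le_of_lipschitz ℝ hw)
    (by positivity))

end Gradients

/-! ### Test functions for weak formulations -/

section TestPairs

variable {d m : ℕ} {U : Set (Rn d)} {σ : Rn d → Grad d m} {f : Rn d → Rn m}

/-- A square-integrable function `w` with gradient `W` satisfies the weak formulation of
`-div σ = f` in `U`. -/
structure IsTestPair (U : Set (Rn d)) (σ : Rn d → Grad d m) (f : Rn d → Rn m)
    (w : Rn d → Rn m) (W : Rn d → Grad d m) : Prop where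
  memLp : MemLp w 2 (volume.restrict U)
  memLp_grad : MemLp W 2 (volume.restrict U)
  integral_eq : ∫ x in U, inner ℝ (σ x) (W x) = ∫ x in U, inner ℝ (f x) (w x)

theorem tendsto_integral_inner_of_tendsto_eLpNorm {α V ι : Type*} [MeasurableSpace α]
    [NormedAddCommGroup V] [InnerProductSpace ℝ V] {ν : Measure α} {l : Filter ι}
    {a b : α → V} {c : ι → α → V} (ha : MemLp a 2 ν) (hb : MemLp b 2 ν)
    (hc : ∀ k, MemLp (c k) 2 ν)
    (h : Tendsto (fun k => eLpNorm (c k - b) 2 ν) l (𝓝 0)) :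
    Tendsto (fun k => ∫ x, inner ℝ (a x) (c k x) ∂ν) l (𝓝 (∫ x, inner ℝ (a x) (b x) ∂ν)) := by
  have key : ∀ (e : α → V) (he : MemLp e 2 ν),
      ∫ x, inner ℝ (a x) (e x) ∂ν = inner ℝ (ha.toLp a) (he.toLp e) := by
    intro e he
    rw [L2.inner_def]
    refine integral_congr_ae ?_
    filter_upwards [ha.coeFn_toLp, he.coeFn_toLp] with x h1 h2
    rw [h1, h2]
  rw [key b hb]
  simp_rw [fun k => key (c k) (hc k)]
  exact tendsto_const_nhds.inner ((Lp.tendsto_Lp_iff_tendsto_eLpNorm'' c hc b hb).2 h)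

/-- A test pair records only integrability and the integral identity, both sides of which are
continuous in `L²`; nothing about derivatives has to be passed to the limit. -/
theorem IsTestPair.of_tendsto {ι : Type*} {l : Filter ι} [l.NeBot]
    (hσ : MemLp σ 2 (volume.restrict U)) (hf : MemLp f 2 (volume.restrict U))
    {w : ι → Rn d → Rn m} {W : ι → Rn d → Grad d m} {w' : Rn d → Rn m} {W' : Rn d → Grad d m}
    (h : ∀ k, IsTestPair U σ f (w k) (W k))
    (hw : MemLp w' 2 (volume.restrict U)) (hW : MemLp W' 2 (volume.restrict U))
    (hw' : Tendsto (fun k => eLpNorm (w k - w') 2 (volume.restrict U)) l (𝓝 0))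
    (hW' : Tendsto (fun k => eLpNorm (W k - W') 2 (volume.restrict U)) l (𝓝 0)) :
    IsTestPair U σ f w' W' := by
  refine ⟨hw, hW, ?_⟩
  have h1 := tendsto_integral_inner_of_tendsto_eLpNorm hσ hW (fun k => (h k).memLp_grad) hW'
  have h2 := tendsto_integral_inner_of_tendsto_eLpNorm hf hw (fun k => (h k).memLp) hw'
  simp_rw [fun k => (h k).integral_eq] at h1
  exact tendsto_nhds_unique h1 h2

/-- Lipschitz functions with compact support in `U` are admissible test functions. -/
theorem isTestPair_of_lipschitz (hU : IsOpen U) (hfin : volume U ≠ ∞)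
    (hσ : MemLp σ 2 (volume.restrict U)) (hf : MemLp f 2 (volume.restrict U))
    (hweak : ∀ φ : Rn d → Rn m, ContDiff ℝ (⊤ : ℕ∞) φ → HasCompactSupport φ → tsupport φ ⊆ U →
      ∫ x in U, inner ℝ (σ x) (gradient φ x) = ∫ x in U, inner ℝ (f x) (φ x))
    {w : Rn d → Rn m} {K : ℝ≥0} (hw : LipschitzWith K w) (hcw : HasCompactSupport w)
    (hsub : tsupport w ⊆ U) : IsTestPair U σ f w (gradient w) := by
  have : IsFiniteMeasure (volume.restrict U) := isFiniteMeasure_restrict.2 hfin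
  obtain ⟨B, hB⟩ := hcw.exists_bound_of_continuous hw.continuous
  refine ⟨MemLp.of_bound hw.continuous.aestronglyMeasurable B (Eventually.of_forall hB),
    MemLp.of_bound (measurable_gradient w).aestronglyMeasurable _
      (Eventually.of_forall (norm_gradient_le hw)), ?_⟩
  -- Gradients of mollifications converge almost everywhere and are uniformly bounded, so dominated
  -- convergence applies against the integrable `σ`.
  have hlim1 : Tendsto (fun k => ∫ x in U, inner ℝ (σ x) (gradient (mollify k w) x)) atTop
      (𝓝 (∫ x in U, inner ℝ (σ x) (gradient w x))) := by
    refine tendsto_integral_of_dominated_convergence (fun x => ‖σ x‖ * (√(m * d) * K))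
      (fun k => hσ.1.inner (measurable_gradient _).aestronglyMeasurable)
      ((hσ.integrable one_le_two).norm.mul_const _) (fun k => Eventually.of_forall fun x => ?_)
      (ae_restrict_of_ae ?_)
    · refine (norm_inner_le_norm _ _).trans (mul_le_mul_of_nonneg_left ?_ (norm_nonneg _))
      exact (norm_gradOf_le _).trans
        (mul_le_mul_of_nonneg_left (norm_fderiv_mollify_le k hw x) (by positivity))
    · filter_upwards [ae_tendsto_mollify_fderiv hw] with x hx
      exact tendsto_const_nhds.inner ((continuous_gradOf.tendsto _).comp hx)
  have hlim2 : Tendsto (fun k => ∫ x in U, inner ℝ (f x) (mollify k w x)) atTop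
      (𝓝 (∫ x in U, inner ℝ (f x) (w x))) := by
    have hcont : ∀ k, Continuous (mollify k w) := fun k =>
      (contDiff_mollify k hw.continuous.locallyIntegrable).continuous
    refine tendsto_integral_of_dominated_convergence (fun x => ‖f x‖ * (K * 1 + B))
      (fun k => hf.1.inner (hcont k).aestronglyMeasurable)
      ((hf.integrable one_le_two).norm.mul_const _) (fun k => Eventually.of_forall fun x => ?_)
      (Eventually.of_forall fun x => ?_)
    · refine (norm_inner_le_norm _ _).trans (mul_le_mul_of_nonneg_left ?_ (norm_nonneg _))
      have h1 := norm_mollify_sub_le k hw x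
      have h2 : (1 / (k + 1) : ℝ) ≤ 1 := by
        rw [div_le_one (by positivity)]; linarith [k.cast_nonneg (α := ℝ)]
      have h3 : ‖mollify k w x‖ ≤ ‖mollify k w x - w x‖ + ‖w x‖ := by
        simpa using norm_add_le (mollify k w x - w x) (w x)
      have h4 := hB x
      have h5 : (K : ℝ) * (1 / (k + 1)) ≤ K * 1 := by gcongr
      linarith
    · exact tendsto_const_nhds.inner (ContDiffBump.convolution_tendsto_right_of_continuous
        tendsto_shrinkingBump_rOut hw.continuous x)
  -- Mollification enlarges the support by at most `1 / (k + 1)`, so it eventually stays in `U`.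
  obtain ⟨r, hr, hrU⟩ := hcw.isCompact.exists_cthickening_subset_open hU hsub
  refine tendsto_nhds_unique (hlim1.congr' ?_) hlim2
  filter_upwards [(tendsto_one_div_add_atTop_nhds_zero_nat (𝕜 := ℝ)).eventually
    (gt_mem_nhds hr)] with k hk
  have hs : tsupport (mollify k w) ⊆ Metric.cthickening r (tsupport w) :=
    (tsupport_mollify_subset k).trans (Metric.cthickening_mono hk.le _)
  exact hweak _ (contDiff_mollify k hw.continuous.locallyIntegrable)
    (hcw.isCompact.cthickening.of_isClosed_subset (isClosed_tsupport _) hs) (hs.trans hrU)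

end TestPairs

/-! ### Collapsing the inclusions -/

/-- The product of a bounded Lipschitz function with a function that is bounded and Lipschitz on a
set outside of which the first function vanishes. -/
theorem lipschitzWith_smul_of_eq_zero {X V : Type*} [PseudoMetricSpace X] [NormedAddCommGroup V]
    [NormedSpace ℝ V] {S : Set X} {c : X → ℝ} {F : X → V} {K L B : ℝ≥0} (hc : LipschitzWith K c)
    (hc1 : ∀ x, |c x| ≤ 1) (hc0 : ∀ x ∉ S, c x = 0) (hF : LipschitzOnWith L F S)
    (hB : ∀ x ∈ S, ‖F x‖ ≤ B) : LipschitzWith (K * B + L) fun x => c x • F x := by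
  have key : ∀ x ∈ S, ∀ y, ‖c x • F x - c y • F y‖ ≤ (K * B + L) * dist x y := by
    intro x hx y
    have h1 : |c x - c y| ≤ K * dist x y := by simpa [Real.dist_eq] using hc.dist_le_mul x y
    have h2 : |c x - c y| * ‖F x‖ ≤ K * dist x y * B :=
      mul_le_mul h1 (hB x hx) (norm_nonneg _) (by positivity)
    by_cases hy : y ∈ S
    · have e : c x • F x - c y • F y = (c x - c y) • F x + c y • (F x - F y) := by
        rw [sub_smul, smul_sub]; abel
      have h3 : ‖F x - F y‖ ≤ L * dist x y := by
        simpa [dist_eq_norm] using hF.dist_le_mul x hx y hy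
      rw [e]
      refine (norm_add_le _ _).trans ?_
      rw [norm_smul, norm_smul, Real.norm_eq_abs, Real.norm_eq_abs]
      have := mul_le_mul (hc1 y) h3 (norm_nonneg _) zero_le_one
      linarith
    · rw [hc0 y hy] at h2 ⊢
      rw [zero_smul, sub_zero, norm_smul, Real.norm_eq_abs]
      rw [sub_zero] at h2
      have : 0 ≤ (L : ℝ) * dist x y := by positivity
      linarith
  refine LipschitzWith.of_dist_le_mul fun x y => ?_
  rw [dist_eq_norm]
  push_cast
  by_cases hx : x ∈ S
  · exact key x hx y
  · by_cases hy : y ∈ S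
    · rw [norm_sub_rev, dist_comm]
      exact key y hy x
    · rw [hc0 x hx, hc0 y hy]
      simp only [zero_smul, sub_self, norm_zero]
      positivity

section Collapse

variable {d : ℕ}

theorem norm_le_of_mem_unitCell {y : Rn d} (hy : y ∈ unitCell d) : ‖y‖ ≤ √d := by
  rw [EuclideanSpace.norm_eq]
  refine Real.sqrt_le_sqrt ?_
  have : ∀ i ∈ Finset.univ, ‖y i‖ ^ 2 ≤ 1 := by
    intro i _
    rw [Real.norm_eq_abs, sq_abs]
    nlinarith [(hy i).1, (hy i).2]
  simpa using Finset.sum_le_sum this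

theorem le_dist_of_lt_setEDist {S T : Set (Rn d)} {r : ℝ} (h : ENNReal.ofReal r < setEDist S T)
    {x y : Rn d} (hx : x ∈ S) (hy : y ∈ T) : r < dist x y := by
  have h1 : setEDist S T ≤ edist x y := (iInf₂_le x hx).trans (iInf₂_le y hy)
  have h2 := h.trans_le h1
  rw [edist_dist] at h2
  exact (ENNReal.ofReal_lt_ofReal_iff'.1 h2).1

/-- The ball of radius `η` about a point of `ω` is connected and misses the frontier of the cell, so
it cannot leave the cell. -/
theorem mem_unitCell_of_dist_lt {ω : Set (Rn d)} {η : ℝ} (hω : ω ⊆ unitCell d)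
    (h : ENNReal.ofReal η < setEDist ω (frontier (unitCell d))) {x y : Rn d} (hx : x ∈ ω)
    (hxy : dist y x < η) : y ∈ unitCell d := by
  have hη : 0 < η := dist_nonneg.trans_lt hxy
  have hfr : ∀ z ∈ Metric.ball x η, z ∉ frontier (unitCell d) := by
    intro z hz hzf
    have := le_dist_of_lt_setEDist h hx hzf
    rw [Metric.mem_ball, dist_comm] at hz
    exact lt_asymm this hz
  have hcases : ∀ z ∈ Metric.ball x η,
      (z ∈ unitCell d → z ∈ interior (unitCell d)) ∧ (z ∉ unitCell d → z ∈ interior (unitCell d)ᶜ) := by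
    intro z hz
    refine ⟨fun h1 => ?_, fun h1 => ?_⟩
    · rw [← self_sdiff_frontier]
      exact ⟨h1, hfr z hz⟩
    · rw [← self_sdiff_frontier, frontier_compl]
      exact ⟨h1, hfr z hz⟩
  have hsub := IsPreconnected.subset_left_of_subset_union (isOpen_interior (s := unitCell d))
    (isOpen_interior (s := (unitCell d)ᶜ))
    (disjoint_compl_right.mono interior_subset interior_subset)
    (fun z hz => (em (z ∈ unitCell d)).imp (hcases z hz).1 (hcases z hz).2)
    ⟨x, Metric.mem_ball_self hη, (hcases x (Metric.mem_ball_self hη)).1 (hω hx)⟩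
    (convex_ball x η).isPreconnected
  exact interior_subset (hsub hxy)

theorem round_eq_of_mem {a : ℝ} {k : ℤ} (h1 : -(1 / 2) < a - k) (h2 : a - k < 1 / 2) :
    round a = k := by
  rw [round_eq, Int.floor_eq_iff]
  constructor <;> linarith

/-- The coordinatewise nearest lattice point. -/
def nearestIndex (x : Rn d) : Fin d → ℤ := fun i => round (x i)

theorem nearestIndex_eq {x : Rn d} {k : Fin d → ℤ} (h : x - latticePoint k ∈ unitCell d) :
    nearestIndex x = k := by
  funext i
  exact round_eq_of_mem (h i).1 (h i).2

/-- For each model inclusion there are uniformly Lipschitz maps close to the identity that collapse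
each inclusion to a point and fix the boundary of the domain. -/
theorem exists_collapse {ω : Set (Rn d)} (hω : IsModelInclusion ω) {κ : ℝ} (hκ : 0 < κ) :
    ∃ K : ℝ≥0, ∀ (Ω : Set (Rn d)) (ε : ℝ), 0 < ε → ∃ P : Rn d → Rn d, LipschitzWith K P ∧
      (∀ x, dist (P x) x ≤ √d * ε) ∧ (∀ x ∈ frontier Ω, P x = x) ∧
      ∀ x ∈ inclusions ω Ω κ ε, P =ᶠ[𝓝 x] fun _ => P x := by
  obtain ⟨η₀, hη₀, hη₀'⟩ := ENNReal.lt_iff_exists_nnreal_btwn.1 hω.dist_pos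
  have hη₀pos : (0 : ℝ) < η₀ := by exact_mod_cast hη₀
  have hne : ω.Nonempty := hω.simplyConnected.nonempty
  -- The bound by `η₀` keeps the transition layer around `ω` inside the cell; the bound by `κ` keeps
  -- the scaled layers of the selected inclusions off `∂Ω`.
  set η : ℝ := min κ η₀ with hη
  have hηpos : 0 < η := lt_min hκ hη₀pos
  have hcell : ENNReal.ofReal η < setEDist ω (frontier (unitCell d)) := by
    refine lt_of_le_of_lt ?_ hη₀'
    rw [← ENNReal.ofReal_coe_nnreal]
    exact ENNReal.ofReal_le_ofReal (min_le_right _ _)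
  set χ : Rn d → ℝ := fun y => max 0 (1 - Metric.infDist y ω / η) with hχ
  have hχlip : LipschitzWith ⟨η⁻¹, by positivity⟩ χ := by
    refine LipschitzWith.const_max ?_ 0
    refine LipschitzWith.of_dist_le_mul fun x y => ?_
    have := (Metric.lipschitz_infDist_pt ω).dist_le_mul x y
    rw [Real.dist_eq] at this ⊢
    have e : 1 - Metric.infDist x ω / η - (1 - Metric.infDist y ω / η) =
      -(η⁻¹ * (Metric.infDist x ω - Metric.infDist y ω)) := by field_simp; ring
    rw [e, abs_neg, abs_mul, abs_of_pos (by positivity)]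
    rw [NNReal.coe_one, one_mul] at this
    exact mul_le_mul_of_nonneg_left this (by positivity)
  have hχ1 : ∀ y, |χ y| ≤ 1 := by
    intro y
    rw [abs_of_nonneg (le_max_left _ _)]
    refine max_le zero_le_one ?_
    have : 0 ≤ Metric.infDist y ω / η := div_nonneg Metric.infDist_nonneg hηpos.le
    linarith
  have hχω : ∀ y ∈ ω, χ y = 1 := by
    intro y hy
    simp [hχ, Metric.infDist_zero_of_mem hy]
  have hχne : ∀ y, χ y ≠ 0 → ∃ z ∈ ω, dist y z < η := by
    intro y hy
    rw [← Metric.infDist_lt_iff hne]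
    by_contra hcon
    refine hy (max_eq_left ?_)
    have := (one_le_div hηpos).2 (not_lt.1 hcon)
    linarith
  have hχY : ∀ y, χ y ≠ 0 → y ∈ unitCell d := by
    intro y hy
    obtain ⟨z, hz, hyz⟩ := hχne y hy
    exact mem_unitCell_of_dist_lt hω.subset_cell hcell hz hyz
  -- The map `y ↦ y - q y` sends `ω` to the origin and is the identity outside the layer. Since `χ`
  -- is supported in the bounded cell, `q` is globally Lipschitz.
  set q : Rn d → Rn d := fun y => χ y • y with hq
  set B : ℝ≥0 := ⟨√d, by positivity⟩
  obtain ⟨L, hqlip⟩ : ∃ L : ℝ≥0, LipschitzWith L q :=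
    ⟨_, lipschitzWith_smul_of_eq_zero (S := {y | χ y ≠ 0}) (B := B) hχlip hχ1
      (fun y hy => by simpa using hy) LipschitzWith.id.lipschitzOnWith
      fun y hy => norm_le_of_mem_unitCell (hχY y hy)⟩
  have hqnorm : ∀ y, ‖q y‖ ≤ √d := by
    intro y
    by_cases hy : χ y = 0
    · simp [hq, hy]
    · rw [hq, norm_smul, Real.norm_eq_abs]
      have := mul_le_mul (hχ1 y) (norm_le_of_mem_unitCell (hχY y hy)) (norm_nonneg _) zero_le_one
      linarith
  have hqY : ∀ y, q y ≠ 0 → χ y ≠ 0 := fun y hy h0 => hy (by simp [hq, h0])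
  -- The rescaled map `x ↦ ε q(x/ε - k)` has the same Lipschitz constant `L` as `q`, whence the
  -- independence of `ε`.
  refine ⟨1 + 2 * L, fun Ω ε hε => ?_⟩
  set N : Set (Fin d → ℤ) := {k : Fin d → ℤ | inclusion ω ε k ⊆ Ω ∧
    ENNReal.ofReal (κ * ε) < setEDist (inclusion ω ε k) (frontier Ω)} with hN
  classical
  set Q : (Fin d → ℤ) → Rn d → Rn d := fun k x =>
    if k ∈ N then q (ε⁻¹ • x - latticePoint k) else 0 with hQ
  have hQlip : ∀ k x y, ε * ‖Q k x - Q k y‖ ≤ L * dist x y := by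
    intro k x y
    by_cases hk : k ∈ N
    · simp only [hQ, hk, if_true]
      have := hqlip.dist_le_mul (ε⁻¹ • x - latticePoint k) (ε⁻¹ • y - latticePoint k)
      rw [dist_sub_right, dist_smul₀, dist_eq_norm, Real.norm_of_nonneg (by positivity)] at this
      calc _ ≤ ε * (L * (ε⁻¹ * dist x y)) := by gcongr
        _ = _ := by field_simp
    · simp only [hQ, hk, if_false, sub_self, norm_zero, mul_zero]
      positivity
  have hQ0 : ∀ k x, k ≠ nearestIndex (ε⁻¹ • x) → Q k x = 0 := by
    intro k x hk
    by_contra hne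
    by_cases hkN : k ∈ N
    · simp only [hQ, hkN, if_true] at hne
      exact hk (nearestIndex_eq (hχY _ (hqY _ hne))).symm
    · simp [hQ, hkN] at hne
  -- At each point at most one `Q k` is nonzero, namely that of the nearest lattice point.
  set P : Rn d → Rn d := fun x => x - ε • Q (nearestIndex (ε⁻¹ • x)) x with hP
  have hPk : ∀ k x, ε⁻¹ • x - latticePoint k ∈ unitCell d → P x = x - ε • Q k x := by
    intro k x hk
    simp only [hP]
    rw [nearestIndex_eq hk]
  refine ⟨P, ?_, ?_, ?_, ?_⟩
  · refine LipschitzWith.of_dist_le_mul fun x y => ?_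
    set k := nearestIndex (ε⁻¹ • x)
    set j := nearestIndex (ε⁻¹ • y)
    have e : P x - P y = (x - y) - ε • (Q k x - Q j y) := by
      simp only [hP, smul_sub]; abel
    have h1 : ε * ‖Q k x - Q j y‖ ≤ 2 * L * dist x y := by
      by_cases hkj : k = j
      · rw [← hkj]
        have := hQlip k x y
        have h0 : 0 ≤ (L : ℝ) * dist x y := by positivity
        linarith
      -- For different nearest indices each of `Q k` and `Q j` vanishes at one of the two points, so
      -- the difference splits into two increments; this gives the factor `2`.
      · have e2 : Q k x - Q j y = (Q k x - Q k y) + (Q j x - Q j y) := by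
          rw [hQ0 k y hkj, hQ0 j x (Ne.symm hkj)]; abel
        have h2 := hQlip k x y
        have h3 := hQlip j x y
        rw [e2]
        have h4 := norm_add_le (Q k x - Q k y) (Q j x - Q j y)
        nlinarith
    rw [dist_eq_norm, e]
    refine (norm_sub_le _ _).trans ?_
    rw [norm_smul, Real.norm_of_nonneg hε.le, ← dist_eq_norm]
    push_cast
    linarith
  · intro x
    have : ‖Q (nearestIndex (ε⁻¹ • x)) x‖ ≤ √d := by
      simp only [hQ]
      split_ifs
      · exact hqnorm _
      · simp
    simp only [hP, dist_eq_norm, sub_sub_cancel_left, norm_neg, norm_smul,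
      Real.norm_of_nonneg hε.le]
    nlinarith
  -- A point of `∂Ω` moved by `P` would lie within `κ ε` of a selected inclusion, against the
  -- selection rule.
  · intro x hx
    by_contra hne
    set k := nearestIndex (ε⁻¹ • x)
    have hQne : Q k x ≠ 0 := fun h0 => hne (by simp only [hP]; rw [h0]; simp)
    have hkN : k ∈ N := by
      by_contra hk
      simp [hQ, hk] at hQne
    simp only [hQ, hkN, if_true] at hQne
    obtain ⟨z, hz, hdist⟩ := hχne _ (hqY _ hQne)
    have hlt := le_dist_of_lt_setEDist hkN.2 (mem_image_of_mem _ hz) hx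
    have e : dist (ε • (latticePoint k + z)) x = ε * dist (ε⁻¹ • x - latticePoint k) z := by
      rw [dist_comm, dist_eq_norm, dist_eq_norm, ← Real.norm_of_nonneg hε.le, ← norm_smul,
        Real.norm_of_nonneg hε.le]
      congr 1
      rw [smul_sub, smul_sub, smul_inv_smul₀ hε.ne', smul_add]
      abel
    rw [e] at hlt
    have : dist (ε⁻¹ • x - latticePoint k) z < κ := hdist.trans_le (min_le_left _ _)
    nlinarith
  · intro x hx
    simp only [inclusions, mem_iUnion] at hx
    obtain ⟨k, hkN, hxk⟩ := hx
    have hopen : IsOpen (inclusion ω ε k) := by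
      have : inclusion ω ε k = (fun x => ε⁻¹ • x - latticePoint k) ⁻¹' ω := by
        ext y
        constructor
        · rintro ⟨z, hz, rfl⟩
          simpa [inv_smul_smul₀ hε.ne'] using hz
        · intro hy
          exact ⟨_, hy, by simp [smul_inv_smul₀ hε.ne']⟩
      rw [this]
      exact hω.isOpen.preimage (by fun_prop)
    -- On the inclusion `χ = 1`, so all its points go to the lattice point `ε k`; openness of the
    -- inclusion gives local constancy.
    have hval : ∀ y ∈ inclusion ω ε k, P y = ε • latticePoint k := by
      rintro _ ⟨z, hz, rfl⟩
      have e : ε⁻¹ • (ε • (latticePoint k + z)) - latticePoint k = z := by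
        simp [inv_smul_smul₀ hε.ne']
      rw [hPk k _ (by rw [e]; exact hω.subset_cell hz)]
      have hkN' : k ∈ N := hkN
      simp only [hQ, hkN', if_true]
      rw [e]
      simp [hq, hχω z hz]
    filter_upwards [hopen.mem_nhds hxk] with y hy
    rw [hval y hy, hval x hxk]

end Collapse

/-! ### Surface measure on the graph -/

section Surface

variable {d m : ℕ}

/-- For the sup norm the two measures agree, and passing from the Euclidean to the sup norm is
`1`-Lipschitz. One inequality is enough, so no normalizing constant is computed. -/
theorem volume_le_hausdorffMeasure {n : ℕ} (S : Set (Rn n)) : volume S ≤ μH[(n : ℝ)] S := by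
  have h1 : volume S = volume ((WithLp.ofLp : Rn n → Fin n → ℝ) '' S) := by
    rw [← (EuclideanSpace.volume_preserving_symm_measurableEquiv_toLp
      (Fin n)).symm.measure_preimage_equiv S]
    congr 1
    ext y
    constructor
    · intro hy
      exact ⟨_, hy, rfl⟩
    · rintro ⟨x, hx, rfl⟩
      exact hx
  have h2 := hausdorffMeasure_pi_real (ι := Fin n)
  rw [Fintype.card_fin] at h2
  rw [h1, ← h2]
  simpa using (PiLp.lipschitzWith_ofLp 2 (fun _ : Fin n => ℝ)).hausdorffMeasure_image_le
    (d := n) n.cast_nonneg S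

theorem hausdorffMeasure_eq_zero_of_volume {n : ℕ} {S : Set (Rn n)} (h : volume S = 0) :
    μH[(n : ℝ)] S = 0 := by
  have h1 : volume ((WithLp.toLp 2 : (Fin n → ℝ) → Rn n) ⁻¹' S) = 0 := by
    rw [← h]
    exact (EuclideanSpace.volume_preserving_symm_measurableEquiv_toLp
      (Fin n)).symm.measure_preimage_equiv S
  have h2 := hausdorffMeasure_pi_real (ι := Fin n)
  rw [Fintype.card_fin] at h2
  rw [← h2] at h1
  have h3 := (PiLp.lipschitzWith_toLp 2 (fun _ : Fin n => ℝ)).hausdorffMeasure_image_le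
    (d := n) n.cast_nonneg ((WithLp.toLp 2 : (Fin n → ℝ) → Rn n) ⁻¹' S)
  rw [h1, mul_zero, image_preimage_eq _ (WithLp.toLp_surjective 2)] at h3
  exact le_antisymm h3 zero_le

theorem lipschitzWith_graphMap (Φ : Rigid d) {ψ : Rn (d - 1) → ℝ} {M : ℝ≥0}
    (hψ : LipschitzWith M ψ) : LipschitzWith (1 + M) (graphMap Φ ψ) := by
  refine LipschitzWith.of_dist_le_mul fun x y => ?_
  rw [graphMap, graphMap, Φ.dist_map, dist_eq_norm]
  have h := WithLp.prod_norm_sq_eq_of_L2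
    (WithLp.toLp 2 (x, ψ x) - WithLp.toLp 2 (y, ψ y) : Local d)
  have h1 : ‖ψ x - ψ y‖ ≤ M * dist x y := by
    simpa [dist_eq_norm] using hψ.dist_le_mul x y
  refine le_of_sq_le_sq ?_ (by positivity)
  rw [h]
  change ‖x - y‖ ^ 2 + ‖ψ x - ψ y‖ ^ 2 ≤ _
  rw [← dist_eq_norm x y]
  push_cast
  have h2 : ‖ψ x - ψ y‖ ^ 2 ≤ (M * dist x y) ^ 2 := pow_le_pow_left₀ (norm_nonneg _) h1 2
  have h3 : 0 ≤ (M : ℝ) * dist x y ^ 2 := by positivity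
  nlinarith

@[simp] theorem localBase_graphMap (Φ : Rigid d) (ψ : Rn (d - 1) → ℝ) (x' : Rn (d - 1)) :
    localBase Φ (graphMap Φ ψ x') = x' := by
  simp [localBase, graphMap]

@[simp] theorem height_graphMap (Φ : Rigid d) (ψ : Rn (d - 1) → ℝ) (x' : Rn (d - 1)) :
    height Φ ψ (graphMap Φ ψ x') = 0 := by
  simp [height, graphMap]

theorem graphMap_localBase {Φ : Rigid d} {ψ : Rn (d - 1) → ℝ} {x : Rn d}
    (h : height Φ ψ x = 0) : graphMap Φ ψ (localBase Φ x) = x := by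
  rw [← liftPoint_zero, ← h, liftPoint_localBase_height]

/-- The linear part of `localBase`. -/
def localBaseL (Φ : Rigid d) : Rn d →L[ℝ] Rn (d - 1) :=
  (WithLp.fstL 2 ℝ (Rn (d - 1)) ℝ).comp
    (Φ.symm.linearIsometryEquiv.toContinuousLinearEquiv : Rn d →L[ℝ] Local d)

theorem hasFDerivAt_localBase (Φ : Rigid d) (x : Rn d) :
    HasFDerivAt (localBase Φ) (localBaseL Φ) x := by
  have h1 : localBase Φ = fun y => localBaseL Φ y + localBase Φ 0 := by
    funext y
    have := Φ.symm.map_vadd 0 y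
    simp only [vadd_eq_add, add_zero] at this
    simp only [localBase, localBaseL]
    rw [this]
    simp
  rw [h1]
  exact (localBaseL Φ).hasFDerivAt.add_const _

theorem norm_localBaseL_le (Φ : Rigid d) : ‖localBaseL Φ‖ ≤ 1 := by
  rw [← (hasFDerivAt_localBase Φ 0).fderiv]
  exact_mod_cast norm_fderiv_le_of_lipschitz ℝ (lipschitzWith_localBase Φ)

theorem measurableSet_boundaryPortion (Ω : Set (Rn d)) (M₀ : ℝ) (Φ : Rigid d)
    (ψ : Rn (d - 1) → ℝ) (r : ℝ) : MeasurableSet (boundaryPortion Ω M₀ Φ ψ r) :=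
  (isClosed_frontier.inter isClosed_frontier).measurableSet

/-! ### Comparison of surface measure with Lebesgue measure on the base. -/

section Chart

variable {Ω : Set (Rn d)} {x₀ : Rn d} {M : ℝ≥0} {M₀ r₀ : ℝ} {Φ : Rigid d} {ψ : Rn (d - 1) → ℝ}
  {r : ℝ}

theorem IsBoundaryChart.graphMap_mem (h : IsBoundaryChart Ω x₀ M M₀ r₀ Φ ψ) (hr0 : 0 < r)
    (hr : r < r₀) {x' : Rn (d - 1)} (hx : x' ∈ Metric.closedBall 0 r) :
    graphMap Φ ψ x' ∈ boundaryPortion Ω M₀ Φ ψ r := by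
  rw [h.mem_boundaryPortion_iff hr0 hr]
  simpa using hx

/-- The projection to the base is `1`-Lipschitz and maps the boundary portion onto the closed ball,
so it does not increase Hausdorff measure. This one-sided comparison replaces the area formula. -/
theorem IsBoundaryChart.volume_le_surfaceMeasure (hd : 1 ≤ d)
    (h : IsBoundaryChart Ω x₀ M M₀ r₀ Φ ψ) (hr0 : 0 < r) (hr : r < r₀) (S : Set (Rn (d - 1))) :
    volume (S ∩ Metric.closedBall 0 r) ≤
      surfaceMeasure (boundaryPortion Ω M₀ Φ ψ r) (localBase Φ ⁻¹' S) := by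
  rw [surfaceMeasure, Measure.restrict_apply' (measurableSet_boundaryPortion _ _ _ _ _)]
  have hsub : S ∩ Metric.closedBall 0 r ⊆
      localBase Φ '' (localBase Φ ⁻¹' S ∩ boundaryPortion Ω M₀ Φ ψ r) := by
    rintro x' ⟨hS, hx'⟩
    exact ⟨graphMap Φ ψ x', ⟨by simpa using hS, h.graphMap_mem hr0 hr hx'⟩, by simp⟩
  refine (measure_mono hsub).trans ((volume_le_hausdorffMeasure _).trans ?_)
  have := (lipschitzWith_localBase Φ).hausdorffMeasure_image_le (d := ((d - 1 : ℕ) : ℝ))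
    (Nat.cast_nonneg _) (localBase Φ ⁻¹' S ∩ boundaryPortion Ω M₀ Φ ψ r)
  rw [Nat.cast_sub hd, Nat.cast_one] at this ⊢
  simpa using this

theorem IsBoundaryChart.ae_graphMap (hd : 1 ≤ d) (h : IsBoundaryChart Ω x₀ M M₀ r₀ Φ ψ)
    (hr0 : 0 < r) (hr : r < r₀) {p : Rn d → Prop}
    (hp : ∀ᵐ x ∂surfaceMeasure (boundaryPortion Ω M₀ Φ ψ r), p x) :
    ∀ᵐ x', x' ∈ Metric.closedBall (0 : Rn (d - 1)) r → p (graphMap Φ ψ x') := by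
  rw [ae_iff]
  have e : {x' | ¬(x' ∈ Metric.closedBall (0 : Rn (d - 1)) r → p (graphMap Φ ψ x'))} =
      {x' | ¬ p (graphMap Φ ψ x')} ∩ Metric.closedBall 0 r := by
    ext x'; simp [and_comm]
  rw [e]
  refine le_antisymm ((h.volume_le_surfaceMeasure hd hr0 hr _).trans (le_of_eq ?_)) zero_le
  change surfaceMeasure _ {x | ¬ p (graphMap Φ ψ (localBase Φ x))} = 0
  rw [← ae_iff]
  filter_upwards [hp, ae_restrict_mem (measurableSet_boundaryPortion Ω M₀ Φ ψ r)] with x hx hxΓ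
  rwa [graphMap_localBase ((h.mem_boundaryPortion_iff hr0 hr).1 hxΓ).2]

/-- Turns convergence of traces in `L²` of the surface measure into convergence on the ball of the
base. -/
theorem IsBoundaryChart.lintegral_graphMap_le (hd : 1 ≤ d) (h : IsBoundaryChart Ω x₀ M M₀ r₀ Φ ψ)
    (hr0 : 0 < r) (hr : r < r₀) {H : Rn d → ℝ≥0∞}
    (hH : Measurable fun x' => H (graphMap Φ ψ x')) :
    ∫⁻ x' in Metric.closedBall 0 r, H (graphMap Φ ψ x') ≤
      ∫⁻ x, H x ∂surfaceMeasure (boundaryPortion Ω M₀ Φ ψ r) := by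
  have hm := (lipschitzWith_localBase Φ).continuous.measurable
  have hle : volume.restrict (Metric.closedBall 0 r) ≤
      (surfaceMeasure (boundaryPortion Ω M₀ Φ ψ r)).map (localBase Φ) := by
    refine Measure.le_iff.2 fun S hS => ?_
    rw [Measure.restrict_apply hS, Measure.map_apply hm hS]
    exact h.volume_le_surfaceMeasure hd hr0 hr S
  refine (lintegral_mono' hle le_rfl).trans (le_of_eq ?_)
  rw [lintegral_map hH hm]
  refine setLIntegral_congr_fun (measurableSet_boundaryPortion Ω M₀ Φ ψ r) fun x hx => ?_
  rw [graphMap_localBase ((h.mem_boundaryPortion_iff hr0 hr).1 hx).2]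

/-- The rim of the boundary portion is the Lipschitz image of a null sphere. Off the rim,
derivatives of `g` along the graph see a full neighbourhood on which `g` is controlled. -/
theorem IsBoundaryChart.ae_localBase_mem_ball (hd : 1 ≤ d)
    (h : IsBoundaryChart Ω x₀ M M₀ r₀ Φ ψ) (hr0 : 0 < r) (hr : r < r₀) :
    ∀ᵐ x ∂surfaceMeasure (boundaryPortion Ω M₀ Φ ψ r), localBase Φ x ∈ Metric.ball 0 r := by
  rw [ae_iff, surfaceMeasure, Measure.restrict_apply' (measurableSet_boundaryPortion _ _ _ _ _)]
  have hsub : {x | localBase Φ x ∉ Metric.ball 0 r} ∩ boundaryPortion Ω M₀ Φ ψ r ⊆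
      graphMap Φ ψ '' Metric.sphere 0 r := by
    rintro x ⟨hx, hxΓ⟩
    obtain ⟨h1, h2⟩ := (h.mem_boundaryPortion_iff hr0 hr).1 hxΓ
    refine ⟨localBase Φ x, ?_, graphMap_localBase h2⟩
    simp only [mem_ofPred_eq, Metric.mem_ball, dist_zero_right, not_lt] at hx
    simpa using le_antisymm h1 hx
  refine measure_mono_null hsub ?_
  have h0 : μH[((d - 1 : ℕ) : ℝ)] (Metric.sphere (0 : Rn (d - 1)) r) = 0 :=
    hausdorffMeasure_eq_zero_of_volume (Measure.addHaar_sphere_of_ne_zero _ _ hr0.ne')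
  have h1 := (lipschitzWith_graphMap Φ h.lipschitz).hausdorffMeasure_image_le
    (d := ((d - 1 : ℕ) : ℝ)) (Nat.cast_nonneg _) (Metric.sphere 0 r)
  rw [h0, mul_zero, Nat.cast_sub hd, Nat.cast_one] at h1
  exact le_antisymm h1 zero_le

end Chart

/-! ### Tangential gradients and extension of boundary values -/

theorem tangentialGradient_graphMap (Φ : Rigid d) (ψ : Rn (d - 1) → ℝ) (g : Rn d → Rn m)
    (x' : Rn (d - 1)) : tangentialGradient Φ ψ g (graphMap Φ ψ x') =
      gradOf (((fderiv ℝ (fun y => g (graphMap Φ ψ y)) x').comp (localBaseL Φ)).comp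
        (fderiv ℝ (graphMap Φ ψ) x').range.starProjection) := by
  have key : ∀ y', y' = x' →
      gradOf (((fderiv ℝ (fun y => g (graphMap Φ ψ y)) y').comp (localBaseL Φ)).comp
        (fderiv ℝ (graphMap Φ ψ) y').range.starProjection) =
      gradOf (((fderiv ℝ (fun y => g (graphMap Φ ψ y)) x').comp (localBaseL Φ)).comp
        (fderiv ℝ (graphMap Φ ψ) x').range.starProjection) := by
    rintro _ rfl
    rfl
  exact key _ (localBase_graphMap Φ ψ x')

/-- Since `π ∘ Dγ = id` and `Dγ v` is tangent, the tangential gradient applied to `Dγ v` returns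
`D(g ∘ γ) v`; the factor `1 + M` bounds `Dγ`. -/
theorem norm_fderiv_le_tangentialGradient {Φ : Rigid d} {ψ : Rn (d - 1) → ℝ} {M : ℝ≥0}
    (hψ : LipschitzWith M ψ) (g : Rn d → Rn m) {x' : Rn (d - 1)}
    (hx : DifferentiableAt ℝ (graphMap Φ ψ) x') :
    ‖fderiv ℝ (fun y => g (graphMap Φ ψ y)) x'‖ ≤
      (1 + M) * ‖tangentialGradient Φ ψ g (graphMap Φ ψ x')‖ := by
  refine ContinuousLinearMap.opNorm_le_bound _ (by positivity) fun v => ?_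
  set L := ((fderiv ℝ (fun y => g (graphMap Φ ψ y)) x').comp (localBaseL Φ)).comp
        (fderiv ℝ (graphMap Φ ψ) x').range.starProjection with hL
  have h1 : localBaseL Φ (fderiv ℝ (graphMap Φ ψ) x' v) = v := by
    have hc := (hasFDerivAt_localBase Φ (graphMap Φ ψ x')).comp x' hx.hasFDerivAt
    have e : localBase Φ ∘ graphMap Φ ψ = id := by funext y; simp
    rw [e] at hc
    have := hc.unique (hasFDerivAt_id x')
    exact congrArg (fun T => T v) this
  have h2 : L (fderiv ℝ (graphMap Φ ψ) x' v) = fderiv ℝ (fun y => g (graphMap Φ ψ y)) x' v := by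
    have h3 : (fderiv ℝ (graphMap Φ ψ) x').range.starProjection (fderiv ℝ (graphMap Φ ψ) x' v) =
        fderiv ℝ (graphMap Φ ψ) x' v :=
      Submodule.starProjection_eq_self_iff.2 ⟨v, rfl⟩
    simp only [hL, ContinuousLinearMap.comp_apply]
    rw [h3, h1]
  rw [← h2, tangentialGradient_graphMap]
  refine (norm_apply_le_norm_gradOf L _).trans ?_
  have h4 : ‖fderiv ℝ (graphMap Φ ψ) x' v‖ ≤ (1 + M) * ‖v‖ := by
    refine (ContinuousLinearMap.le_opNorm _ v).trans ?_
    gcongr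
    exact_mod_cast norm_fderiv_le_of_lipschitz ℝ (lipschitzWith_graphMap Φ hψ)
  nlinarith [norm_nonneg (gradOf L)]

variable {Ω : Set (Rn d)} {x₀ : Rn d} {M : ℝ≥0} {M₀ r₀ : ℝ} {Φ : Rigid d} {ψ : Rn (d - 1) → ℝ}
  {r : ℝ}

/-- `supNorm` takes the value zero when the essential supremum is infinite, so some finite bound `B`
must be known; its size is irrelevant. -/
theorem ae_norm_le_supNorm {V : Type*} [NormedAddCommGroup V] {Γ : Set (Rn d)} {h : Rn d → V}
    {B : ℝ} (hB : ∀ᵐ x ∂surfaceMeasure Γ, ‖h x‖ ≤ B) :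
    ∀ᵐ x ∂surfaceMeasure Γ, ‖h x‖ ≤ supNorm Γ h := by
  have hfin : eLpNorm h ∞ (surfaceMeasure Γ) ≠ ∞ := by
    rw [eLpNorm_exponent_top]
    exact (eLpNormEssSup_lt_top_of_ae_bound hB).ne
  have := ae_le_eLpNormEssSup (f := h) (μ := surfaceMeasure Γ)
  filter_upwards [this] with x hx
  rw [← eLpNorm_exponent_top] at hx
  rw [supNorm, ← toReal_enorm]
  exact ENNReal.toReal_mono hfin hx

theorem supNorm_nonneg {V : Type*} [NormedAddCommGroup V] (Γ : Set (Rn d)) (h : Rn d → V) :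
    0 ≤ supNorm Γ h := ENNReal.toReal_nonneg

theorem IsBoundaryChart.lipschitzOnWith_comp_graphMap (h : IsBoundaryChart Ω x₀ M M₀ r₀ Φ ψ)
    (hr0 : 0 < r) (hr : r < r₀) {g : Rn d → Rn m} {K : ℝ≥0}
    (hg : LipschitzOnWith K g (boundaryPortion Ω M₀ Φ ψ r)) :
    LipschitzOnWith (K * (1 + M)) (fun y => g (graphMap Φ ψ y)) (Metric.closedBall 0 r) :=
  hg.comp (lipschitzWith_graphMap Φ h.lipschitz).lipschitzOnWith
    fun _ hx => h.graphMap_mem hr0 hr hx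

/-- A crude bound in terms of the Lipschitz constant of `g`, there only to ensure that the `supNorm`
of the tangential gradient is a genuine supremum. -/
theorem IsBoundaryChart.ae_norm_tangentialGradient_le (hd : 1 ≤ d)
    (h : IsBoundaryChart Ω x₀ M M₀ r₀ Φ ψ) (hr0 : 0 < r) (hr : r < r₀) {g : Rn d → Rn m} {K : ℝ≥0}
    (hg : LipschitzOnWith K g (boundaryPortion Ω M₀ Φ ψ r)) :
    ∀ᵐ x ∂surfaceMeasure (boundaryPortion Ω M₀ Φ ψ r), ‖tangentialGradient Φ ψ g x‖ ≤
      √(m * d) * (K * (1 + M)) := by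
  filter_upwards [h.ae_localBase_mem_ball hd hr0 hr,
    ae_restrict_mem (measurableSet_boundaryPortion Ω M₀ Φ ψ r)] with x hx hxΓ
  rw [← graphMap_localBase ((h.mem_boundaryPortion_iff hr0 hr).1 hxΓ).2,
    tangentialGradient_graphMap]
  refine (norm_gradOf_le _).trans (mul_le_mul_of_nonneg_left ?_ (by positivity))
  have h1 : ‖fderiv ℝ (fun y => g (graphMap Φ ψ y)) (localBase Φ x)‖ ≤ K * (1 + M) := by
    have := norm_fderiv_le_of_lipschitzOn ℝ (Filter.mem_of_superset
      (Metric.isOpen_ball.mem_nhds hx) Metric.ball_subset_closedBall)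
      (h.lipschitzOnWith_comp_graphMap hr0 hr hg)
    exact_mod_cast this
  refine (ContinuousLinearMap.opNorm_comp_le _ _).trans ?_
  have h2 := ContinuousLinearMap.opNorm_comp_le
    (fderiv ℝ (fun y => g (graphMap Φ ψ y)) (localBase Φ x)) (localBaseL Φ)
  have h3 := Submodule.starProjection_norm_le
    (fderiv ℝ (graphMap Φ ψ) (localBase Φ x)).range
  have h4 := norm_localBaseL_le Φ
  calc _ ≤ ((K : ℝ) * (1 + M) * 1) * 1 := by
        gcongr
        exact h2.trans (by gcongr)
    _ = _ := by ring

/-- Lipschitz boundary values extend to a Lipschitz function of the base point, with Lipschitz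
constant controlled by the tangential gradient. -/
theorem exists_boundary_extension (d m : ℕ) (hd : 1 ≤ d) (M : ℝ≥0) : ∃ C : ℝ≥0,
    ∀ {Ω : Set (Rn d)} {x₀ : Rn d} {M₀ r₀ : ℝ} {Φ : Rigid d} {ψ : Rn (d - 1) → ℝ} {r : ℝ},
    IsBoundaryChart Ω x₀ M M₀ r₀ Φ ψ → 0 < r → r < r₀ → ∀ {g : Rn d → Rn m} {K : ℝ≥0},
    LipschitzOnWith K g (boundaryPortion Ω M₀ Φ ψ r) → ∃ g' : Rn (d - 1) → Rn m,
      LipschitzWith (C * (supNorm (boundaryPortion Ω M₀ Φ ψ r)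
        (tangentialGradient Φ ψ g)).toNNReal) g' ∧
      (∀ x' ∈ Metric.closedBall 0 r, g' x' = g (graphMap Φ ψ x')) ∧
      ∀ x' ∈ Metric.ball 0 r, ‖g' x'‖ ≤ supNorm (boundaryPortion Ω M₀ Φ ψ r) g := by
  refine ⟨lipschitzExtensionConstant (Rn m) * (1 + M), ?_⟩
  intro Ω x₀ M₀ r₀ Φ ψ r h hr0 hr g K hg
  set Γ := boundaryPortion Ω M₀ Φ ψ r
  set T := supNorm Γ (tangentialGradient Φ ψ g) with hT
  have hlip := h.lipschitzOnWith_comp_graphMap hr0 hr hg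
  -- A first extension with the uncontrolled constant of `g` makes the function globally Lipschitz;
  -- that constant does not enter the result.
  obtain ⟨e, he, hee⟩ := hlip.extend_finite_dimension
  have hball : LipschitzOnWith ((1 + M) * T.toNNReal) e (Metric.ball 0 r) := by
    refine lipschitzOnWith_ball_of_ae_fderiv_le he ?_
    filter_upwards [h.ae_graphMap hd hr0 hr (ae_norm_le_supNorm
      (h.ae_norm_tangentialGradient_le hd hr0 hr hg)),
      (lipschitzWith_graphMap Φ h.lipschitz).ae_differentiableAt (μ := volume)] with x' h1 h2 hx'
    have heq : e =ᶠ[𝓝 x'] fun y => g (graphMap Φ ψ y) := by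
      filter_upwards [Metric.isOpen_ball.mem_nhds hx'] with y hy
      exact (hee (Metric.ball_subset_closedBall hy)).symm
    rw [heq.fderiv_eq]
    refine (norm_fderiv_le_tangentialGradient h.lipschitz g h2).trans ?_
    push_cast
    rw [Real.coe_toNNReal _ (supNorm_nonneg _ _)]
    exact mul_le_mul_of_nonneg_left (h1 (Metric.ball_subset_closedBall hx')) (by positivity)
  have hclosed : LipschitzOnWith ((1 + M) * T.toNNReal) e (Metric.closedBall 0 r) := by
    rw [← closure_ball (0 : Rn (d - 1)) hr0.ne']
    exact hball.closure he.continuous.continuousOn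
  -- A second extension, from the closed ball, where the Lipschitz constant is now the one given by
  -- the tangential gradient.
  obtain ⟨g', hg', hgg'⟩ := hclosed.extend_finite_dimension
  have heq : ∀ x' ∈ Metric.closedBall 0 r, g' x' = g (graphMap Φ ψ x') := fun x' hx' => by
    rw [← hgg' hx', ← hee hx']
  refine ⟨g', by rwa [mul_assoc], heq, ?_⟩
  have hbd : ∃ B, ∀ᵐ x ∂surfaceMeasure Γ, ‖g x‖ ≤ B := by
    obtain ⟨B, hB⟩ := (isCompact_closedBall (0 : Rn (d - 1)) r).exists_bound_of_continuousOn
      hg'.continuous.continuousOn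
    refine ⟨B, ?_⟩
    filter_upwards [ae_restrict_mem (measurableSet_boundaryPortion Ω M₀ Φ ψ r)] with x hx
    obtain ⟨h1, h2⟩ := (h.mem_boundaryPortion_iff hr0 hr).1 hx
    have hx' : localBase Φ x ∈ Metric.closedBall 0 r := by simpa using h1
    have := hB _ hx'
    rwa [heq _ hx', graphMap_localBase h2] at this
  obtain ⟨B, hB⟩ := hbd
  have hae := h.ae_graphMap hd hr0 hr (ae_norm_le_supNorm hB)
  intro x' hx'
  by_contra hcon
  -- A violation at one point would hold on a nonempty open set, which has positive measure, against
  -- the almost everywhere bound.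
  have hO : IsOpen (Metric.ball 0 r ∩ {y | supNorm Γ g < ‖g' y‖}) :=
    Metric.isOpen_ball.inter (isOpen_lt continuous_const hg'.continuous.norm)
  refine (hO.measure_pos volume ⟨x', hx', not_le.1 hcon⟩).ne' ?_
  refine measure_mono_null (fun y hy => ?_) (ae_iff.1 hae)
  intro hy'
  have := hy' (Metric.ball_subset_closedBall hy.1)
  rw [← heq y (Metric.ball_subset_closedBall hy.1)] at this
  exact not_le.2 hy.2 this

end Surface

/-! ### Integrals over strips along the graph -/

section Strips

variable {d m : ℕ}

theorem eLpNorm_two_sq {α V : Type*} [MeasurableSpace α] [NormedAddCommGroup V] (h : α → V)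
    (ν : Measure α) : eLpNorm h 2 ν ^ 2 = ∫⁻ x, ‖h x‖ₑ ^ 2 ∂ν := by
  have := eLpNorm_nnreal_pow_eq_lintegral (f := h) (μ := ν) (p := 2) two_ne_zero
  simpa using this

theorem sq_lintegral_le {α : Type*} [MeasurableSpace α] {ν : Measure α} {h : α → ℝ≥0∞}
    (hh : AEMeasurable h ν) : (∫⁻ x, h x ∂ν) ^ 2 ≤ ν univ * ∫⁻ x, h x ^ 2 ∂ν := by
  have h1 := ENNReal.lintegral_mul_le_Lp_mul_Lq ν Real.HolderConjugate.two_two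
    (aemeasurable_const (b := (1 : ℝ≥0∞))) hh
  simp only [Pi.mul_apply, one_mul, lintegral_const, ENNReal.rpow_two, one_pow] at h1
  refine (pow_le_pow_left' h1 2).trans (le_of_eq ?_)
  rw [mul_pow]
  simp only [← ENNReal.rpow_two, ← ENNReal.rpow_mul]
  norm_num

/-- The fundamental theorem of calculus followed by the Cauchy–Schwarz inequality on an interval of
length `a`. -/
theorem enorm_sub_sq_le_lintegral_deriv {V : Type*} [NormedAddCommGroup V] [NormedSpace ℝ V]
    [CompleteSpace V] {F : ℝ → V} (hF : ContDiff ℝ 1 F) {a s : ℝ} (hs : s ∈ Ioo 0 a) :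
    ‖F s - F 0‖ₑ ^ 2 ≤ ENNReal.ofReal a * ∫⁻ t in Ioo 0 a, ‖deriv F t‖ₑ ^ 2 := by
  have hc : Continuous (deriv F) := hF.continuous_deriv le_rfl
  have h1 : F s - F 0 = ∫ t in Ioc 0 s, deriv F t := by
    rw [← intervalIntegral.integral_of_le hs.1.le]
    exact (intervalIntegral.integral_deriv_eq_sub
      (fun x _ => (hF.differentiable one_ne_zero).differentiableAt)
      (hc.intervalIntegrable _ _)).symm
  have h2 : ‖F s - F 0‖ₑ ≤ ∫⁻ t in Ioo 0 a, ‖deriv F t‖ₑ := by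
    rw [h1]
    refine (enorm_integral_le_lintegral_enorm _).trans (lintegral_mono_set ?_)
    exact fun t ht => ⟨ht.1, ht.2.trans_lt hs.2⟩
  refine (pow_le_pow_left' h2 2).trans ((sq_lintegral_le hc.enorm.aemeasurable).trans ?_)
  simp

/-- The part of the region above the graph over the ball of radius `r` with height less than `a`. -/
def strip (Φ : Rigid d) (ψ : Rn (d - 1) → ℝ) (r a : ℝ) : Set (Rn d) :=
  {x | localBase Φ x ∈ Metric.ball 0 r ∧ height Φ ψ x ∈ Ioo 0 a}

theorem measurableSet_strip (Φ : Rigid d) {ψ : Rn (d - 1) → ℝ} {M : ℝ≥0} (hψ : LipschitzWith M ψ)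
    (r a : ℝ) : MeasurableSet (strip Φ ψ r a) :=
  ((lipschitzWith_localBase Φ).continuous.measurable measurableSet_ball).inter
    ((lipschitzWith_height Φ hψ).continuous.measurable measurableSet_Ioo)

theorem lintegral_strip (Φ : Rigid d) {ψ : Rn (d - 1) → ℝ} {M : ℝ≥0} (hψ : LipschitzWith M ψ)
    (r a : ℝ) {H : Rn d → ℝ≥0∞} (hH : Measurable H) :
    ∫⁻ x in strip Φ ψ r a, H x =
      ∫⁻ x' in Metric.ball 0 r, ∫⁻ s in Ioo 0 a, H (liftPoint Φ ψ x' s) := by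
  have hm := measurableSet_strip Φ hψ r a
  rw [← lintegral_indicator hm, lintegral_slice Φ ψ (hH.indicator hm),
    ← lintegral_indicator measurableSet_ball]
  refine lintegral_congr fun x' => ?_
  by_cases hx : x' ∈ Metric.ball (0 : Rn (d - 1)) r
  · rw [indicator_of_mem hx, ← lintegral_indicator measurableSet_Ioo]
    refine lintegral_congr fun s => ?_
    by_cases hs : s ∈ Ioo 0 a
    · rw [indicator_of_mem hs, indicator_of_mem]
      exact ⟨by simpa using hx, by simpa using hs⟩
    · rw [indicator_of_notMem hs, indicator_of_notMem]
      exact fun h => hs (by simpa using h.2)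
  · rw [indicator_of_notMem hx]
    refine (lintegral_congr fun s => indicator_of_notMem (fun h => hx ?_) _).trans lintegral_zero
    simpa using h.1

theorem dist_liftPoint (Φ : Rigid d) (ψ : Rn (d - 1) → ℝ) (x' : Rn (d - 1)) (s t : ℝ) :
    dist (liftPoint Φ ψ x' s) (liftPoint Φ ψ x' t) = dist s t := by
  rw [liftPoint, liftPoint, Φ.dist_map, dist_eq_norm]
  have h := WithLp.prod_norm_sq_eq_of_L2
    (WithLp.toLp 2 (x', ψ x' + s) - WithLp.toLp 2 (x', ψ x' + t) : Local d)
  have h2 : ‖(WithLp.toLp 2 (x', ψ x' + s) - WithLp.toLp 2 (x', ψ x' + t) : Local d)‖ ^ 2 =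
      dist s t ^ 2 := by
    rw [h]
    change ‖x' - x'‖ ^ 2 + ‖(ψ x' + s) - (ψ x' + t)‖ ^ 2 = _
    simp [dist_eq_norm]
  exact (sq_eq_sq₀ (norm_nonneg _) dist_nonneg).1 h2

theorem contDiff_liftPoint (Φ : Rigid d) (ψ : Rn (d - 1) → ℝ) (x' : Rn (d - 1)) :
    ContDiff ℝ (⊤ : ℕ∞) fun s => liftPoint Φ ψ x' s := by
  have e : (fun s => liftPoint Φ ψ x' s) = fun s => 
      s • (Φ.linearIsometryEquiv (WithLp.toLp 2 (0, 1))) + liftPoint Φ ψ x' 0 := by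
    funext s
    have h1 := Φ.map_vadd (WithLp.toLp 2 (x', ψ x')) (s • WithLp.toLp 2 (0, 1))
    rw [map_smul] at h1
    simp only [liftPoint, add_zero]
    rw [vadd_eq_add, vadd_eq_add] at h1
    rw [← h1]
    congr 1
    have : s • (WithLp.toLp 2 (0, 1) : Local d) = WithLp.toLp 2 (0, s) := by
      rw [← WithLp.toLp_smul]; simp
    rw [this, ← WithLp.toLp_add, Prod.mk_add_mk, zero_add, add_comm]
  rw [e]
  fun_prop

/-- Vertical lines are traversed at unit speed, so the chain rule costs no constant. -/
theorem norm_deriv_comp_liftPoint_le (Φ : Rigid d) (ψ : Rn (d - 1) → ℝ) {v : Rn d → Rn m}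
    (hv : Differentiable ℝ v) (x' : Rn (d - 1)) (s : ℝ) :
    ‖deriv (fun t => v (liftPoint Φ ψ x' t)) s‖ ≤ ‖gradient v (liftPoint Φ ψ x' s)‖ := by
  have h1 : HasDerivAt (fun t => liftPoint Φ ψ x' t) (deriv (fun t => liftPoint Φ ψ x' t) s) s :=
    ((contDiff_liftPoint Φ ψ x').differentiable (by simp)).differentiableAt.hasDerivAt
  have h2 := (hv (liftPoint Φ ψ x' s)).hasFDerivAt.comp_hasDerivAt s h1
  have h3 : ‖deriv (fun t => liftPoint Φ ψ x' t) s‖ ≤ 1 := by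
    have : LipschitzWith 1 fun t => liftPoint Φ ψ x' t :=
      LipschitzWith.of_dist_le_mul fun a b => by rw [dist_liftPoint]; simp
    simpa using norm_deriv_le_of_lipschitz this (x₀ := s)
  have h4 : deriv (fun t => v (liftPoint Φ ψ x' t)) s = _ := h2.deriv
  rw [h4]
  refine (norm_apply_le_norm_gradOf _ _).trans ?_
  exact mul_le_of_le_one_right (norm_nonneg _) h3

theorem enorm_add_sq_le {V : Type*} [NormedAddCommGroup V] (a b : V) :
    ‖a + b‖ₑ ^ 2 ≤ 2 * ‖a‖ₑ ^ 2 + 2 * ‖b‖ₑ ^ 2 := by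
  have h : ‖a + b‖ ^ 2 ≤ 2 * ‖a‖ ^ 2 + 2 * ‖b‖ ^ 2 := by
    nlinarith [norm_add_le a b, sq_nonneg (‖a‖ - ‖b‖), norm_nonneg (a + b), norm_nonneg a,
      norm_nonneg b]
  have h' : ‖a + b‖₊ ^ 2 ≤ 2 * ‖a‖₊ ^ 2 + 2 * ‖b‖₊ ^ 2 := by exact_mod_cast h
  simp only [enorm_eq_nnnorm]
  exact_mod_cast h'

/-- A smooth function minus a Lipschitz function on a strip, estimated by its values on the graph. -/
theorem lintegral_strip_le_of_contDiff (Φ : Rigid d) {ψ : Rn (d - 1) → ℝ} {M : ℝ≥0}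
    (hψ : LipschitzWith M ψ) (r a : ℝ) {v G : Rn d → Rn m}
    (hv : ContDiff ℝ (⊤ : ℕ∞) v) {L : ℝ≥0} (hG : LipschitzWith L G) :
    ∫⁻ x in strip Φ ψ r a, ‖v x - G x‖ₑ ^ 2 ≤
      4 * ENNReal.ofReal a * (∫⁻ x' in Metric.ball 0 r,
        ‖v (graphMap Φ ψ x') - G (graphMap Φ ψ x')‖ₑ ^ 2) +
      4 * ENNReal.ofReal a ^ 2 * (∫⁻ x in strip Φ ψ r a, ‖gradient v x‖ₑ ^ 2) +
      2 * (L * ENNReal.ofReal a) ^ 2 * volume (strip Φ ψ r a) := by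
  set A := ENNReal.ofReal a
  have hmain : ∀ x' : Rn (d - 1), ∀ s ∈ Ioo 0 a,
      ‖v (liftPoint Φ ψ x' s) - G (liftPoint Φ ψ x' s)‖ₑ ^ 2 ≤
      4 * ‖v (graphMap Φ ψ x') - G (graphMap Φ ψ x')‖ₑ ^ 2 +
      (4 * (A * ∫⁻ t in Ioo 0 a, ‖gradient v (liftPoint Φ ψ x' t)‖ₑ ^ 2) + 2 * (L * A) ^ 2) := by
    intro x' s hs
    have hF : ContDiff ℝ 1 fun t => v (liftPoint Φ ψ x' t) :=
      (hv.comp (contDiff_liftPoint Φ ψ x')).of_le (by exact_mod_cast le_top)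
    have h1 := enorm_sub_sq_le_lintegral_deriv hF hs
    simp only [liftPoint_zero] at h1
    have h2 : ∫⁻ t in Ioo 0 a, ‖deriv (fun t => v (liftPoint Φ ψ x' t)) t‖ₑ ^ 2 ≤
        ∫⁻ t in Ioo 0 a, ‖gradient v (liftPoint Φ ψ x' t)‖ₑ ^ 2 := by
      refine lintegral_mono fun t => pow_le_pow_left' ?_ 2
      exact enorm_le_iff_norm_le.2
        (norm_deriv_comp_liftPoint_le Φ ψ (hv.differentiable (by simp)) x' t)
    have h3 : ‖G (graphMap Φ ψ x') - G (liftPoint Φ ψ x' s)‖ₑ ≤ L * A := by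
      rw [← edist_eq_enorm_sub]
      refine (hG _ _).trans ?_
      gcongr
      rw [← liftPoint_zero, edist_dist, dist_liftPoint]
      refine ENNReal.ofReal_le_ofReal ?_
      simp [abs_of_pos hs.1, hs.2.le]
    -- The difference is split into its value on the graph, the vertical variation of `v`, and that
    -- of `G`; squaring twice gives the factors `4`, `4` and `2`.
    have e : v (liftPoint Φ ψ x' s) - G (liftPoint Φ ψ x' s) =
        ((v (graphMap Φ ψ x') - G (graphMap Φ ψ x')) +
          (v (liftPoint Φ ψ x' s) - v (graphMap Φ ψ x'))) +
        (G (graphMap Φ ψ x') - G (liftPoint Φ ψ x' s)) := by abel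
    rw [e]
    refine (enorm_add_sq_le _ _).trans ?_
    rw [← add_assoc]
    refine add_le_add ?_ (by gcongr)
    refine (mul_le_mul_right (enorm_add_sq_le _ _) 2).trans ?_
    rw [mul_add, ← mul_assoc, ← mul_assoc]
    norm_num only
    gcongr
    exact h1.trans (mul_le_mul_right h2 A)
  have hcg : Continuous (gradient v) :=
    continuous_gradOf.comp (hv.continuous_fderiv (by simp))
  have hvG : Continuous fun x => v x - G x := hv.continuous.sub hG.continuous
  have hm1 : Measurable fun x' : Rn (d - 1) =>
      ‖v (graphMap Φ ψ x') - G (graphMap Φ ψ x')‖ₑ ^ 2 :=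
    ((hvG.comp (lipschitzWith_graphMap Φ hψ).continuous).enorm.measurable.pow_const 2)
  have hm2 : Measurable fun x => ‖gradient v x‖ₑ ^ 2 := hcg.enorm.measurable.pow_const 2
  have hvol : volume (strip Φ ψ r a) = volume (Metric.ball (0 : Rn (d - 1)) r) * A := by
    have := lintegral_strip Φ hψ r a (measurable_const (a := (1 : ℝ≥0∞)))
    simpa [mul_comm, A] using this
  rw [lintegral_strip Φ hψ r a (hvG.enorm.measurable.pow_const 2)]
  calc ∫⁻ x' in Metric.ball 0 r, ∫⁻ s in Ioo 0 a,
        ‖v (liftPoint Φ ψ x' s) - G (liftPoint Φ ψ x' s)‖ₑ ^ 2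
      ≤ ∫⁻ x' in Metric.ball 0 r,
        (4 * A * ‖v (graphMap Φ ψ x') - G (graphMap Φ ψ x')‖ₑ ^ 2 +
        (4 * A ^ 2 * (∫⁻ t in Ioo 0 a, ‖gradient v (liftPoint Φ ψ x' t)‖ₑ ^ 2) +
          2 * (L * A) ^ 2 * A)) := by
        refine lintegral_mono fun x' => ?_
        refine (setLIntegral_mono' measurableSet_Ioo (hmain x')).trans ?_
        rw [setLIntegral_const, Real.volume_Ioo, sub_zero]
        refine le_of_eq ?_
        change _ * A = _
        ring
    _ = _ := by
        rw [lintegral_add_left (hm1.const_mul _), lintegral_const_mul _ hm1,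
          lintegral_add_right _ measurable_const, lintegral_const_mul' _ _ (by finiteness),
          ← lintegral_strip Φ hψ r a hm2, lintegral_const, hvol,
          Measure.restrict_apply_univ]
        ring

end Strips

/-! ### Test functions vanishing on the boundary portion -/

section BoundaryTest

variable {d m : ℕ}

theorem tendsto_eLpNorm_two_iff {α V ι : Type*} [MeasurableSpace α] [NormedAddCommGroup V]
    {ν : Measure α} {l : Filter ι} {h : ι → α → V} :
    Tendsto (fun k => eLpNorm (h k) 2 ν) l (𝓝 0) ↔
      Tendsto (fun k => ∫⁻ x, ‖h k x‖ₑ ^ 2 ∂ν) l (𝓝 0) := by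
  simp_rw [← eLpNorm_two_sq]
  constructor
  · intro hk
    simpa [Function.comp_def] using (ENNReal.continuous_pow 2).tendsto 0 |>.comp hk
  · intro hk
    have h1 := (ENNReal.continuous_rpow_const (y := (1 / 2 : ℝ))).tendsto 0 |>.comp hk
    simp only [Function.comp_def, ← ENNReal.rpow_two, ← ENNReal.rpow_mul] at h1
    norm_num at h1
    exact h1

theorem tendsto_lintegral_sq_zero_of_le {α V ι : Type*} [MeasurableSpace α] [NormedAddCommGroup V]
    {ν : Measure α} {l : Filter ι} {h : ι → α → V} {b : ι → α → ℝ≥0∞}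
    (hle : ∀ k, ∀ᵐ x ∂ν, ‖h k x‖ₑ ^ 2 ≤ b k x)
    (hb : Tendsto (fun k => ∫⁻ x, b k x ∂ν) l (𝓝 0)) :
    Tendsto (fun k => ∫⁻ x, ‖h k x‖ₑ ^ 2 ∂ν) l (𝓝 0) :=
  tendsto_of_tendsto_of_tendsto_of_le_of_le tendsto_const_nhds hb (fun _ => zero_le)
    fun k => lintegral_mono_ae (hle k)

theorem lipschitzOnWith_closedBall_of_contDiff {v : Rn d → Rn m} (hv : ContDiff ℝ (⊤ : ℕ∞) v)
    (ρ : ℝ) : ∃ K : ℝ≥0, LipschitzOnWith K v (Metric.closedBall 0 ρ) := by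
  obtain ⟨B, hB⟩ := (isCompact_closedBall (0 : Rn d) ρ).exists_bound_of_continuousOn
    (hv.continuous_fderiv (by simp)).continuousOn
  refine ⟨B.toNNReal, (convex_closedBall _ _).lipschitzOnWith_of_nnnorm_fderiv_le
    (fun x _ => (hv.differentiable (by simp)).differentiableAt) fun x hx => ?_⟩
  rw [← NNReal.coe_le_coe, coe_nnnorm]
  exact (hB x hx).trans (Real.le_coe_toNNReal B)

theorem gradient_smul_sub {c : Rn d → ℝ} {v G : Rn d → Rn m} {x : Rn d}
    (hc : DifferentiableAt ℝ c x) (hv : DifferentiableAt ℝ v x) (hG : DifferentiableAt ℝ G x) :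
    gradient (fun y => c y • (v y - G y)) x =
      c x • (gradient v x - gradient G x) + tensor (fderiv ℝ c x) (v x - G x) := by
  have h := (hc.hasFDerivAt.smul (hv.hasFDerivAt.sub hG.hasFDerivAt)).fderiv
  rw [gradient, gradient, gradient, tensor, ← gradOf_sub, ← gradOf_smul, ← gradOf_add]
  exact congrArg gradOf h

theorem memLp_of_continuous_of_isBounded {V : Type*} [NormedAddCommGroup V] {U : Set (Rn d)}
    (hU : Bornology.IsBounded U) {h : Rn d → V} (hh : Continuous h) [SecondCountableTopology V]
    (p : ℝ≥0∞) : MemLp h p (volume.restrict U) := by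
  have : IsFiniteMeasure (volume.restrict U) := isFiniteMeasure_restrict.2 hU.measure_lt_top.ne
  obtain ⟨B, hB⟩ := hU.isCompact_closure.exists_bound_of_continuousOn hh.continuousOn
  refine MemLp.of_bound hh.aestronglyMeasurable B ?_
  have h1 : ∀ᵐ x ∂(volume.restrict (closure U)), ‖h x‖ ≤ B :=
    (ae_restrict_mem isClosed_closure.measurableSet).mono hB
  exact ae_mono (Measure.restrict_mono subset_closure le_rfl) h1

variable {U : Set (Rn d)} {σ : Rn d → Grad d m} {f : Rn d → Rn m} {u : Rn d → Rn m}
  {Du : Rn d → Grad d m} {v : ℕ → Rn d → Rn m} {G : Rn d → Rn m} {L Kc : ℝ≥0} {c : Rn d → ℝ}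

/-- The gradient of `c • (u - G)` when `Du` is the gradient of `u`. -/
def cutGrad (c : Rn d → ℝ) (u : Rn d → Rn m) (Du : Rn d → Grad d m) (G : Rn d → Rn m)
    (x : Rn d) : Grad d m :=
  c x • (Du x - gradient G x) + tensor (fderiv ℝ c x) (u x - G x)

theorem memLp_cut (hU : Bornology.IsBounded U) (hu : MemLp u 2 (volume.restrict U))
    (hG : LipschitzWith L G) (hc : LipschitzWith Kc c) (hc1 : ∀ x, |c x| ≤ 1) :
    MemLp (fun x => c x • (u x - G x)) 2 (volume.restrict U) := by
  have h := hu.sub (memLp_of_continuous_of_isBounded hU hG.continuous 2)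
  refine h.of_le (hc.continuous.aestronglyMeasurable.smul h.1) (Eventually.of_forall fun x => ?_)
  rw [norm_smul, Real.norm_eq_abs]
  exact mul_le_of_le_one_left (norm_nonneg _) (hc1 x)

theorem memLp_cutGrad (hU : Bornology.IsBounded U) (hu : MemLp u 2 (volume.restrict U))
    (hDu : MemLp Du 2 (volume.restrict U))
    (hG : LipschitzWith L G) (hc : LipschitzWith Kc c) (hc1 : ∀ x, |c x| ≤ 1) :
    MemLp (cutGrad c u Du G) 2 (volume.restrict U) := by
  have : IsFiniteMeasure (volume.restrict U) := isFiniteMeasure_restrict.2 hU.measure_lt_top.ne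
  have h1 := hu.sub (memLp_of_continuous_of_isBounded hU hG.continuous 2)
  have h2 : MemLp (gradient G) 2 (volume.restrict U) :=
    MemLp.of_bound (measurable_gradient G).aestronglyMeasurable _
      (Eventually.of_forall (norm_gradient_le hG))
  have h3 := hDu.sub h2
  refine MemLp.add (h3.of_le (hc.continuous.aestronglyMeasurable.smul h3.1)
    (Eventually.of_forall fun x => ?_)) (h1.of_le_mul (c := √(m * d) * Kc)
    (continuous_tensor.comp_aestronglyMeasurable
      ((measurable_fderiv ℝ c).aestronglyMeasurable.prodMk h1.1)) (Eventually.of_forall fun x => ?_))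
  · rw [norm_smul, Real.norm_eq_abs]
    exact mul_le_of_le_one_left (norm_nonneg _) (hc1 x)
  · refine (norm_tensor_le _ _).trans ?_
    rw [mul_assoc]
    gcongr
    · exact norm_fderiv_le_of_lipschitz ℝ hc
    · rfl

/-- Replacing `u` by the smooth approximations `v n` gives Lipschitz test functions with compact
support, which converge in `L²` together with their gradients. -/
theorem isTestPair_cut_of_tsupport_subset (hU : IsOpen U) (hb : Bornology.IsBounded U)
    (hσ : MemLp σ 2 (volume.restrict U)) (hf : MemLp f 2 (volume.restrict U))
    (hweak : ∀ φ : Rn d → Rn m, ContDiff ℝ (⊤ : ℕ∞) φ → HasCompactSupport φ → tsupport φ ⊆ U →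
      ∫ x in U, inner ℝ (σ x) (gradient φ x) = ∫ x in U, inner ℝ (f x) (φ x))
    (hu : MemLp u 2 (volume.restrict U)) (hDu : MemLp Du 2 (volume.restrict U))
    (hv : ∀ n, ContDiff ℝ (⊤ : ℕ∞) (v n))
    (hvu : Tendsto (fun n => eLpNorm (fun x => v n x - u x) 2 (volume.restrict U)) atTop (𝓝 0))
    (hvDu : Tendsto (fun n => eLpNorm (fun x => gradient (v n) x - Du x) 2 (volume.restrict U))
      atTop (𝓝 0))
    (hG : LipschitzWith L G) (hc : LipschitzWith Kc c) (hc1 : ∀ x, |c x| ≤ 1)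
    (hcs : HasCompactSupport c) (hcU : tsupport c ⊆ U) :
    IsTestPair U σ f (fun x => c x • (u x - G x)) (cutGrad c u Du G) := by
  have hpair : ∀ n, IsTestPair U σ f (fun x => c x • (v n x - G x))
      (gradient fun x => c x • (v n x - G x)) := by
    intro n
    obtain ⟨ρ, hρ⟩ := hcs.isCompact.isBounded.subset_closedBall 0
    obtain ⟨K, hK⟩ := lipschitzOnWith_closedBall_of_contDiff (hv n) ρ
    obtain ⟨B, hB⟩ := (isCompact_closedBall (0 : Rn d) ρ).exists_bound_of_continuousOn
      ((hv n).continuous.sub hG.continuous).continuousOn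
    -- The function `v n` need not be globally bounded or Lipschitz; only a ball containing the
    -- support of `c` matters.
    have hlip := lipschitzWith_smul_of_eq_zero (S := Metric.closedBall 0 ρ) (B := B.toNNReal) hc hc1
      (fun x hx => image_eq_zero_of_notMem_tsupport fun hx' => hx (hρ hx'))
      (hK.sub hG.lipschitzOnWith) fun x hx => (hB x hx).trans (Real.le_coe_toNNReal B)
    exact isTestPair_of_lipschitz hU hb.measure_lt_top.ne hσ hf hweak hlip hcs.smul_right
      ((closure_mono (Function.support_smul_subset_left _ _)).trans hcU)
  refine IsTestPair.of_tendsto (l := atTop) hσ hf hpair (memLp_cut hb hu hG hc hc1)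
    (memLp_cutGrad hb hu hDu hG hc hc1) ?_ ?_
  · rw [tendsto_eLpNorm_two_iff] at hvu ⊢
    refine tendsto_lintegral_sq_zero_of_le (fun n => Eventually.of_forall fun x => ?_) hvu
    refine pow_le_pow_left' (enorm_le_iff_norm_le.2 ?_) 2
    simp only [Pi.sub_apply]
    rw [← smul_sub, sub_sub_sub_cancel_right, norm_smul, Real.norm_eq_abs]
    exact mul_le_of_le_one_left (norm_nonneg _) (hc1 x)
  · rw [tendsto_eLpNorm_two_iff] at hvu hvDu ⊢
    set C : ℝ≥0∞ := ENNReal.ofReal (√(m * d) * Kc)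
    refine tendsto_lintegral_sq_zero_of_le (b := fun n x =>
      2 * ‖gradient (v n) x - Du x‖ₑ ^ 2 + 2 * C ^ 2 * ‖v n x - u x‖ₑ ^ 2)
      (fun n => ae_restrict_of_ae ?_) ?_
    · filter_upwards [hc.ae_differentiableAt (μ := volume), hG.ae_differentiableAt (μ := volume)]
        with x hcx hGx
      simp only [Pi.sub_apply]
      rw [gradient_smul_sub hcx ((hv n).differentiable (by simp)).differentiableAt hGx, cutGrad]
      have e : c x • (gradient (v n) x - gradient G x) + tensor (fderiv ℝ c x) (v n x - G x) -
          (c x • (Du x - gradient G x) + tensor (fderiv ℝ c x) (u x - G x)) =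
          c x • (gradient (v n) x - Du x) + tensor (fderiv ℝ c x) (v n x - u x) := by
        rw [add_sub_add_comm, ← smul_sub, ← tensor_sub, sub_sub_sub_cancel_right,
          sub_sub_sub_cancel_right]
      rw [e]
      refine (enorm_add_sq_le _ _).trans (add_le_add ?_ ?_)
      · gcongr
        refine enorm_le_iff_norm_le.2 ?_
        rw [norm_smul, Real.norm_eq_abs]
        exact mul_le_of_le_one_left (norm_nonneg _) (hc1 x)
      · rw [mul_assoc, ← mul_pow]
        gcongr
        rw [← ofReal_norm, ← ofReal_norm, ← ENNReal.ofReal_mul (by positivity), mul_assoc]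
        refine ENNReal.ofReal_le_ofReal ((norm_tensor_le _ _).trans ?_)
        gcongr
        exact norm_fderiv_le_of_lipschitz ℝ hc
    · have hm : ∀ n, AEMeasurable (fun x => ‖v n x - u x‖ₑ ^ 2) (volume.restrict U) := fun n =>
        (((hv n).continuous.aestronglyMeasurable.sub hu.1).enorm).pow_const 2
      have e : ∀ n, ∫⁻ x in U, (2 * ‖gradient (v n) x - Du x‖ₑ ^ 2 +
          2 * C ^ 2 * ‖v n x - u x‖ₑ ^ 2) = 2 * (∫⁻ x in U, ‖gradient (v n) x - Du x‖ₑ ^ 2) +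
          2 * C ^ 2 * ∫⁻ x in U, ‖v n x - u x‖ₑ ^ 2 := by
        intro n
        rw [lintegral_add_right' _ ((hm n).const_mul _), lintegral_const_mul' _ _ (by finiteness),
          lintegral_const_mul' _ _ (by finiteness)]
      simp_rw [e]
      have h1 := ENNReal.Tendsto.const_mul hvDu (a := 2) (Or.inr (by finiteness))
      have h2 := ENNReal.Tendsto.const_mul hvu (a := 2 * C ^ 2) (Or.inr (by finiteness))
      simpa using h1.add h2

variable {M : ℝ≥0} {M₀ : ℝ} {Φ : Rigid d} {ψ : Rn (d - 1) → ℝ} {r : ℝ}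

/-- The Poincaré inequality on a thin strip for the zero-trace function `u - G`, by passage to the
limit in the smooth case. The factor `a²` compensates the squared gradient of a height cutoff. -/
theorem lintegral_strip_le (hψ : LipschitzWith M ψ) {a : ℝ} (hsub : strip Φ ψ r a ⊆ U)
    (hDu : MemLp Du 2 (volume.restrict U)) (hv : ∀ n, ContDiff ℝ (⊤ : ℕ∞) (v n))
    (hvu : Tendsto (fun n => eLpNorm (fun x => v n x - u x) 2 (volume.restrict U)) atTop (𝓝 0))
    (hvDu : Tendsto (fun n => eLpNorm (fun x => gradient (v n) x - Du x) 2 (volume.restrict U))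
      atTop (𝓝 0))
    (hbd : Tendsto (fun n => ∫⁻ x' in Metric.ball 0 r,
      ‖v n (graphMap Φ ψ x') - G (graphMap Φ ψ x')‖ₑ ^ 2) atTop (𝓝 0))
    (hG : LipschitzWith L G) :
    ∫⁻ x in strip Φ ψ r a, ‖u x - G x‖ₑ ^ 2 ≤ ENNReal.ofReal a ^ 2 *
      ∫⁻ x in strip Φ ψ r a, (16 * ‖Du x‖ₑ ^ 2 + 4 * (L : ℝ≥0∞) ^ 2) := by
  set A := ENNReal.ofReal a
  set S := strip Φ ψ r a with hS
  have hmono : volume.restrict S ≤ volume.restrict U := Measure.restrict_mono hsub le_rfl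
  rw [tendsto_eLpNorm_two_iff] at hvu hvDu
  have hle : ∀ n, ∫⁻ x in S, ‖u x - G x‖ₑ ^ 2 ≤
      2 * (∫⁻ x in U, ‖v n x - u x‖ₑ ^ 2) + 2 * (4 * A * (∫⁻ x' in Metric.ball 0 r,
        ‖v n (graphMap Φ ψ x') - G (graphMap Φ ψ x')‖ₑ ^ 2) +
      4 * A ^ 2 * (2 * (∫⁻ x in U, ‖gradient (v n) x - Du x‖ₑ ^ 2) +
        2 * ∫⁻ x in S, ‖Du x‖ₑ ^ 2) + 2 * (L * A) ^ 2 * volume S) := by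
    intro n
    have hcont : Continuous fun x => v n x - G x := (hv n).continuous.sub hG.continuous
    have h1 : ∫⁻ x in S, ‖u x - G x‖ₑ ^ 2 ≤
        2 * (∫⁻ x in S, ‖v n x - u x‖ₑ ^ 2) + 2 * ∫⁻ x in S, ‖v n x - G x‖ₑ ^ 2 := by
      rw [← lintegral_const_mul' _ _ (by finiteness), ← lintegral_const_mul' _ _ (by finiteness),
        ← lintegral_add_right _ ((hcont.enorm.measurable.pow_const 2).const_mul 2)]
      refine lintegral_mono fun x => ?_
      have := enorm_add_sq_le (u x - v n x) (v n x - G x)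
      rwa [sub_add_sub_cancel, enorm_sub_rev (u x) (v n x)] at this
    have h2 : ∫⁻ x in S, ‖gradient (v n) x‖ₑ ^ 2 ≤
        2 * (∫⁻ x in S, ‖gradient (v n) x - Du x‖ₑ ^ 2) + 2 * ∫⁻ x in S, ‖Du x‖ₑ ^ 2 := by
      rw [← lintegral_const_mul' _ _ (by finiteness), ← lintegral_const_mul' _ _ (by finiteness),
        ← lintegral_add_right' _ (((hDu.1.mono_measure hmono).enorm.pow_const 2).const_mul 2)]
      refine lintegral_mono fun x => ?_
      have := enorm_add_sq_le (gradient (v n) x - Du x) (Du x)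
      rwa [sub_add_cancel] at this
    have h3 := lintegral_strip_le_of_contDiff Φ hψ r a (hv n) hG
    refine h1.trans ?_
    gcongr
    refine h3.trans ?_
    gcongr
    exact h2.trans (by gcongr)
  have hlim := ((ENNReal.Tendsto.const_mul hvu (a := 2) (Or.inr (by finiteness))).add
    (ENNReal.Tendsto.const_mul (((ENNReal.Tendsto.const_mul hbd (a := 4 * A)
      (Or.inr (by finiteness))).add (ENNReal.Tendsto.const_mul
        ((ENNReal.Tendsto.const_mul hvDu (a := 2) (Or.inr (by finiteness))).add_const
          (2 * ∫⁻ x in S, ‖Du x‖ₑ ^ 2)) (a := 4 * A ^ 2) (Or.inr (by finiteness)))).add_const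
      (2 * (L * A) ^ 2 * volume S)) (a := 2) (Or.inr (by finiteness))))
  refine (ge_of_tendsto' hlim hle).trans (le_of_eq ?_)
  rw [lintegral_add_right _ measurable_const, lintegral_const_mul' _ _ (by finiteness),
    lintegral_const, Measure.restrict_apply_univ]
  ring

/-- The cutoff of the height that vanishes below `t` and is one above `2 t`. -/
def heightCutoff (Φ : Rigid d) (ψ : Rn (d - 1) → ℝ) (t : ℝ) (x : Rn d) : ℝ :=
  max 0 (min 1 ((height Φ ψ x - t) / t))

theorem heightCutoff_nonneg (Φ : Rigid d) (ψ : Rn (d - 1) → ℝ) (t : ℝ) (x : Rn d) :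
    0 ≤ heightCutoff Φ ψ t x := le_max_left _ _

theorem heightCutoff_le_one (Φ : Rigid d) (ψ : Rn (d - 1) → ℝ) (t : ℝ) (x : Rn d) :
    heightCutoff Φ ψ t x ≤ 1 := max_le zero_le_one (min_le_left _ _)

theorem heightCutoff_eq_zero {t : ℝ} (ht : 0 < t) {x : Rn d} (hx : height Φ ψ x ≤ t) :
    heightCutoff Φ ψ t x = 0 := by
  refine max_eq_left ((min_le_right _ _).trans ?_)
  exact div_nonpos_of_nonpos_of_nonneg (by linarith) ht.le

theorem heightCutoff_eq_one {t : ℝ} (ht : 0 < t) {x : Rn d} (hx : 2 * t ≤ height Φ ψ x) :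
    heightCutoff Φ ψ t x = 1 := by
  have : 1 ≤ (height Φ ψ x - t) / t := by rw [le_div_iff₀ ht]; linarith
  simp [heightCutoff, this]

theorem lipschitzWith_heightCutoff (hψ : LipschitzWith M ψ) {t : ℝ} (ht : 0 < t) :
    LipschitzWith ((1 + M) * (t⁻¹).toNNReal) (heightCutoff Φ ψ t) := by
  refine LipschitzWith.const_max (LipschitzWith.const_min ?_ 1) 0
  refine LipschitzWith.of_dist_le_mul fun x y => ?_
  have := (lipschitzWith_height Φ hψ).dist_le_mul x y
  rw [Real.dist_eq] at this ⊢
  have e : (height Φ ψ x - t) / t - (height Φ ψ y - t) / t =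
    t⁻¹ * (height Φ ψ x - height Φ ψ y) := by field_simp; ring
  rw [e, abs_mul, abs_of_pos (by positivity)]
  push_cast at this ⊢
  rw [Real.coe_toNNReal _ (by positivity)]
  have h2 : 0 < t⁻¹ := by positivity
  nlinarith

/-- One is the maximum of the cutoff, so this includes height exactly `2 t`; where the cutoff is not
differentiable, `fderiv` is zero by convention. -/
theorem fderiv_heightCutoff_eq_zero {t : ℝ} (ht : 0 < t) {x : Rn d}
    (hx : 2 * t ≤ height Φ ψ x) : fderiv ℝ (heightCutoff Φ ψ t) x = 0 := by
  refine IsLocalMax.fderiv_eq_zero (Eventually.of_forall fun y => ?_)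
  rw [heightCutoff_eq_one ht hx]
  exact heightCutoff_le_one Φ ψ t y

/-- Heights are positive in the cylinder, so the strips shrink to the empty set and dominated
convergence applies. -/
theorem tendsto_lintegral_strip (hM₀ : 0 < M₀) (hψ : LipschitzWith M ψ)
    {H : Rn d → ℝ≥0∞} (hH : AEMeasurable H (volume.restrict (boundaryCylinder M₀ Φ ψ r)))
    (hfin : ∫⁻ x in boundaryCylinder M₀ Φ ψ r, H x ≠ ∞) {a : ℕ → ℝ}
    (ha : Tendsto a atTop (𝓝 0)) :
    Tendsto (fun k => ∫⁻ x in boundaryCylinder M₀ Φ ψ r, (strip Φ ψ r (a k)).indicator H x)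
      atTop (𝓝 0) := by
  have h := tendsto_lintegral_of_dominated_convergence'
    (μ := volume.restrict (boundaryCylinder M₀ Φ ψ r))
    (F := fun k x => (strip Φ ψ r (a k)).indicator H x) (f := fun _ => 0) H
    (fun k => hH.indicator (measurableSet_strip Φ hψ r (a k)))
    (fun k => Eventually.of_forall fun x => indicator_le_self _ _ _) hfin
    (by
      filter_upwards [ae_restrict_mem (isOpen_boundaryCylinder hM₀ Φ hψ r).measurableSet] with x hx
      have hpos := ((mem_boundaryCylinder_iff hM₀ Φ ψ).1 hx).2
      refine tendsto_const_nhds.congr' ?_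
      filter_upwards [ha.eventually (gt_mem_nhds hpos)] with k hk
      rw [indicator_of_notMem]
      exact fun hxs => lt_asymm hk hxs.2.2)
  simpa using h

theorem strip_subset_boundaryCylinder (hM₀ : 0 < M₀) {a : ℝ} (ha : a ≤ M₀ * r) :
    strip Φ ψ r a ⊆ boundaryCylinder M₀ Φ ψ r := by
  intro x hx
  rw [mem_boundaryCylinder_iff hM₀, cylinderGauge, max_lt_iff, div_lt_iff₀' hM₀]
  exact ⟨⟨by simpa using hx.1, hx.2.2.trans_le ha⟩, hx.2.1⟩

theorem mem_strip_of_mem_boundaryCylinder (hM₀ : 0 < M₀) {a : ℝ} {x : Rn d}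
    (hx : x ∈ boundaryCylinder M₀ Φ ψ r) (ha : height Φ ψ x < a) : x ∈ strip Φ ψ r a := by
  rw [mem_boundaryCylinder_iff hM₀, cylinderGauge, max_lt_iff] at hx
  exact ⟨by simpa using hx.1.1, hx.2, ha⟩

theorem enorm_heightCutoff_sub_one_smul_le (hM₀ : 0 < M₀) {V : Type*} [NormedAddCommGroup V]
    [NormedSpace ℝ V] {t : ℝ} (ht : 0 < t) (h : Rn d → V) {x : Rn d}
    (hx : x ∈ boundaryCylinder M₀ Φ ψ r) :
    ‖(heightCutoff Φ ψ t x - 1) • h x‖ₑ ^ 2 ≤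
      (strip Φ ψ r (2 * t)).indicator (fun x => ‖h x‖ₑ ^ 2) x := by
  rcases le_or_gt (2 * t) (height Φ ψ x) with h1 | h1
  · rw [heightCutoff_eq_one ht h1]
    simp
  · rw [indicator_of_mem (mem_strip_of_mem_boundaryCylinder hM₀ hx h1)]
    refine pow_le_pow_left' (enorm_le_iff_norm_le.2 ?_) 2
    rw [norm_smul, Real.norm_eq_abs]
    refine mul_le_of_le_one_left (norm_nonneg _) ?_
    rw [abs_le]
    constructor <;> linarith [heightCutoff_nonneg Φ ψ t x, heightCutoff_le_one Φ ψ t x]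

/-- The weak formulation may be tested with `c • (u - G)` if `u = G` on the boundary portion and `c`
vanishes near the rest of the boundary of the cylinder. -/
theorem isTestPair_cut_of_cylinderGauge (hM₀ : 0 < M₀) (hψ : LipschitzWith M ψ) (hr : 0 < r)
    (hb : Bornology.IsBounded (boundaryCylinder M₀ Φ ψ r))
    (hσ : MemLp σ 2 (volume.restrict (boundaryCylinder M₀ Φ ψ r)))
    (hf : MemLp f 2 (volume.restrict (boundaryCylinder M₀ Φ ψ r)))
    (hweak : ∀ φ : Rn d → Rn m, ContDiff ℝ (⊤ : ℕ∞) φ → HasCompactSupport φ →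
      tsupport φ ⊆ boundaryCylinder M₀ Φ ψ r →
      ∫ x in boundaryCylinder M₀ Φ ψ r, inner ℝ (σ x) (gradient φ x) =
        ∫ x in boundaryCylinder M₀ Φ ψ r, inner ℝ (f x) (φ x))
    (hu : MemLp u 2 (volume.restrict (boundaryCylinder M₀ Φ ψ r)))
    (hDu : MemLp Du 2 (volume.restrict (boundaryCylinder M₀ Φ ψ r)))
    (hv : ∀ n, ContDiff ℝ (⊤ : ℕ∞) (v n))
    (hvu : Tendsto (fun n => eLpNorm (fun x => v n x - u x) 2
      (volume.restrict (boundaryCylinder M₀ Φ ψ r))) atTop (𝓝 0))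
    (hvDu : Tendsto (fun n => eLpNorm (fun x => gradient (v n) x - Du x) 2
      (volume.restrict (boundaryCylinder M₀ Φ ψ r))) atTop (𝓝 0))
    (hbd : Tendsto (fun n => ∫⁻ x' in Metric.ball 0 r,
      ‖v n (graphMap Φ ψ x') - G (graphMap Φ ψ x')‖ₑ ^ 2) atTop (𝓝 0))
    (hG : LipschitzWith L G) (hc : LipschitzWith Kc c) (hc1 : ∀ x, |c x| ≤ 1) {r' : ℝ}
    (hr' : r' < r) (hc0 : ∀ x, r' ≤ cylinderGauge M₀ Φ ψ x → c x = 0) :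
    IsTestPair (boundaryCylinder M₀ Φ ψ r) σ f (fun x => c x • (u x - G x))
      (cutGrad c u Du G) := by
  set U := boundaryCylinder M₀ Φ ψ r with hUdef
  have hUopen : IsOpen U := isOpen_boundaryCylinder hM₀ Φ hψ r
  -- Chosen so that the strip of height `2 t k` fits inside the cylinder.
  set t : ℕ → ℝ := fun k => M₀ * r / 2 * (1 / (k + 1)) with ht
  have htpos : ∀ k, 0 < t k := fun k => by positivity
  have htle : ∀ k, 2 * t k ≤ M₀ * r := by
    intro k
    have h1 : (1 / (k + 1) : ℝ) ≤ 1 := by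
      rw [div_le_one (by positivity)]; linarith [k.cast_nonneg (α := ℝ)]
    have h2 : 0 < M₀ * r := mul_pos hM₀ hr
    have h3 : t k = M₀ * r / 2 * (1 / (k + 1)) := rfl
    nlinarith
  have htlim : Tendsto (fun k => 2 * t k) atTop (𝓝 0) := by
    have := ((tendsto_one_div_add_atTop_nhds_zero_nat (𝕜 := ℝ)).const_mul (M₀ * r / 2)).const_mul 2
    simpa [ht] using this
  set θ : ℕ → Rn d → ℝ := fun k => heightCutoff Φ ψ (t k) with hθ
  have hθlip : ∀ k, LipschitzWith ((1 + M) * ((t k)⁻¹).toNNReal) (θ k) := fun k =>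
    lipschitzWith_heightCutoff hψ (htpos k)
  have hθ1 : ∀ k x, |θ k x| ≤ 1 := fun k x => by
    rw [abs_of_nonneg (heightCutoff_nonneg _ _ _ _)]
    exact heightCutoff_le_one _ _ _ _
  set e : ℕ → Rn d → ℝ := fun k x => θ k x • c x with he
  have helip : ∀ k, LipschitzWith ((1 + M) * ((t k)⁻¹).toNNReal * 1 + Kc) (e k) := fun k =>
    lipschitzWith_smul_of_eq_zero (S := univ) (hθlip k) (hθ1 k) (fun x hx => (hx trivial).elim)
      hc.lipschitzOnWith fun x _ => hc1 x
  have he1 : ∀ k x, |e k x| ≤ 1 := fun k x => by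
    change |θ k x * c x| ≤ 1
    rw [abs_mul]
    exact mul_le_one₀ (hθ1 k x) (abs_nonneg _) (hc1 x)
  have hpair : ∀ k, IsTestPair U σ f (fun x => e k x • (u x - G x)) (cutGrad (e k) u Du G) := by
    intro k
    -- The support of `θ k • c` stays away from the graph because of `θ k`, and from the rest of the
    -- boundary because of `c`.
    set Z : Set (Rn d) := {x | t k ≤ height Φ ψ x} ∩ {x | cylinderGauge M₀ Φ ψ x ≤ r'}
    have hZ : IsClosed Z :=
      (isClosed_le continuous_const (lipschitzWith_height Φ hψ).continuous).inter
        (isClosed_le (lipschitzWith_cylinderGauge M₀ Φ hψ).continuous continuous_const)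
    have hZU : Z ⊆ U := fun x hx =>
      (mem_boundaryCylinder_iff hM₀ Φ ψ).2 ⟨hx.2.trans_lt hr', (htpos k).trans_le hx.1⟩
    have hsupp : Function.support (e k) ⊆ Z := by
      intro x hx
      constructor
      · by_contra hcon
        refine hx ?_
        simp only [he, hθ]
        rw [heightCutoff_eq_zero (htpos k) (not_le.1 hcon).le, zero_smul]
      · by_contra hcon
        refine hx ?_
        simp only [he]
        rw [hc0 x (not_le.1 hcon).le, smul_zero]
    have hts : tsupport (e k) ⊆ Z := closure_minimal hsupp hZ
    have hcomp : HasCompactSupport (e k) :=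
      (Metric.isCompact_of_isClosed_isBounded hZ (hb.subset hZU)).of_isClosed_subset
        (isClosed_tsupport _) hts
    exact isTestPair_cut_of_tsupport_subset hUopen hb hσ hf hweak hu hDu hv hvu hvDu hG (helip k)
      (he1 k) hcomp (hts.trans hZU)
  have hmw := memLp_cut hb hu hG hc hc1
  have hmW := memLp_cutGrad hb hu hDu hG hc hc1
  have hsq : ∀ {V : Type} [NormedAddCommGroup V] {h : Rn d → V}, MemLp h 2 (volume.restrict U) →
      Tendsto (fun k => ∫⁻ x in U, (strip Φ ψ r (2 * t k)).indicator (fun x => ‖h x‖ₑ ^ 2) x)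
        atTop (𝓝 0) := by
    intro V _ h hh
    refine tendsto_lintegral_strip hM₀ hψ (hh.1.enorm.pow_const 2) ?_ htlim
    rw [← eLpNorm_two_sq]
    exact ENNReal.pow_ne_top hh.2.ne
  refine IsTestPair.of_tendsto (l := atTop) hσ hf hpair hmw hmW ?_ ?_
  · rw [tendsto_eLpNorm_two_iff]
    refine tendsto_lintegral_sq_zero_of_le (fun k => ?_) (hsq hmw)
    filter_upwards [ae_restrict_mem hUopen.measurableSet] with x hx
    refine le_trans (le_of_eq ?_)
      (enorm_heightCutoff_sub_one_smul_le hM₀ (htpos k) (fun x => c x • (u x - G x)) hx)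
    congr 2
    simp only [Pi.sub_apply, he, hθ, sub_smul, one_smul, smul_assoc]
  · rw [tendsto_eLpNorm_two_iff]
    set H : Rn d → ℝ≥0∞ := fun x => 16 * ‖Du x‖ₑ ^ 2 + 4 * (L : ℝ≥0∞) ^ 2 with hH
    set C : ℝ≥0∞ := ENNReal.ofReal (√(m * d) * (1 + M)) with hC
    set T : ℕ → ℝ≥0∞ := fun k => ENNReal.ofReal ((t k)⁻¹) with hT
    refine tendsto_lintegral_sq_zero_of_le (b := fun k x =>
      2 * (strip Φ ψ r (2 * t k)).indicator (fun x => ‖cutGrad c u Du G x‖ₑ ^ 2) x +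
      2 * (C * T k) ^ 2 * (strip Φ ψ r (2 * t k)).indicator (fun x => ‖u x - G x‖ₑ ^ 2) x)
      (fun k => ?_) ?_
    · filter_upwards [ae_restrict_mem hUopen.measurableSet,
        ae_restrict_of_ae (hc.ae_differentiableAt (μ := volume)),
        ae_restrict_of_ae ((hθlip k).ae_differentiableAt (μ := volume))] with x hx hcx hθx
      have hfd : fderiv ℝ (e k) x = θ k x • fderiv ℝ c x + c x • fderiv ℝ (θ k) x := by
        have := (hθx.hasFDerivAt.mul hcx.hasFDerivAt).fderiv
        exact this
      -- The first error tends to zero by absolute continuity of the integral; the second contains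
      -- the large gradient of the height cutoff and requires the zero trace.
      have e1 : cutGrad (e k) u Du G x - cutGrad c u Du G x =
          (heightCutoff Φ ψ (t k) x - 1) • cutGrad c u Du G x +
            c x • tensor (fderiv ℝ (θ k) x) (u x - G x) := by
        rw [cutGrad, cutGrad, hfd, tensor_add_left, tensor_smul_left, tensor_smul_left]
        simp only [he, hθ, smul_eq_mul]
        module
      rw [Pi.sub_apply, e1]
      refine (enorm_add_sq_le _ _).trans (add_le_add ?_ ?_)
      · gcongr
        exact enorm_heightCutoff_sub_one_smul_le hM₀ (htpos k) _ hx
      · rw [mul_assoc]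
        gcongr
        rcases le_or_gt (2 * t k) (height Φ ψ x) with h1 | h1
        · simp only [hθ]
          rw [fderiv_heightCutoff_eq_zero (htpos k) h1]
          simp
        · rw [indicator_of_mem (mem_strip_of_mem_boundaryCylinder hM₀ hx h1), ← mul_pow]
          gcongr
          rw [hC, hT, ← ofReal_norm, ← ofReal_norm (u x - G x),
            ← ENNReal.ofReal_mul (by positivity), ← ENNReal.ofReal_mul (by positivity)]
          refine ENNReal.ofReal_le_ofReal ?_
          rw [norm_smul, Real.norm_eq_abs]
          refine (mul_le_of_le_one_left (norm_nonneg _) (hc1 x)).trans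
            ((norm_tensor_le _ _).trans ?_)
          have h2 := norm_fderiv_le_of_lipschitz ℝ (hθlip k) (x₀ := x)
          push_cast at h2
          rw [Real.coe_toNNReal _ (inv_nonneg.2 (htpos k).le)] at h2
          have h3 := mul_le_mul_of_nonneg_right h2 (norm_nonneg (u x - G x))
          have h4 := mul_le_mul_of_nonneg_left h3 (Real.sqrt_nonneg ((m : ℝ) * d))
          linarith
    · have hstrip : ∀ (k : ℕ) (F : Rn d → ℝ≥0∞), ∫⁻ x in U, (strip Φ ψ r (2 * t k)).indicator F x =
          ∫⁻ x in strip Φ ψ r (2 * t k), F x := by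
        intro k F
        rw [lintegral_indicator (measurableSet_strip Φ hψ _ _),
          Measure.restrict_restrict (measurableSet_strip Φ hψ _ _),
          inter_eq_left.2 (strip_subset_boundaryCylinder hM₀ (htle k))]
      have hHm : AEMeasurable H (volume.restrict U) :=
        ((hDu.1.enorm.pow_const 2).const_mul 16).add_const _
      have hHfin : ∫⁻ x in U, H x ≠ ∞ := by
        rw [lintegral_add_right _ measurable_const, lintegral_const_mul' _ _ (by finiteness),
          lintegral_const, Measure.restrict_apply_univ, ← eLpNorm_two_sq]
        have := hDu.2.ne
        have := hb.measure_lt_top (μ := volume) |>.ne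
        finiteness
      have hlimH := tendsto_lintegral_strip hM₀ hψ hHm hHfin htlim
      have hle : ∀ k, ∫⁻ x in U,
          (2 * (strip Φ ψ r (2 * t k)).indicator (fun x => ‖cutGrad c u Du G x‖ₑ ^ 2) x +
          2 * (C * T k) ^ 2 * (strip Φ ψ r (2 * t k)).indicator (fun x => ‖u x - G x‖ₑ ^ 2) x) ≤
          2 * (∫⁻ x in U, (strip Φ ψ r (2 * t k)).indicator
            (fun x => ‖cutGrad c u Du G x‖ₑ ^ 2) x) +
          2 * (C * 2) ^ 2 * ∫⁻ x in U, (strip Φ ψ r (2 * t k)).indicator H x := by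
        intro k
        rw [lintegral_add_left' (((hmW.1.enorm.pow_const 2).indicator
          (measurableSet_strip Φ hψ _ _)).const_mul 2), lintegral_const_mul' _ _ (by finiteness),
          lintegral_const_mul' _ _ (by finiteness), hstrip k (fun x => ‖u x - G x‖ₑ ^ 2),
          hstrip k H]
        have h1 := lintegral_strip_le hψ (strip_subset_boundaryCylinder hM₀ (htle k)) hDu hv
          hvu hvDu hbd hG
        refine add_le_add le_rfl ((mul_le_mul_right h1 _).trans (le_of_eq ?_))
        -- The gradient of order `1 / t k` meets the strip height `2 t k`. The product is bounded,
        -- and the remaining integral over the strip tends to zero.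
        have h2 : T k * ENNReal.ofReal (2 * t k) = 2 := by
          rw [hT, ← ENNReal.ofReal_mul (inv_nonneg.2 (htpos k).le)]
          have : (t k)⁻¹ * (2 * t k) = 2 := by have := (htpos k).ne'; field_simp
          rw [this]; simp
        rw [← mul_assoc, mul_assoc 2, ← mul_pow, mul_assoc C, h2]
      have hlim := (ENNReal.Tendsto.const_mul (hsq hmW) (a := 2) (Or.inr (by finiteness))).add
        (ENNReal.Tendsto.const_mul hlimH (a := 2 * (C * 2) ^ 2) (Or.inr (by finiteness)))
      simp only [mul_zero, add_zero] at hlim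
      exact tendsto_of_tendsto_of_tendsto_of_le_of_le tendsto_const_nhds hlim (fun _ => zero_le) hle

end BoundaryTest

/-! ### Coefficients and the contrast function -/

section Coefficients

variable {d m : ℕ}

/-- The product of a coefficient matrix with a gradient. -/
def flux (B : Matrix (Fin m × Fin d) (Fin m × Fin d) ℝ) (ξ : Grad d m) : Grad d m :=
  WithLp.toLp 2 fun p => ∑ q, B p q * ξ q

theorem inner_flux (B : Matrix (Fin m × Fin d) (Fin m × Fin d) ℝ) (ξ η : Grad d m) :
    inner ℝ (flux B ξ) η = bilin B ξ η := by
  rw [PiLp.inner_apply, bilin]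
  refine Finset.sum_congr rfl fun p _ => ?_
  simp [flux, Finset.mul_sum, mul_comm]

theorem flux_smul (B : Matrix (Fin m × Fin d) (Fin m × Fin d) ℝ) (c : ℝ) (ξ : Grad d m) :
    flux B (c • ξ) = c • flux B ξ := by
  ext p
  simp [flux, Finset.mul_sum, mul_left_comm]

theorem flux_sub (B : Matrix (Fin m × Fin d) (Fin m × Fin d) ℝ) (ξ η : Grad d m) :
    flux B (ξ - η) = flux B ξ - flux B η := by
  ext p
  simp [flux, mul_sub]

theorem bilin_comm {B : Matrix (Fin m × Fin d) (Fin m × Fin d) ℝ} (hB : B.IsSymm)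
    (ξ η : Grad d m) : bilin B ξ η = bilin B η ξ := by
  rw [bilin, bilin, Finset.sum_comm]
  refine Finset.sum_congr rfl fun p _ => Finset.sum_congr rfl fun q _ => ?_
  rw [hB.apply p q]
  ring

theorem bilin_sub_sub {B : Matrix (Fin m × Fin d) (Fin m × Fin d) ℝ} (hB : B.IsSymm)
    (ξ η : Grad d m) :
    bilin B (ξ - η) (ξ - η) = bilin B ξ ξ - 2 * bilin B ξ η + bilin B η η := by
  have h := bilin_comm hB ξ η
  simp only [← inner_flux] at h ⊢
  rw [flux_sub, inner_sub_left, inner_sub_right, inner_sub_right, h]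
  ring

theorem bilin_smul_smul (B : Matrix (Fin m × Fin d) (Fin m × Fin d) ℝ) (a b : ℝ) (ξ η : Grad d m) :
    bilin B (a • ξ) (b • η) = a * b * bilin B ξ η := by
  simp only [← inner_flux]
  rw [flux_smul, inner_smul_left, inner_smul_right]
  simp [mul_assoc]

variable {μ lam τ : ℝ} {A : Coeff d m}

theorem IsAdmissibleCoeff.bilin_nonneg (hA : IsAdmissibleCoeff μ lam τ A) (hμ : 0 < μ) (y : Rn d)
    (ξ : Grad d m) : 0 ≤ bilin (A y) ξ ξ :=
  le_trans (by positivity) (hA.lower y ξ)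

/-- With `η = A ξ`, nonnegativity of the form at `μ⁻¹ ξ - η` and symmetry give `2 μ⁻¹ |η|² ≤ μ⁻³
|ξ|² + μ⁻¹ |η|²`. -/
theorem IsAdmissibleCoeff.norm_flux_le (hA : IsAdmissibleCoeff μ lam τ A) (hμ : 0 < μ) (y : Rn d)
    (ξ : Grad d m) : ‖flux (A y) ξ‖ ≤ μ⁻¹ * ‖ξ‖ := by
  set η := flux (A y) ξ with hη
  have h1 := hA.bilin_nonneg hμ y (μ⁻¹ • ξ - η)
  rw [bilin_sub_sub (hA.symm y)] at h1
  have h2 : bilin (A y) (μ⁻¹ • ξ) (μ⁻¹ • ξ) = μ⁻¹ * μ⁻¹ * bilin (A y) ξ ξ :=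
    bilin_smul_smul _ _ _ _ _
  have h3 : bilin (A y) (μ⁻¹ • ξ) η = μ⁻¹ * ‖η‖ ^ 2 := by
    have := bilin_smul_smul (A y) μ⁻¹ 1 ξ η
    rw [one_smul, mul_one, ← inner_flux (A y) ξ, ← hη, real_inner_self_eq_norm_sq] at this
    exact this
  have h4 := hA.upper y ξ
  have h5 := hA.upper y η
  have hi : 0 < μ⁻¹ := inv_pos.2 hμ
  rw [h2, h3] at h1
  have h6 : μ⁻¹ * μ⁻¹ * bilin (A y) ξ ξ ≤ μ⁻¹ * μ⁻¹ * (μ⁻¹ * ‖ξ‖ ^ 2) :=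
    mul_le_mul_of_nonneg_left h4 (by positivity)
  refine le_of_sq_le_sq ?_ (by positivity)
  have h7 : μ⁻¹ * ‖η‖ ^ 2 ≤ μ⁻¹ * (μ⁻¹ * ‖ξ‖) ^ 2 := by nlinarith
  exact le_of_mul_le_mul_left h7 hi

theorem IsAdmissibleCoeff.continuous_entry (hA : IsAdmissibleCoeff μ lam τ A) (hlam : 0 < lam)
    (p q : Fin m × Fin d) : Continuous fun y => A y p q := by
  rw [continuous_iff_continuousAt]
  intro w
  rw [ContinuousAt, tendsto_iff_norm_sub_tendsto_zero]
  have hbound : ∀ y, ‖A y p q - A w p q‖ ≤ τ * ‖y - w‖ ^ lam := by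
    intro y
    refine le_trans ?_ (hA.holder y w)
    refine Real.le_sqrt_of_sq_le ?_
    rw [Real.norm_eq_abs, sq_abs]
    refine (Finset.single_le_sum (f := fun q => (A y p q - A w p q) ^ 2)
      (fun _ _ => sq_nonneg _) (Finset.mem_univ q)).trans ?_
    exact Finset.single_le_sum (f := fun p => ∑ q, (A y p q - A w p q) ^ 2)
      (fun _ _ => Finset.sum_nonneg fun _ _ => sq_nonneg _) (Finset.mem_univ p)
  refine squeeze_zero (fun _ => norm_nonneg _) hbound ?_
  have : Continuous fun y : Rn d => τ * ‖y - w‖ ^ lam :=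
    continuous_const.mul ((continuous_id.sub continuous_const).norm.rpow_const
      fun _ => Or.inr hlam.le)
  exact this.tendsto' w 0 (by simp [hlam.ne'])

theorem IsAdmissibleCoeff.aestronglyMeasurable_flux (hA : IsAdmissibleCoeff μ lam τ A)
    (hlam : 0 < lam) (ε : ℝ) {Du : Rn d → Grad d m} {ν : Measure (Rn d)}
    (hDu : AEStronglyMeasurable Du ν) :
    AEStronglyMeasurable (fun x => flux (A (ε⁻¹ • x)) (Du x)) ν := by
  refine (PiLp.continuous_toLp 2 _).comp_aestronglyMeasurable
    (f := fun x p => ∑ q, A (ε⁻¹ • x) p q * Du x q) ?_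
  refine AEMeasurable.aestronglyMeasurable (aemeasurable_pi_lambda _ fun p => ?_)
  refine Finset.aemeasurable_fun_sum _ fun q _ => ?_
  refine AEMeasurable.mul ?_ ?_
  · exact ((hA.continuous_entry hlam p q).comp (continuous_const_smul ε⁻¹)).aemeasurable
  · exact ((PiLp.continuous_apply 2 _ q).comp_aestronglyMeasurable hDu).aemeasurable

variable {ω Ω : Set (Rn d)} {κ ε δ : ℝ}

theorem isOpen_inclusion (hω : IsOpen ω) (hε : 0 < ε) (k : Fin d → ℤ) :
    IsOpen (inclusion ω ε k) := by
  have h : IsOpenMap fun y : Rn d => ε • (latticePoint k + y) :=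
    (isOpenMap_smul₀ hε.ne').comp (isOpenMap_add_left (latticePoint k))
  exact h ω hω

theorem isOpen_inclusions (hω : IsOpen ω) (hε : 0 < ε) : IsOpen (inclusions ω Ω κ ε) :=
  isOpen_biUnion fun k _ => isOpen_inclusion hω hε k

theorem volume_frontier_inclusion (hω : volume (frontier ω) = 0) (hε : 0 < ε) (k : Fin d → ℤ) :
    volume (frontier (inclusion ω ε k)) = 0 := by
  let e : Rn d ≃ₜ Rn d := (Homeomorph.addLeft (latticePoint k)).trans (Homeomorph.smulOfNeZero ε hε.ne')
  have h : inclusion ω ε k = e '' ω := rfl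
  rw [h, ← e.image_frontier]
  refine addHaar_image_eq_zero_of_differentiableOn_of_addHaar_eq_zero volume ?_ hω
  have : Differentiable ℝ fun y : Rn d => ε • (latticePoint k + y) := by fun_prop
  exact this.differentiableOn

theorem locallyFinite_inclusion (hω : ω ⊆ unitCell d) (hε : 0 < ε) :
    LocallyFinite fun k : Fin d → ℤ => inclusion ω ε k := by
  intro x
  refine ⟨Metric.ball x ε, Metric.ball_mem_nhds x hε, ?_⟩
  set N : ℤ := ⌈‖x‖ / ε + 1 + √d⌉
  refine (Set.finite_Icc (fun _ => -N : Fin d → ℤ) (fun _ => N)).subset ?_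
  rintro k ⟨_, ⟨y, hy, rfl⟩, hz⟩
  rw [Metric.mem_ball, dist_eq_norm] at hz
  have h1 : ε * ‖latticePoint k‖ ≤ ‖x‖ + ε + ε * √d := by
    have e : ε • latticePoint k = (ε • (latticePoint k + y) - x) + x - ε • y := by
      rw [smul_add]; abel
    rw [← Real.norm_of_nonneg hε.le, ← norm_smul, Real.norm_of_nonneg hε.le, e]
    refine (norm_sub_le _ _).trans ?_
    have h2 := norm_add_le (ε • (latticePoint k + y) - x) x
    have h3 : ‖ε • y‖ ≤ ε * √d := by
      rw [norm_smul, Real.norm_of_nonneg hε.le]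
      exact mul_le_mul_of_nonneg_left (norm_le_of_mem_unitCell (hω hy)) hε.le
    linarith
  have h2 : ‖latticePoint k‖ ≤ N := by
    refine le_trans ?_ (Int.le_ceil _)
    rw [← mul_le_mul_iff_right₀ hε]
    refine h1.trans (le_of_eq ?_)
    field_simp
  have h3 : ∀ i, |(k i : ℝ)| ≤ N := fun i => (PiLp.norm_apply_le (latticePoint k) i).trans h2
  constructor
  · intro i
    have := (abs_le.1 (h3 i)).1
    exact_mod_cast this
  · intro i
    have := (abs_le.1 (h3 i)).2
    exact_mod_cast this

/-- The scaled inclusions form a locally finite family, so the closure of the union is the union of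
the closures and no new frontier points accumulate. -/
theorem volume_frontier_inclusions (hω : IsModelInclusion ω) (hε : 0 < ε) :
    volume (frontier (inclusions ω Ω κ ε)) = 0 := by
  set N : Set (Fin d → ℤ) := {k : Fin d → ℤ | inclusion ω ε k ⊆ Ω ∧
    ENNReal.ofReal (κ * ε) < setEDist (inclusion ω ε k) (frontier Ω)}
  have hlf : LocallyFinite fun k : Fin d → ℤ => ⋃ _ : k ∈ N, inclusion ω ε k :=
    (locallyFinite_inclusion hω.subset_cell hε).subset fun k => iUnion_subset fun _ => Subset.rfl
  rw [(isOpen_inclusions hω.isOpen hε).frontier_eq, inclusions, hlf.closure_iUnion]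
  refine measure_mono_null (t := ⋃ k : Fin d → ℤ, frontier (inclusion ω ε k)) ?_
    (measure_iUnion_null fun k =>
      volume_frontier_inclusion hω.lipschitz.volume_frontier_eq_zero hε k)
  rintro x ⟨hx, hnot⟩
  obtain ⟨k, hk⟩ := mem_iUnion.1 hx
  by_cases hkN : k ∈ N
  · simp only [hkN, iUnion_true] at hk
    refine mem_iUnion.2 ⟨k, ?_⟩
    rw [(isOpen_inclusion hω.isOpen hε k).frontier_eq]
    exact ⟨hk, fun hxk => hnot (mem_biUnion hkN hxk)⟩
  · simp [hkN] at hk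

theorem measurable_contrast (hω : IsOpen ω) (hΩ : IsOpen Ω) (hε : 0 < ε) :
    Measurable (contrast ω Ω κ ε δ) := by
  refine Measurable.add (Measurable.const_mul ?_ δ) ?_
  · exact measurable_one.indicator (isOpen_inclusions hω hε).measurableSet
  · exact measurable_one.indicator (hΩ.measurableSet.diff isClosed_closure.measurableSet)

theorem contrast_of_mem {x : Rn d} (hx : x ∈ inclusions ω Ω κ ε) :
    contrast ω Ω κ ε δ x = δ := by
  have : x ∉ Ω \ closure (inclusions ω Ω κ ε) := fun h => h.2 (subset_closure hx)
  simp [contrast, hx, this]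

theorem contrast_of_notMem {x : Rn d} (hΩ : x ∈ Ω) (hx : x ∉ closure (inclusions ω Ω κ ε)) :
    contrast ω Ω κ ε δ x = 1 := by
  have h1 : x ∉ inclusions ω Ω κ ε := fun h => hx (subset_closure h)
  have h2 : x ∈ Ω \ closure (inclusions ω Ω κ ε) := ⟨hΩ, hx⟩
  simp [contrast, h1, h2]

/-- Serves only to place the flux in `L²`; the bound by `δ` never enters the final constant. -/
theorem norm_contrast_le (hδ : 1 < δ) (x : Rn d) : ‖contrast ω Ω κ ε δ x‖ ≤ δ + 1 := by
  have h1 : ∀ S : Set (Rn d), 0 ≤ S.indicator (1 : Rn d → ℝ) x ∧ S.indicator (1 : Rn d → ℝ) x ≤ 1 :=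
    fun S => ⟨indicator_nonneg (fun _ _ => zero_le_one) x, indicator_le_self' (fun _ _ => zero_le_one) x⟩
  obtain ⟨a1, a2⟩ := h1 (inclusions ω Ω κ ε)
  obtain ⟨b1, b2⟩ := h1 (Ω \ closure (inclusions ω Ω κ ε))
  rw [contrast, Real.norm_of_nonneg (by positivity)]
  nlinarith

/-- Almost everywhere in `Ω`, the point lies in an inclusion or the contrast is one. -/
theorem ae_contrast (hω : IsModelInclusion ω) (hε : 0 < ε) :
    ∀ᵐ x, x ∈ Ω → (x ∈ inclusions ω Ω κ ε ∧ contrast ω Ω κ ε δ x = δ) ∨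
      contrast ω Ω κ ε δ x = 1 := by
  have h0 : ∀ᵐ x, x ∉ frontier (inclusions ω Ω κ ε) :=
    measure_eq_zero_iff_ae_notMem.1 (volume_frontier_inclusions hω hε)
  filter_upwards [h0] with x hx hxΩ
  by_cases h : x ∈ inclusions ω Ω κ ε
  · exact Or.inl ⟨h, contrast_of_mem h⟩
  · refine Or.inr (contrast_of_notMem hxΩ fun hcl => hx ?_)
    rw [(isOpen_inclusions hω.isOpen hε).frontier_eq]
    exact ⟨hcl, h⟩

end Coefficients

/-! ### The Caccioppoli inequality -/

section Caccioppoli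

variable {d m : ℕ}

theorem norm_add_sq_le_two_mul {V : Type*} [NormedAddCommGroup V] (a b : V) :
    ‖a + b‖ ^ 2 ≤ 2 * ‖a‖ ^ 2 + 2 * ‖b‖ ^ 2 := by
  nlinarith [norm_add_le a b, sq_nonneg (‖a‖ - ‖b‖), norm_nonneg (a + b), norm_nonneg a,
    norm_nonneg b]

theorem norm_sub_sq_le_two_mul {V : Type*} [NormedAddCommGroup V] (a b : V) :
    ‖a - b‖ ^ 2 ≤ 2 * ‖a‖ ^ 2 + 2 * ‖b‖ ^ 2 := by
  simpa [sub_eq_add_neg] using norm_add_sq_le_two_mul a (-b)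

/-- The pointwise energy estimate: absorb the cross term by completing the square. -/
theorem energy_pointwise {B : Matrix (Fin m × Fin d) (Fin m × Fin d) ℝ} {μ s t : ℝ} (hμ : 0 < μ)
    (hB : B.IsSymm) (hlow : ∀ ξ, μ * ‖ξ‖ ^ 2 ≤ bilin B ξ ξ)
    (hup : ∀ ξ, bilin B ξ ξ ≤ μ⁻¹ * ‖ξ‖ ^ 2) (ξ γ ρ : Grad d m) (hs : 1 ≤ s)
    (h : s = 1 ∨ t • γ - (2 : ℝ) • ρ = 0) :
    1 / 2 * μ * (t ^ 2 * ‖ξ‖ ^ 2) - 1 / 2 * μ⁻¹ * ‖t • γ - (2 : ℝ) • ρ‖ ^ 2 ≤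
      inner ℝ (s • flux B ξ) (t ^ 2 • (ξ - γ) + (2 * t) • ρ) := by
  set ζ := t • γ - (2 : ℝ) • ρ with hζ
  -- With `ζ` collecting the gradients of the extension and of the cutoff, the pairing becomes `s
  -- B(tξ, tξ - ζ)`.
  have e1 : t ^ 2 • (ξ - γ) + (2 * t) • ρ = t • (t • ξ - ζ) := by
    rw [hζ]; module
  have e2 : inner ℝ (s • flux B ξ) (t ^ 2 • (ξ - γ) + (2 * t) • ρ) =
      s * (bilin B (t • ξ) (t • ξ) - bilin B (t • ξ) ζ) := by
    rw [e1, ← inner_flux, ← inner_flux, ← inner_sub_right, flux_smul, real_inner_smul_left,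
      real_inner_smul_right, real_inner_smul_left]
  have h1 := bilin_sub_sub hB (t • ξ) ζ
  have h2 : 0 ≤ bilin B (t • ξ - ζ) (t • ξ - ζ) := le_trans (by positivity) (hlow _)
  have h3 := hlow (t • ξ)
  have h4 := hup ζ
  have h5 : ‖t • ξ‖ ^ 2 = t ^ 2 * ‖ξ‖ ^ 2 := by
    rw [norm_smul, mul_pow, Real.norm_eq_abs, sq_abs]
  rw [h5] at h3
  rw [e2]
  -- For `s = 1` the cross term is absorbed by `B(tξ - ζ, tξ - ζ) ≥ 0`; otherwise `ζ = 0`, and the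
  -- factor `s ≥ 1` only increases the energy.
  rcases h with rfl | h0
  · linarith
  · rw [h0] at *
    have h6 : bilin B (t • ξ) 0 = 0 := by rw [← inner_flux, inner_zero_right]
    rw [h6, norm_zero]
    have h7 : 0 ≤ μ * (t ^ 2 * ‖ξ‖ ^ 2) := by positivity
    nlinarith

theorem integrable_inner_of_memLp {α V : Type*} [MeasurableSpace α] [NormedAddCommGroup V]
    [InnerProductSpace ℝ V] {ν : Measure α} {a b : α → V} (ha : MemLp a 2 ν) (hb : MemLp b 2 ν) :
    Integrable (fun x => inner ℝ (a x) (b x)) ν := by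
  refine (ha.norm.integrable_mul hb.norm).mono (ha.1.inner hb.1) (Eventually.of_forall fun x => ?_)
  refine (norm_inner_le_norm _ _).trans (le_of_eq ?_)
  simp

/-- The energy estimate for a weak solution tested with `φ ^ 2 • (u - G)`, where `φ` and `G` are
constant where the contrast is not one. -/
theorem energy_estimate {U : Set (Rn d)} (hU : MeasurableSet U) (hfin : volume U ≠ ∞) {A : Coeff d m}
    {μ lam τ ε R L K S : ℝ} (hμ : 0 < μ) (hA : IsAdmissibleCoeff μ lam τ A) (hR : 0 < R)
    {Λ φ : Rn d → ℝ} {u f G : Rn d → Rn m} {Du : Rn d → Grad d m}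
    (hσ : MemLp (fun x => Λ x • flux (A (ε⁻¹ • x)) (Du x)) 2 (volume.restrict U))
    (hu : MemLp u 2 (volume.restrict U)) (hDu : MemLp Du 2 (volume.restrict U))
    (hf : MemLp f 2 (volume.restrict U))
    (htest : IsTestPair U (fun x => Λ x • flux (A (ε⁻¹ • x)) (Du x)) f
      (fun x => φ x ^ 2 • (u x - G x)) (cutGrad (fun x => φ x ^ 2) u Du G))
    (hφ : Continuous φ) (hφ1 : ∀ x, |φ x| ≤ 1) (hφd : ∀ᵐ x, DifferentiableAt ℝ φ x)
    (hφ0 : ∀ x, φ x = 0 → fderiv ℝ φ x = 0) (hφK : ∀ x, ‖fderiv ℝ φ x‖ ≤ K / R)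
    (hΛ : ∀ᵐ x ∂volume.restrict U,
      (1 ≤ Λ x ∧ fderiv ℝ φ x = 0 ∧ gradient G x = 0) ∨ Λ x = 1)
    (hGL : ∀ x, ‖gradient G x‖ ≤ L) (hGS : ∀ x ∈ U, φ x ≠ 0 → ‖G x‖ ≤ S) :
    1 / 2 * μ * ∫ x in U, φ x ^ 2 * ‖Du x‖ ^ 2 ≤
      (8 * μ⁻¹ * (m * d) * K ^ 2 + 1) / R ^ 2 * (∫ x in U, ‖u x‖ ^ 2) +
      1 / 2 * R ^ 2 * (∫ x in U, ‖f x‖ ^ 2) +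
      (μ⁻¹ * L ^ 2 + (8 * μ⁻¹ * (m * d) * K ^ 2 + 1) / R ^ 2 * S ^ 2) * volume.real U := by
  -- The cutoff contributes `4 μ⁻¹ m d K² / R²` and the force `1 / (2 R²)` in front of `|u - G|²`;
  -- the bound `|u - G|² ≤ 2 |u|² + 2 S²` doubles their sum.
  set α := 8 * μ⁻¹ * (m * d) * K ^ 2 + 1 with hα
  have : IsFiniteMeasure (volume.restrict U) := isFiniteMeasure_restrict.2 hfin
  have hμi : 0 < μ⁻¹ := inv_pos.2 hμ
  have hL : 0 ≤ L := (norm_nonneg _).trans (hGL 0)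
  set Q : Rn d → Rn m := fun x => u x - G x with hQ
  have hφsq : ∀ x, φ x ^ 2 ≤ 1 := fun x => by
    rw [← sq_abs]; exact pow_le_one₀ (abs_nonneg _) (hφ1 x)
  have hQS : ∀ x ∈ U, φ x ≠ 0 → ‖Q x‖ ^ 2 ≤ 2 * ‖u x‖ ^ 2 + 2 * S ^ 2 := by
    intro x hx h0
    have h1 := norm_sub_sq_le_two_mul (u x) (G x)
    have h2 : ‖G x‖ ^ 2 ≤ S ^ 2 := pow_le_pow_left₀ (norm_nonneg _) (hGS x hx h0) 2
    linarith
  have hpt : ∀ᵐ x ∂volume.restrict U, 1 / 2 * μ * (φ x ^ 2 * ‖Du x‖ ^ 2) ≤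
      inner ℝ (Λ x • flux (A (ε⁻¹ • x)) (Du x)) (cutGrad (fun x => φ x ^ 2) u Du G x) -
      inner ℝ (f x) (φ x ^ 2 • (u x - G x)) +
      (α / R ^ 2 * ‖u x‖ ^ 2 + 1 / 2 * R ^ 2 * ‖f x‖ ^ 2 +
        (μ⁻¹ * L ^ 2 + α / R ^ 2 * S ^ 2)) := by
    filter_upwards [ae_restrict_mem hU, ae_restrict_of_ae hφd, hΛ] with x hx hd hΛx
    set ρ := tensor (fderiv ℝ φ x) (Q x) with hρ
    have hcut : cutGrad (fun x => φ x ^ 2) u Du G x =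
        φ x ^ 2 • (Du x - gradient G x) + (2 * φ x) • ρ := by
      have h1 : fderiv ℝ (fun y => φ y ^ 2) x = (2 * φ x) • fderiv ℝ φ x := by
        have := (hd.hasFDerivAt.pow 2).fderiv
        simpa using this
      rw [cutGrad, h1, tensor_smul_left]
    have hΛ1 : 1 ≤ Λ x := by
      rcases hΛx with h | h
      · exact h.1
      · exact h.ge
    have hor : Λ x = 1 ∨ φ x • gradient G x - (2 : ℝ) • ρ = 0 := by
      rcases hΛx with ⟨_, h1, h2⟩ | h
      · right
        rw [hρ, h1, h2]
        simp
      · exact Or.inl h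
    have hen := energy_pointwise hμ (hA.symm (ε⁻¹ • x)) (hA.lower _) (hA.upper _) (Du x)
      (gradient G x) ρ hΛ1 hor
    rw [hcut]
    -- Where `φ` vanishes `G` is not controlled by `S`, but the test function and its gradient
    -- vanish there too.
    by_cases h0 : φ x = 0
    · have hρ0 : ρ = 0 := by rw [hρ, hφ0 x h0, tensor_zero_left]
      rw [h0, hρ0]
      simp only [ne_eq, OfNat.ofNat_ne_zero, not_false_eq_true, zero_pow, zero_mul, mul_zero,
        zero_smul, add_zero, inner_zero_right, sub_zero, zero_add]
      have : 0 ≤ α := by positivity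
      positivity
    · have hq := hQS x hx h0
      have hρle : ‖ρ‖ ^ 2 ≤ m * d * (K / R) ^ 2 * ‖Q x‖ ^ 2 := by
        have h1 : ‖ρ‖ ≤ √(m * d) * (K / R * ‖Q x‖) :=
          (norm_tensor_le _ _).trans (by gcongr; exact hφK x)
        have h2 := pow_le_pow_left₀ (norm_nonneg ρ) h1 2
        rw [mul_pow, Real.sq_sqrt (by positivity), mul_pow] at h2
        linarith
      have hζ : ‖φ x • gradient G x - (2 : ℝ) • ρ‖ ^ 2 ≤ 2 * L ^ 2 + 8 * ‖ρ‖ ^ 2 := by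
        have h1 := norm_sub_sq_le_two_mul (φ x • gradient G x) ((2 : ℝ) • ρ)
        have h2 : ‖φ x • gradient G x‖ ^ 2 ≤ L ^ 2 := by
          refine pow_le_pow_left₀ (norm_nonneg _) ?_ 2
          rw [norm_smul, Real.norm_eq_abs]
          exact (mul_le_of_le_one_left (norm_nonneg _) (hφ1 x)).trans (hGL x)
        have h3 : ‖(2 : ℝ) • ρ‖ ^ 2 = 4 * ‖ρ‖ ^ 2 := by
          rw [norm_smul, mul_pow]; norm_num
        linarith
      have hfw : inner ℝ (f x) (φ x ^ 2 • (u x - G x)) ≤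
          1 / 2 * R ^ 2 * ‖f x‖ ^ 2 + 1 / 2 * (1 / R ^ 2) * ‖Q x‖ ^ 2 := by
        have h1 : inner ℝ (f x) (φ x ^ 2 • (u x - G x)) ≤ ‖f x‖ * ‖Q x‖ := by
          refine (real_inner_le_norm _ _).trans ?_
          rw [norm_smul, Real.norm_of_nonneg (sq_nonneg _)]
          exact mul_le_mul_of_nonneg_left (mul_le_of_le_one_left (norm_nonneg _) (hφsq x))
            (norm_nonneg _)
        have h2 : 0 ≤ (R * ‖f x‖ - 1 / R * ‖Q x‖) ^ 2 := sq_nonneg _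
        have h3 : (R * ‖f x‖ - 1 / R * ‖Q x‖) ^ 2 =
            R ^ 2 * ‖f x‖ ^ 2 + 1 / R ^ 2 * ‖Q x‖ ^ 2 - 2 * (‖f x‖ * ‖Q x‖) := by
          field_simp; ring
        linarith
      have hm1 : μ⁻¹ * ‖φ x • gradient G x - (2 : ℝ) • ρ‖ ^ 2 ≤
          μ⁻¹ * (2 * L ^ 2 + 8 * (m * d * (K / R) ^ 2 * ‖Q x‖ ^ 2)) :=
        mul_le_mul_of_nonneg_left (hζ.trans (by linarith)) hμi.le
      have hm2 : α / R ^ 2 * ‖Q x‖ ^ 2 ≤ α / R ^ 2 * (2 * ‖u x‖ ^ 2 + 2 * S ^ 2) :=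
        mul_le_mul_of_nonneg_left hq (by positivity)
      have hm3 : 1 / 2 * (μ⁻¹ * (2 * L ^ 2 + 8 * (m * d * (K / R) ^ 2 * ‖Q x‖ ^ 2))) +
          1 / 2 * (1 / R ^ 2) * ‖Q x‖ ^ 2 = μ⁻¹ * L ^ 2 + 1 / 2 * (α / R ^ 2 * ‖Q x‖ ^ 2) := by
        rw [hα]; field_simp; ring
      linarith
  have hIu : Integrable (fun x => ‖u x‖ ^ 2) (volume.restrict U) := hu.integrable_norm_pow two_ne_zero
  have hIf : Integrable (fun x => ‖f x‖ ^ 2) (volume.restrict U) := hf.integrable_norm_pow two_ne_zero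
  have hIDu : Integrable (fun x => ‖Du x‖ ^ 2) (volume.restrict U) :=
    hDu.integrable_norm_pow two_ne_zero
  have hIφ : Integrable (fun x => φ x ^ 2 * ‖Du x‖ ^ 2) (volume.restrict U) := by
    refine hIDu.mono ((hφ.pow 2).aestronglyMeasurable.mul hIDu.1) (Eventually.of_forall fun x => ?_)
    rw [norm_mul, Real.norm_of_nonneg (sq_nonneg (φ x))]
    exact mul_le_of_le_one_left (norm_nonneg _) (hφsq x)
  have hI1 := integrable_inner_of_memLp hσ htest.memLp_grad
  have hI2 := integrable_inner_of_memLp hf htest.memLp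
  have hIu' := hIu.const_mul (α / R ^ 2)
  have hIf' := hIf.const_mul (1 / 2 * R ^ 2)
  have hIE : Integrable (fun x => α / R ^ 2 * ‖u x‖ ^ 2 + 1 / 2 * R ^ 2 * ‖f x‖ ^ 2 +
      (μ⁻¹ * L ^ 2 + α / R ^ 2 * S ^ 2)) (volume.restrict U) :=
    (hIu'.add hIf').add (integrable_const _)
  have hint := integral_mono_ae (hIφ.const_mul (1 / 2 * μ)) ((hI1.sub hI2).add hIE) hpt
  have e1 := integral_add (hI1.sub hI2) hIE
  have e2 := integral_sub hI1 hI2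
  have e3 := integral_add (hIu'.add hIf') (integrable_const (μ := volume.restrict U)
    (μ⁻¹ * L ^ 2 + α / R ^ 2 * S ^ 2))
  have e4 := integral_add hIu' hIf'
  have e5 := htest.integral_eq
  rw [integral_const_mul] at hint
  simp only [Pi.add_apply, Pi.sub_apply] at hint e1 e2 e3 e4
  rw [integral_const_mul, integral_const_mul] at e4
  rw [integral_const, smul_eq_mul, measureReal_restrict_apply_univ] at e3
  linarith

end Caccioppoli

/-! ### The boundary inequality with small inclusions -/

section SmallInclusions

variable {d : ℕ}

/-- The cutoff of the cylinder of radius `2 R` in terms of the cylinder gauge. -/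
def gaugeCutoff (M₀ : ℝ) (Φ : Rigid d) (ψ : Rn (d - 1) → ℝ) (R : ℝ) (x : Rn d) : ℝ :=
  max 0 (min 1 ((15 / 8 * R - cylinderGauge M₀ Φ ψ x) / (R / 4)))

theorem abs_gaugeCutoff_le_one (M₀ : ℝ) (Φ : Rigid d) (ψ : Rn (d - 1) → ℝ) (R : ℝ) (x : Rn d) :
    |gaugeCutoff M₀ Φ ψ R x| ≤ 1 := by
  rw [gaugeCutoff, abs_of_nonneg (le_max_left _ _)]
  exact max_le zero_le_one (min_le_left _ _)

variable {M₀ : ℝ} {Φ : Rigid d} {ψ : Rn (d - 1) → ℝ} {R : ℝ}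

theorem gaugeCutoff_eq_one (hR : 0 < R) {x : Rn d} (hx : cylinderGauge M₀ Φ ψ x ≤ 13 / 8 * R) :
    gaugeCutoff M₀ Φ ψ R x = 1 := by
  have : 1 ≤ (15 / 8 * R - cylinderGauge M₀ Φ ψ x) / (R / 4) := by
    rw [le_div_iff₀ (by positivity)]; linarith
  simp [gaugeCutoff, this]

theorem gaugeCutoff_eq_zero (hR : 0 < R) {x : Rn d} (hx : 15 / 8 * R ≤ cylinderGauge M₀ Φ ψ x) :
    gaugeCutoff M₀ Φ ψ R x = 0 := by
  refine max_eq_left ((min_le_right _ _).trans ?_)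
  exact div_nonpos_of_nonpos_of_nonneg (by linarith) (by positivity)

theorem lipschitzWith_gaugeCutoff {K : ℝ≥0} (hK : LipschitzWith K (cylinderGauge M₀ Φ ψ))
    (hR : 0 < R) : LipschitzWith (K * (4 / R).toNNReal) (gaugeCutoff M₀ Φ ψ R) := by
  refine LipschitzWith.const_max (LipschitzWith.const_min ?_ 1) 0
  refine LipschitzWith.of_dist_le_mul fun x y => ?_
  have := hK.dist_le_mul x y
  rw [Real.dist_eq] at this ⊢
  have e : (15 / 8 * R - cylinderGauge M₀ Φ ψ x) / (R / 4) -
      (15 / 8 * R - cylinderGauge M₀ Φ ψ y) / (R / 4) =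
      -(4 / R * (cylinderGauge M₀ Φ ψ x - cylinderGauge M₀ Φ ψ y)) := by field_simp; ring
  have h4 : 0 < 4 / R := by positivity
  rw [e, abs_neg, abs_mul, abs_of_pos h4]
  push_cast
  rw [Real.coe_toNNReal _ h4.le]
  nlinarith

theorem boundaryCylinder_mono (hM₀ : 0 < M₀) {r s : ℝ} (h : r ≤ s) :
    boundaryCylinder M₀ Φ ψ r ⊆ boundaryCylinder M₀ Φ ψ s := by
  intro x hx
  rw [mem_boundaryCylinder_iff hM₀] at hx ⊢
  exact ⟨hx.1.trans_le h, hx.2⟩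

theorem fderiv_comp_eq_zero_of_eventuallyEq {V W : Type*} [NormedAddCommGroup V] [NormedSpace ℝ V]
    [NormedAddCommGroup W] [NormedSpace ℝ W] {P : V → V} {h : V → W} {x : V}
    (hP : P =ᶠ[𝓝 x] fun _ => P x) : fderiv ℝ (fun y => h (P y)) x = 0 := by
  have : (fun y => h (P y)) =ᶠ[𝓝 x] fun _ => h (P x) := hP.fun_comp h
  rw [this.fderiv_eq]
  simp

/-- The Caccioppoli inequality at the boundary when the inclusions are small compared to the
cylinder. -/
theorem caccioppoli_of_small_inclusions {m : ℕ} (hd : 1 ≤ d) {μ lam τ κ : ℝ} (hμ : 0 < μ)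
    (hlam : 0 < lam) {ω Ω : Set (Rn d)} (hω : IsModelInclusion ω) (hΩ : IsOpen Ω)
    (hΩb : Bornology.IsBounded Ω) {M : ℝ≥0} {Kp Cb Ks : ℝ≥0}
    (hKp : ∀ (Ω : Set (Rn d)) (ε : ℝ), 0 < ε → ∃ P : Rn d → Rn d, LipschitzWith Kp P ∧
      (∀ x, dist (P x) x ≤ √d * ε) ∧ (∀ x ∈ frontier Ω, P x = x) ∧
      ∀ x ∈ inclusions ω Ω κ ε, P =ᶠ[𝓝 x] fun _ => P x)
    (hCb : ∀ {Ω : Set (Rn d)} {x₀ : Rn d} {M₀ r₀ : ℝ} {Φ : Rigid d} {ψ : Rn (d - 1) → ℝ} {r : ℝ},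
      IsBoundaryChart Ω x₀ M M₀ r₀ Φ ψ → 0 < r → r < r₀ → ∀ {g : Rn d → Rn m} {K : ℝ≥0},
      LipschitzOnWith K g (boundaryPortion Ω M₀ Φ ψ r) → ∃ g' : Rn (d - 1) → Rn m,
        LipschitzWith (Cb * (supNorm (boundaryPortion Ω M₀ Φ ψ r)
          (tangentialGradient Φ ψ g)).toNNReal) g' ∧
        (∀ x' ∈ Metric.closedBall 0 r, g' x' = g (graphMap Φ ψ x')) ∧
        ∀ x' ∈ Metric.ball 0 r, ‖g' x'‖ ≤ supNorm (boundaryPortion Ω M₀ Φ ψ r) g)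
    {A : Coeff d m} (hA : IsAdmissibleCoeff μ lam τ A) {ε δ : ℝ} (hε : 0 < ε) (hδ : 1 < δ)
    (hKs : LipschitzWith Ks (cylinderGauge M₀ Φ ψ)) (hRε : 16 * Ks * √d * ε ≤ R) (hR : 0 < R)
    {x₀ : Rn d} {r₀ : ℝ} (hchart : IsBoundaryChart Ω x₀ M M₀ r₀ Φ ψ) (hr₀ : 2 * R < r₀)
    {u f g : Rn d → Rn m} {Du : Rn d → Grad d m} (hu : IsH1 (boundaryCylinder M₀ Φ ψ (2 * R)) u Du)
    (hf : MemLp f 2 (volume.restrict (boundaryCylinder M₀ Φ ψ (2 * R))))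
    (hg : ∃ K : ℝ≥0, LipschitzOnWith K g (boundaryPortion Ω M₀ Φ ψ (2 * R)))
    (hweak : IsWeakSolution (boundaryCylinder M₀ Φ ψ (2 * R)) (contrast ω Ω κ ε δ) A ε Du f)
    (htrace : HasTrace (boundaryCylinder M₀ Φ ψ (2 * R)) (boundaryPortion Ω M₀ Φ ψ (2 * R))
      u Du g) :
    1 / 2 * μ * (∫ x in boundaryCylinder M₀ Φ ψ (3 * R / 2), ‖Du x‖ ^ 2) ≤
      (8 * μ⁻¹ * (m * d) * (4 * Ks * Kp : ℝ) ^ 2 + 1) / R ^ 2 *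
        (∫ x in boundaryCylinder M₀ Φ ψ (2 * R), ‖u x‖ ^ 2) +
      1 / 2 * R ^ 2 * (∫ x in boundaryCylinder M₀ Φ ψ (2 * R), ‖f x‖ ^ 2) +
      (μ⁻¹ * (√(m * d) * (Cb * supNorm (boundaryPortion Ω M₀ Φ ψ (2 * R))
          (tangentialGradient Φ ψ g) * Kp)) ^ 2 +
        (8 * μ⁻¹ * (m * d) * (4 * Ks * Kp : ℝ) ^ 2 + 1) / R ^ 2 *
          supNorm (boundaryPortion Ω M₀ Φ ψ (2 * R)) g ^ 2) * volume.real Ω := by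
  have hM₀ := hchart.pos_height
  have hψ := hchart.lipschitz
  set U := boundaryCylinder M₀ Φ ψ (2 * R) with hUdef
  set Γ := boundaryPortion Ω M₀ Φ ψ (2 * R) with hΓ
  set T := supNorm Γ (tangentialGradient Φ ψ g) with hT
  have hUΩ : U ⊆ Ω := hchart.boundaryCylinder_subset hr₀.le
  have hUb : Bornology.IsBounded U := hΩb.subset hUΩ
  have hUo : IsOpen U := isOpen_boundaryCylinder hM₀ Φ hψ _
  have h2R : 0 < 2 * R := by positivity
  obtain ⟨P, hP, hPd, hPfr, hPinc⟩ := hKp Ω ε hε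
  obtain ⟨Kg, hKg⟩ := hg
  obtain ⟨g', hg', hgg', hg'S⟩ := hCb hchart h2R hr₀ hKg
  obtain ⟨v, hv, hvu, hvDu, hvg⟩ := htrace
  -- The shift by `P` changes the gauge by at most `Ks √d ε ≤ R / 16`. The transition from `13R/8`
  -- to `15R/8` leaves room for this: `φ` is one for gauge up to `25R/16`, beyond `3R/2`, and zero
  -- from `31R/16` on, short of `2R`.
  have hgauge : ∀ x, |cylinderGauge M₀ Φ ψ (P x) - cylinderGauge M₀ Φ ψ x| ≤ R / 16 := by
    intro x
    have h1 := hKs.dist_le_mul (P x) x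
    rw [Real.dist_eq] at h1
    refine h1.trans ?_
    have h2 := mul_le_mul_of_nonneg_left (hPd x) Ks.coe_nonneg
    linarith
  -- Composition with `P` makes both functions locally constant on the inclusions.
  set G : Rn d → Rn m := fun x => g' (localBase Φ (P x)) with hGdef
  set φ : Rn d → ℝ := fun x => gaugeCutoff M₀ Φ ψ R (P x) with hφdef
  have hG : LipschitzWith (Cb * T.toNNReal * (1 * Kp)) G :=
    hg'.comp ((lipschitzWith_localBase Φ).comp hP)
  have hφ : LipschitzWith (Ks * (4 / R).toNNReal * Kp) φ :=
    (lipschitzWith_gaugeCutoff hKs hR).comp hP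
  have hφ1 : ∀ x, |φ x| ≤ 1 := fun x => abs_gaugeCutoff_le_one _ _ _ _ _
  have hφzero : ∀ x, 31 / 16 * R ≤ cylinderGauge M₀ Φ ψ x → φ x = 0 := by
    intro x hx
    refine gaugeCutoff_eq_zero hR ?_
    have := (abs_le.1 (hgauge x)).1
    linarith
  have hφone : ∀ x ∈ boundaryCylinder M₀ Φ ψ (3 * R / 2), φ x = 1 := by
    intro x hx
    refine gaugeCutoff_eq_one hR ?_
    have h1 := ((mem_boundaryCylinder_iff hM₀ Φ ψ).1 hx).1
    have := (abs_le.1 (hgauge x)).2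
    linarith
  have hsq : LipschitzWith (Ks * (4 / R).toNNReal * Kp * 1 + Ks * (4 / R).toNNReal * Kp)
      fun x => φ x ^ 2 := by
    have h := lipschitzWith_smul_of_eq_zero (S := univ) (B := 1) hφ hφ1
      (fun x hx => (hx trivial).elim) hφ.lipschitzOnWith fun x _ => hφ1 x
    refine (funext fun x => ?_ : (fun x => φ x • φ x) = fun x => φ x ^ 2) ▸ h
    rw [smul_eq_mul, sq]
  have hsq1 : ∀ x, |φ x ^ 2| ≤ 1 := fun x => by
    rw [abs_pow]; exact pow_le_one₀ (abs_nonneg _) (hφ1 x)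
  set σ : Rn d → Grad d m := fun x => contrast ω Ω κ ε δ x • flux (A (ε⁻¹ • x)) (Du x) with hσdef
  have hσ : MemLp σ 2 (volume.restrict U) := by
    refine hu.memLp_grad.of_le_mul (c := (δ + 1) * μ⁻¹)
      ((measurable_contrast hω.isOpen hΩ hε).aestronglyMeasurable.smul
        (hA.aestronglyMeasurable_flux hlam ε hu.memLp_grad.1)) (Eventually.of_forall fun x => ?_)
    rw [hσdef, norm_smul, mul_assoc]
    exact mul_le_mul (norm_contrast_le hδ x) (hA.norm_flux_le hμ _ _) (norm_nonneg _) (by linarith)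
  have hweak' : ∀ η : Rn d → Rn m, ContDiff ℝ (⊤ : ℕ∞) η → HasCompactSupport η → tsupport η ⊆ U →
      ∫ x in U, inner ℝ (σ x) (gradient η x) = ∫ x in U, inner ℝ (f x) (η x) := by
    intro η h1 h2 h3
    rw [← hweak η h1 h2 h3]
    simp only [hσdef, real_inner_smul_left, inner_flux, gradient]
  -- Since `P` fixes `∂Ω`, collapsing does not alter the boundary values.
  have hGgraph : ∀ x' ∈ Metric.ball (0 : Rn (d - 1)) (2 * R), G (graphMap Φ ψ x') = g' x' := by
    intro x' hx'
    simp only [hGdef]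
    rw [hPfr _ (hchart.graphMap_mem h2R hr₀ (Metric.ball_subset_closedBall hx')).2,
      localBase_graphMap]
  have hbd : Tendsto (fun n => ∫⁻ x' in Metric.ball 0 (2 * R),
      ‖v n (graphMap Φ ψ x') - G (graphMap Φ ψ x')‖ₑ ^ 2) atTop (𝓝 0) := by
    rw [tendsto_eLpNorm_two_iff] at hvg
    refine tendsto_of_tendsto_of_tendsto_of_le_of_le tendsto_const_nhds hvg
      (fun _ => zero_le) fun n => ?_
    set H : Rn d → ℝ≥0∞ := fun x => ‖v n x - g' (localBase Φ x)‖ₑ ^ 2 with hH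
    have hHm : Measurable fun x' => H (graphMap Φ ψ x') := by
      have hc : Continuous fun x => v n x - g' (localBase Φ x) :=
        (hv n).continuous.sub (hg'.continuous.comp (lipschitzWith_localBase Φ).continuous)
      exact (hc.comp (lipschitzWith_graphMap Φ hψ).continuous).enorm.measurable.pow_const 2
    have h1 := hchart.lintegral_graphMap_le hd h2R hr₀ hHm
    calc ∫⁻ x' in Metric.ball 0 (2 * R), ‖v n (graphMap Φ ψ x') - G (graphMap Φ ψ x')‖ₑ ^ 2
        = ∫⁻ x' in Metric.ball 0 (2 * R), H (graphMap Φ ψ x') := by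
          refine setLIntegral_congr_fun measurableSet_ball fun x' hx' => ?_
          simp only [hH, localBase_graphMap]
          rw [hGgraph x' hx']
      _ ≤ ∫⁻ x' in Metric.closedBall 0 (2 * R), H (graphMap Φ ψ x') :=
          lintegral_mono_set Metric.ball_subset_closedBall
      _ ≤ ∫⁻ x, H x ∂surfaceMeasure Γ := h1
      _ = ∫⁻ x, ‖v n x - g x‖ₑ ^ 2 ∂surfaceMeasure Γ := by
          refine setLIntegral_congr_fun (measurableSet_boundaryPortion _ _ _ _ _) fun x hx => ?_
          obtain ⟨h2, h3⟩ := (hchart.mem_boundaryPortion_iff h2R hr₀).1 hx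
          simp only [hH]
          rw [hgg' _ (by simpa using h2), graphMap_localBase h3]
  have htest := isTestPair_cut_of_cylinderGauge hM₀ hψ h2R hUb hσ hf hweak' hu.memLp hu.memLp_grad
    hv hvu hvDu hbd hG hsq hsq1 (r' := 31 / 16 * R) (by linarith)
    (fun x hx => by rw [hφzero x hx]; norm_num)
  -- Zero is the minimum of the cutoff.
  have hfd0 : ∀ x, φ x = 0 → fderiv ℝ φ x = 0 := by
    intro x hx
    refine IsLocalMin.fderiv_eq_zero (Eventually.of_forall fun y => ?_)
    rw [hx]
    exact le_max_left _ _
  have hfdK : ∀ x, ‖fderiv ℝ φ x‖ ≤ 4 * Ks * Kp / R := by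
    intro x
    refine (norm_fderiv_le_of_lipschitz ℝ hφ).trans (le_of_eq ?_)
    push_cast
    rw [Real.coe_toNNReal _ (by positivity)]
    ring
  have hΛ : ∀ᵐ x ∂volume.restrict U, (1 ≤ contrast ω Ω κ ε δ x ∧ fderiv ℝ φ x = 0 ∧
      gradient G x = 0) ∨ contrast ω Ω κ ε δ x = 1 := by
    filter_upwards [ae_restrict_mem hUo.measurableSet, ae_restrict_of_ae (ae_contrast (Ω := Ω)
      (κ := κ) (δ := δ) hω hε)] with x hx hcx
    rcases hcx (hUΩ hx) with ⟨h1, h2⟩ | h1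
    · refine Or.inl ⟨by rw [h2]; exact hδ.le, ?_, ?_⟩
      · exact fderiv_comp_eq_zero_of_eventuallyEq (hPinc x h1)
      · have : fderiv ℝ G x = 0 :=
          fderiv_comp_eq_zero_of_eventuallyEq (h := fun y => g' (localBase Φ y)) (hPinc x h1)
        rw [gradient, this, gradOf_zero]
    · exact Or.inr h1
  have hGL : ∀ x, ‖gradient G x‖ ≤ √(m * d) * (Cb * T * Kp) := by
    intro x
    have := norm_gradient_le hG x
    push_cast at this
    rwa [Real.coe_toNNReal _ (supNorm_nonneg _ _), one_mul] at this
  have hGS : ∀ x ∈ U, φ x ≠ 0 → ‖G x‖ ≤ supNorm Γ g := by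
    intro x _ hx
    refine hg'S _ ?_
    -- The cutoff at `x` is nonzero only if the moved point `P x` lies over the ball of radius `2R`,
    -- where the extension obeys the supremum bound.
    have h1 : cylinderGauge M₀ Φ ψ (P x) < 15 / 8 * R := by
      by_contra hcon
      exact hx (gaugeCutoff_eq_zero hR (not_lt.1 hcon))
    have h2 : ‖localBase Φ (P x)‖ < 2 * R := (le_max_left _ _).trans_lt (h1.trans (by linarith))
    simpa using h2
  have hen := energy_estimate hUo.measurableSet hUb.measure_lt_top.ne hμ hA hR hσ hu.memLp
    hu.memLp_grad hf htest hφ.continuous hφ1 (hφ.ae_differentiableAt) hfd0 hfdK hΛ hGL hGS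
  have hIDu : IntegrableOn (fun x => φ x ^ 2 * ‖Du x‖ ^ 2) U := by
    have hI : Integrable (fun x => ‖Du x‖ ^ 2) (volume.restrict U) :=
      hu.memLp_grad.integrable_norm_pow two_ne_zero
    refine hI.mono ((hφ.continuous.pow 2).aestronglyMeasurable.mul hI.1)
      (Eventually.of_forall fun x => ?_)
    rw [norm_mul, Real.norm_eq_abs]
    exact mul_le_of_le_one_left (norm_nonneg _) (hsq1 x)
  have hsub : boundaryCylinder M₀ Φ ψ (3 * R / 2) ⊆ U := boundaryCylinder_mono hM₀ (by linarith)
  have hI32 : ∫ x in boundaryCylinder M₀ Φ ψ (3 * R / 2), ‖Du x‖ ^ 2 ≤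
      ∫ x in U, φ x ^ 2 * ‖Du x‖ ^ 2 := by
    have e : ∫ x in boundaryCylinder M₀ Φ ψ (3 * R / 2), ‖Du x‖ ^ 2 =
        ∫ x in boundaryCylinder M₀ Φ ψ (3 * R / 2), φ x ^ 2 * ‖Du x‖ ^ 2 := by
      refine setIntegral_congr_fun (isOpen_boundaryCylinder hM₀ Φ hψ _).measurableSet
        fun x hx => ?_
      rw [hφone x hx]
      ring
    rw [e]
    exact setIntegral_mono_set hIDu (Eventually.of_forall fun x => by positivity)
      hsub.eventuallyLE
  refine (mul_le_mul_of_nonneg_left hI32 (by positivity)).trans (hen.trans ?_)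
  have hvol : volume.real U ≤ volume.real Ω :=
    measureReal_mono hUΩ hΩb.measure_lt_top.ne
  gcongr

end SmallInclusions

end HighContrast

end
-- The theorem: the regimes of large and small `R / ε`.
open HighContrast in
theorem theorem5p8 (d m : ℕ) (hd : 2 ≤ d) (hm : 1 ≤ m)
    (μ lam τ κ : ℝ) (hμ : 0 < μ) (hlam : 0 < lam ∧ lam < 1) (hτ : 0 < τ) (hκ : 0 < κ)
    (ω Ω : Set (Rn d)) (hω : IsModelInclusion ω) (hΩ : IsBoundedLipschitzDomain Ω)
    (M : ℝ≥0) (M₀ : ℝ) (hM₀ : 0 < M₀) (l : ℕ) (hl : 1 ≤ l) :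
    ∃ C : ℝ, 0 < C ∧
      ∀ A : Coeff d m, IsAdmissibleCoeff μ lam τ A →
      ∀ ε : ℝ, 0 < ε → ε < 1 → ∀ δ : ℝ, 1 < δ → ∀ R : ℝ, 32 * ε ≤ R →
      ∀ x₀ ∈ frontier Ω, ∀ (r₀ : ℝ) (Φ : Rigid d) (ψ : Rn (d - 1) → ℝ),
        IsBoundaryChart Ω x₀ M M₀ r₀ Φ ψ → 2 * R < r₀ →
      ∀ (u : Rn d → Rn m) (Du : Rn d → Grad d m) (f g : Rn d → Rn m),
        IsH1 (boundaryCylinder M₀ Φ ψ (2 * R)) u Du →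
        MemLp f 2 (volume.restrict (boundaryCylinder M₀ Φ ψ (2 * R))) →
        (∃ K : ℝ≥0, LipschitzOnWith K g (boundaryPortion Ω M₀ Φ ψ (2 * R))) →
        IsWeakSolution (boundaryCylinder M₀ Φ ψ (2 * R)) (contrast ω Ω κ ε δ) A ε Du f →
        HasTrace (boundaryCylinder M₀ Φ ψ (2 * R)) (boundaryPortion Ω M₀ Φ ψ (2 * R)) u Du g →
        (∫ x in boundaryCylinder M₀ Φ ψ (3 * R / 2), ‖Du x‖ ^ 2) ≤
          C / R ^ 2 * (∫ x in boundaryCylinder M₀ Φ ψ (2 * R), ‖u x‖ ^ 2)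
          + C * (ε / R) ^ (2 * l) * (∫ x in boundaryCylinder M₀ Φ ψ (2 * R), ‖Du x‖ ^ 2)
          + C * (R ^ 2 * (∫ x in boundaryCylinder M₀ Φ ψ (2 * R), ‖f x‖ ^ 2)
            + 1 / R ^ 2 * supNorm (boundaryPortion Ω M₀ Φ ψ (2 * R)) g ^ 2
            + supNorm (boundaryPortion Ω M₀ Φ ψ (2 * R)) (tangentialGradient Φ ψ g) ^ 2) := by
  have hd1 : 1 ≤ d := by omega
  obtain ⟨Kp, hKp⟩ := exists_collapse hω hκ
  obtain ⟨Cb, hCb⟩ := exists_boundary_extension d m hd1 M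
  set Ks : ℝ≥0 := max 1 ((1 + M) * ‖M₀⁻¹‖₊) with hKs
  -- `N ε ≤ R` guarantees `16 Ks √d ε ≤ R`, the smallness required of the inclusions.
  set N : ℝ := 16 * Ks * √d + 1 with hN
  have hN1 : 1 ≤ N := by
    have : 0 ≤ 16 * (Ks : ℝ) * √d := by positivity
    linarith
  set α : ℝ := 8 * μ⁻¹ * (m * d) * (4 * Ks * Kp : ℝ) ^ 2 + 1 with hα
  have hα0 : 0 ≤ α := by positivity
  set V : ℝ := volume.real Ω with hV
  have hV0 : 0 ≤ V := measureReal_nonneg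
  set β : ℝ := μ⁻¹ * (√(m * d) * (Cb * Kp)) ^ 2 with hβ
  have hβ0 : 0 ≤ β := by positivity
  -- Dominates the four coefficients left after division by `μ / 2`. The volume of `Ω` enters
  -- because suprema of the boundary data are integrated over the cylinder.
  set C₀ : ℝ := 2 * μ⁻¹ * (α + 1 / 2 + (β + α) * V) with hC₀
  have hC₀0 : 0 ≤ C₀ := by positivity
  refine ⟨N ^ (2 * l) + C₀, by positivity, ?_⟩
  intro A hA ε hε _ δ hδ R hRε x₀ _ r₀ Φ ψ hchart hr₀ u Du f g hu hf hg hweak htrace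
  have hR : 0 < R := by linarith
  have hIu : 0 ≤ ∫ x in boundaryCylinder M₀ Φ ψ (2 * R), ‖u x‖ ^ 2 :=
    integral_nonneg fun x => by positivity
  have hIf : 0 ≤ ∫ x in boundaryCylinder M₀ Φ ψ (2 * R), ‖f x‖ ^ 2 :=
    integral_nonneg fun x => by positivity
  have hIDu : 0 ≤ ∫ x in boundaryCylinder M₀ Φ ψ (2 * R), ‖Du x‖ ^ 2 :=
    integral_nonneg fun x => by positivity
  have hC : 0 ≤ N ^ (2 * l) + C₀ := by positivity
  rcases le_or_gt (N * ε) R with hsmall | hlarge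
  · have hmain := caccioppoli_of_small_inclusions hd1 hμ hlam.1 hω hΩ.isOpen hΩ.bounded hKp hCb hA
      hε hδ (lipschitzWith_cylinderGauge M₀ Φ hchart.lipschitz) (by rw [← hKs]; nlinarith) hR hchart
      hr₀ hu hf hg hweak htrace
    rw [← hKs, ← hα, ← hV] at hmain
    set I := ∫ x in boundaryCylinder M₀ Φ ψ (3 * R / 2), ‖Du x‖ ^ 2
    set Iu := ∫ x in boundaryCylinder M₀ Φ ψ (2 * R), ‖u x‖ ^ 2
    set If := ∫ x in boundaryCylinder M₀ Φ ψ (2 * R), ‖f x‖ ^ 2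
    set S := supNorm (boundaryPortion Ω M₀ Φ ψ (2 * R)) g
    set T := supNorm (boundaryPortion Ω M₀ Φ ψ (2 * R)) (tangentialGradient Φ ψ g)
    have hle : C₀ ≤ N ^ (2 * l) + C₀ := by
      have : 0 ≤ N ^ (2 * l) := by positivity
      linarith
    have h1 : I ≤ 2 * μ⁻¹ * (α / R ^ 2 * Iu + 1 / 2 * R ^ 2 * If +
        (μ⁻¹ * (√(m * d) * (Cb * T * Kp)) ^ 2 + α / R ^ 2 * S ^ 2) * V) := by
      have h2 := mul_le_mul_of_nonneg_left hmain (show (0 : ℝ) ≤ 2 * μ⁻¹ by positivity)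
      have h3 : 2 * μ⁻¹ * (1 / 2 * μ * I) = I := by field_simp
      rwa [h3] at h2
    have h4 : 2 * μ⁻¹ * (α / R ^ 2 * Iu + 1 / 2 * R ^ 2 * If +
        (μ⁻¹ * (√(m * d) * (Cb * T * Kp)) ^ 2 + α / R ^ 2 * S ^ 2) * V) =
        2 * μ⁻¹ * α * (Iu / R ^ 2) + 2 * μ⁻¹ * (1 / 2) * (R ^ 2 * If) +
        2 * μ⁻¹ * (β * V) * T ^ 2 + 2 * μ⁻¹ * (α * V) * (1 / R ^ 2 * S ^ 2) := by
      rw [hβ]; ring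
    have hμi : 0 < μ⁻¹ := inv_pos.2 hμ
    have hαV : 0 ≤ α * V := mul_nonneg hα0 hV0
    have hβV : 0 ≤ β * V := mul_nonneg hβ0 hV0
    have k1 : 2 * μ⁻¹ * α ≤ C₀ := mul_le_mul_of_nonneg_left (by linarith) (by positivity)
    have k2 : 2 * μ⁻¹ * (1 / 2) ≤ C₀ := mul_le_mul_of_nonneg_left (by linarith) (by positivity)
    have k3 : 2 * μ⁻¹ * (β * V) ≤ C₀ := mul_le_mul_of_nonneg_left (by linarith) (by positivity)
    have k4 : 2 * μ⁻¹ * (α * V) ≤ C₀ := mul_le_mul_of_nonneg_left (by linarith) (by positivity)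
    have n1 := mul_le_mul_of_nonneg_right (k1.trans hle) (show 0 ≤ Iu / R ^ 2 by positivity)
    have n2 := mul_le_mul_of_nonneg_right (k2.trans hle) (show 0 ≤ R ^ 2 * If by positivity)
    have n3 := mul_le_mul_of_nonneg_right (k3.trans hle) (show 0 ≤ T ^ 2 by positivity)
    have n4 := mul_le_mul_of_nonneg_right (k4.trans hle) (show 0 ≤ 1 / R ^ 2 * S ^ 2 by positivity)
    have n5 : 0 ≤ (N ^ (2 * l) + C₀) * (ε / R) ^ (2 * l) *
        ∫ x in boundaryCylinder M₀ Φ ψ (2 * R), ‖Du x‖ ^ 2 := by positivity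
    have e1 : (N ^ (2 * l) + C₀) / R ^ 2 * Iu = (N ^ (2 * l) + C₀) * (Iu / R ^ 2) := by ring
    rw [e1]
    linarith
  -- Here `R < N ε`, so the gradient term on the right has coefficient at least one and dominates by
  -- monotonicity of the domain.
  · have h1 : 1 ≤ (N ^ (2 * l) + C₀) * (ε / R) ^ (2 * l) := by
      have h2 : 1 ≤ (N * (ε / R)) ^ (2 * l) := by
        refine one_le_pow₀ ?_
        rw [← mul_div_assoc, one_le_div hR]
        exact hlarge.le
      rw [mul_pow] at h2
      have h3 : 0 ≤ C₀ * (ε / R) ^ (2 * l) := by positivity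
      linarith
    have h2 : ∫ x in boundaryCylinder M₀ Φ ψ (3 * R / 2), ‖Du x‖ ^ 2 ≤
        ∫ x in boundaryCylinder M₀ Φ ψ (2 * R), ‖Du x‖ ^ 2 :=
      setIntegral_mono_set (hu.memLp_grad.integrable_norm_pow two_ne_zero)
        (Eventually.of_forall fun x => by positivity)
        (boundaryCylinder_mono hM₀ (by linarith)).eventuallyLE
    have h3 := mul_le_mul_of_nonneg_right h1 hIDu
    have h4 : 0 ≤ (N ^ (2 * l) + C₀) / R ^ 2 *
        ∫ x in boundaryCylinder M₀ Φ ψ (2 * R), ‖u x‖ ^ 2 := by positivity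
    have h5 : 0 ≤ (N ^ (2 * l) + C₀) *
        (R ^ 2 * (∫ x in boundaryCylinder M₀ Φ ψ (2 * R), ‖f x‖ ^ 2)
          + 1 / R ^ 2 * supNorm (boundaryPortion Ω M₀ Φ ψ (2 * R)) g ^ 2
          + supNorm (boundaryPortion Ω M₀ Φ ψ (2 * R)) (tangentialGradient Φ ψ g) ^ 2) := by
      positivity
    linarith
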